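/- All algebras are associative unital over $\mathbb C$. Let $H$ be a Hopf algebra, $B$ an algebra, and $I$ a finite set. Let $\mathcal P$ be a locally trivial quantum principal fibre bundle with structure group $H$ and base $B$: $\mathcal P$ is a right $H$-comodule algebra with coaction $\Delta_{\mathcal P}$; $(J_i)_{i\in I}$ are two-sided ideals of $B$ forming a complete covering; with $B_i=B/J_i$, $\chi_i:\mathcal P\to B_i\otimes H$ are surjective homomorphisms with $(\mathrm{id}\otimes\Delta)\chi_i=(\chi_i\otimes \mathrm{id})\Delta_{\mathcal P}$ whose kernels form a complete covering of $\mathcal P$; and $\iota:B\to\mathcal P$ is an injective homomorphism with $\chi_i(\iota(b))=\pi_i(b)\otimes 1$ (where $\pi_i:B\to B_i$ is the projection) and $\iota(B)=\{p:\Delta_{\mathcal P}(p)=p\otimes 1\}$. (A family of ideals $K_i$ of an algebra $A$ is a complete covering if $\bigcap_i K_i=0$ and each family in $\prod_i A/K_i$ whose members agree in all $A/(K_i+K_j)$ comes from an element of $A$.) Put $B_{ij}=B/(J_i+J_j)$ and let $\tau_{ij}:H\to B_{ij}$ be the transition functions, $\tau_{ij}(h)=(\mathrm{id}\otimes\varepsilon)(\pi^j_i\otimes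 \mathrm{id})\chi_j(p)$ for any $p\in\mathcal P$ with $\chi_i(p)=1\otimes h$, where $\pi^j_i:B_j\to B_{ij}$ is the projection. A differential calculus over an algebra $A$ is a differential graded algebra $\Gamma(A)=\bigoplus_{n\ge 0}\Gamma^n(A)$ with $\Gamma^0(A)=A$, generated by $A$ and $dA$. Let differential calculi $\Gamma(B_i)$ and a right covariant differential calculus $\Gamma(H)$ be given, and let $\hat\otimes$ be the graded (skew) tensor product. Let $\Gamma(\mathcal P)$ (resp. $\Gamma(B)$) be the quotient of the universal differential calculus of $\mathcal P$ (resp. $B$) by the intersection of the kernels of the extensions of the $\chi_i$ to $\Gamma(B_i)\hat\otimes\Gamma(H)$ (resp. of the projections $B\to B_i$ to $\Gamma(B_i)$). Let $\Gamma_c(\mathcal P)\subset\prod_i\Gamma(B_i)\hat\otimes\Gamma(H)$ and $\Gamma_c(B)\subset\prod_i\Gamma(B_i)$ be their covering completions, i.e. the algebras of families whose $i$-th and $j$-th members agree in the quotient of $\Gamma(\mathcal P)$ (resp. $\Gamma(B)$) by the sum of the kernels $\ker_i+\ker_j$ of the $i$-th and $j$-th extension, for all $i,j$. Here $\Gamma_c(\mathcal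 P)$ carries the componentwise $d$ and the coaction $\Delta$ which is componentwise $\mathrm{id}\otimes\Delta^{\Gamma(H)}$; $\chi_i$ also denotes the $i$-th projection of $\Gamma_c(\mathcal P)$; and $\iota_c:\Gamma_c(B)\to\Gamma_c(\mathcal P)$ is $(\gamma_i)\mapsto(\gamma_i\hat\otimes 1)$. Let $\mathrm{hor}\,\Gamma_c(\mathcal P)$ be the subalgebra of the $\alpha\in\Gamma_c(\mathcal P)$ with $\chi_i(\alpha)\in\Gamma(B_i)\hat\otimes H$ for all $i$. A left (right) covariant derivative is a linear map $D:\mathrm{hor}\,\Gamma_c(\mathcal P)\to\mathrm{hor}\,\Gamma_c(\mathcal P)$ which raises the degree by one, satisfies $D(1)=0$, $(D\otimes \mathrm{id})\Delta=\Delta D$ and $D(\ker\chi_i|_{\mathrm{hor}})\subset\ker\chi_i|_{\mathrm{hor}}$ for all $i$, and, in the left case, $D(\iota_c(\gamma)\alpha)=d(\iota_c(\gamma))\,\alpha+(-1)^n\iota_c(\gamma)D(\alpha)$ for $\gamma\in\Gamma_c^n(B)$, $\alpha\in\mathrm{hor}\,\Gamma_c(\mathcal P)$; in the right case, $D(\alpha\,\iota_c(\gamma))=D(\alpha)\iota_c(\gamma)+(-1)^n\alpha\,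 d(\iota_c(\gamma))$ for $\alpha\in\mathrm{hor}\,\Gamma^n_c(\mathcal P)$, $\gamma\in\Gamma_c(B)$. Let $\Gamma_m(B_{ij})$ be the differential calculus over $B_{ij}$ induced on the subalgebra $B_{ij}=B_{ij}\otimes 1$ by the calculus $\Gamma(\mathcal P)/(\ker_i+\ker_j)$ over $B_{ij}\otimes H$, with the projections $\pi^i_j:\Gamma(B_i)\to\Gamma_m(B_{ij})$, $\pi^j_i:\Gamma(B_j)\to\Gamma_m(B_{ij})$ extending $B_i\to B_{ij}$, $B_j\to B_{ij}$. Then left covariant derivatives are in bijective correspondence with families of linear maps $A_i:H\to\Gamma^1(B_i)$, $i\in I$, such that $A_i(1)=0$ for all $i$ and, for all $i,j\in I$ and $h\in H$, $$\pi^i_j(A_i(h))=\sum\tau_{ij}(h_1)\,\pi^j_i(A_j(h_2))\,\tau_{ji}(h_3)+\sum\tau_{ij}(h_1)\,d\tau_{ji}(h_2)\quad\text{in }\Gamma_m(B_{ij}),$$ and so are right covariant derivatives. In both cases the correspondence is given by $A_i(h)=-(\mathrm{id}\otimes\varepsilon)(D_i(1\otimes h))$, where $D_i$ is the linear map of $\Gamma(B_i)\hat\otimes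 H$ with $D_i\circ\chi_i=\chi_i\circ D$ on $\mathrm{hor}\,\Gamma_c(\mathcal P)$; conversely, for $\gamma\in\Gamma^n(B_i)$, $h\in H$, $D_i(\gamma\hat\otimes h)=d\gamma\hat\otimes h+(-1)^{n+1}\sum\gamma A_i(h_1)\hat\otimes h_2$ in the left case and $D_i(\gamma\hat\otimes h)=d\gamma\hat\otimes h-\sum A_i(h_1)\gamma\hat\otimes h_2$ in the right case. -/

import Mathlib

open scoped TensorProduct

noncomputable section

namespace QuantumBundle

universe u v v' w uH uB uP

/-! ### Algebraic preliminaries -/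

/-- The sum of two two-sided ideals is two-sided. -/
instance isTwoSided_sup {A : Type*} [Ring A] (K L : Ideal A) [K.IsTwoSided] [L.IsTwoSided] :
    (K ⊔ L).IsTwoSided := by
  refine ⟨fun {a} b ha => ?_⟩
  obtain ⟨x, hx, y, hy, rfl⟩ := Submodule.mem_sup.1 ha
  rw [add_mul]
  exact Submodule.add_mem_sup (Ideal.mul_mem_right _ _ hx) (Ideal.mul_mem_right _ _ hy)

/-- The convolution product `h ↦ ∑ f(h₁) g(h₂)` of two linear maps from a coalgebra to an
algebra. -/
def conv {H A : Type*} [Ring H] [Bialgebra ℂ H] [Ring A] [Algebra ℂ A]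
    (f g : H →ₗ[ℂ] A) : H →ₗ[ℂ] A :=
  LinearMap.mul' ℂ A ∘ₗ TensorProduct.map f g ∘ₗ Coalgebra.comul

/-- A right coaction of `H` on `A`, compatible with the algebra structures
(i.e. `A` is a right `H`-comodule algebra). -/
structure IsComoduleAlgebra {A H : Type*} [Ring A] [Algebra ℂ A] [Ring H] [HopfAlgebra ℂ H]
    (δ : A →ₐ[ℂ] A ⊗[ℂ] H) : Prop where
  coassoc : ∀ a : A,
    TensorProduct.assoc ℂ A H H (δ.toLinearMap.rTensor H (δ a)) =
      (Coalgebra.comul : H →ₗ[ℂ] H ⊗[ℂ] H).lTensor A (δ a)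
  counit : ∀ a : A,
    TensorProduct.rid ℂ A ((Coalgebra.counit : H →ₗ[ℂ] ℂ).lTensor A (δ a)) = a

/-- A complete covering of an algebra: the ideals have zero intersection, and every family of
classes which agree in all the quotients `A / (K i + K j)` comes from an element of `A`. -/
def IsCompleteCovering {A I : Type*} [Ring A] (K : I → Ideal A) [∀ i, (K i).IsTwoSided] : Prop :=
  (⨅ i, K i) = ⊥ ∧
    ∀ a : ∀ i, A ⧸ K i,
      (∀ i j, Ideal.Quotient.factor (le_sup_left : K i ≤ K i ⊔ K j) (a i) =
        Ideal.Quotient.factor (le_sup_right : K j ≤ K i ⊔ K j) (a j)) →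
      ∃ x : A, ∀ i, Ideal.Quotient.mk (K i) x = a i

/-- A family of linear maps `χ i : P → C i ⊗ H` is colinear for the coaction `δ` of `H` on `P`:
`(id ⊗ Δ) ∘ χ i = (χ i ⊗ id) ∘ δ`. -/
def IsColinear {P I H : Type*} {C : I → Type*} [Ring P] [Algebra ℂ P] [Ring H] [HopfAlgebra ℂ H]
    [∀ i, Ring (C i)] [∀ i, Algebra ℂ (C i)] (δ : P →ₐ[ℂ] P ⊗[ℂ] H)
    (χ : ∀ i, P →ₐ[ℂ] C i ⊗[ℂ] H) : Prop :=
  ∀ i p, (Coalgebra.comul : H →ₗ[ℂ] H ⊗[ℂ] H).lTensor (C i) (χ i p) =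
    TensorProduct.assoc ℂ (C i) H H ((χ i).toLinearMap.rTensor H (δ p))

/-- The kernels of the maps `χ i` form a complete covering of `P`. -/
def KernelsCover {P I : Type*} {C : I → Type*} [Ring P] [Algebra ℂ P]
    [∀ i, Ring (C i)] [∀ i, Algebra ℂ (C i)] (χ : ∀ i, P →ₐ[ℂ] C i) : Prop :=
  IsCompleteCovering fun i => RingHom.ker (χ i)

/-! ### Differential calculi -/

/-- A differential calculus over an algebra `A`: a differential graded algebra, graded by `ℕ`,
with `A` as degree zero part, and generated as an algebra by `A` and `dA`. -/
structure DiffCalculus (A : Type u) [Ring A] [Algebra ℂ A] where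
  /-- the underlying space of forms -/
  Form : Type v
  [ring : Ring Form]
  [algebra : Algebra ℂ Form]
  /-- the forms of degree `n` -/
  gr : ℕ → Submodule ℂ Form
  [graded : GradedAlgebra gr]
  /-- the identification of `A` with the forms of degree zero -/
  emb : A →ₐ[ℂ] Form
  emb_injective : Function.Injective emb
  range_emb : LinearMap.range emb.toLinearMap = gr 0
  /-- the differential -/
  d : Form →ₗ[ℂ] Form
  d_mem : ∀ {n : ℕ} {x : Form}, x ∈ gr n → d x ∈ gr (n + 1)
  d_d : ∀ x : Form, d (d x) = 0
  leibniz : ∀ {n : ℕ} {x : Form}, x ∈ gr n → ∀ y : Form,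
    d (x * y) = d x * y + (-1 : ℂ) ^ n • (x * d y)
  generated : Algebra.adjoin ℂ (Set.range emb ∪ Set.range fun a => d (emb a)) = ⊤

attribute [instance] DiffCalculus.ring DiffCalculus.algebra DiffCalculus.graded

namespace DiffCalculus

variable {A : Type u} [Ring A] [Algebra ℂ A] (Γ : DiffCalculus.{u, v} A)

/-- The linear map which is multiplication by `(-1)ⁿ` on forms of degree `n`. -/
def parity : Γ.Form →ₗ[ℂ] Γ.Form :=
  DirectSum.toModule ℂ ℕ Γ.Form (fun n => (-1 : ℂ) ^ n • (Γ.gr n).subtype) ∘ₗ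
    (DirectSum.decomposeLinearEquiv Γ.gr).toLinearMap

theorem parity_apply {n : ℕ} {x : Γ.Form} (hx : x ∈ Γ.gr n) :
    Γ.parity x = (-1 : ℂ) ^ n • x := by
  lift x to Γ.gr n using hx
  simp [parity]

theorem emb_mem (a : A) : Γ.emb a ∈ Γ.gr 0 := by
  rw [← Γ.range_emb]; exact ⟨a, rfl⟩

theorem d_one : Γ.d 1 = 0 := by
  have h := Γ.leibniz (n := 0) (x := 1) (by rw [← map_one Γ.emb]; exact Γ.emb_mem 1) 1
  simpa using h

end DiffCalculus

/-- A right covariant differential calculus over a Hopf algebra `H`: the algebra of forms is a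
right `H`-comodule algebra, the coaction being
`h₀ dh₁ ⋯ dhₙ ↦ Δ(h₀) (d ⊗ id)Δ(h₁) ⋯ (d ⊗ id)Δ(hₙ)`
(the coaction is multiplicative, so this is determined by its values on `h` and `dh`). -/
structure RightCovariantCalculus (H : Type u) [Ring H] [HopfAlgebra ℂ H] extends
    DiffCalculus.{u, v} H where
  /-- the coaction -/
  coaction : Form →ₐ[ℂ] Form ⊗[ℂ] H
  isComoduleAlgebra : IsComoduleAlgebra coaction
  coaction_emb : ∀ h : H, coaction (emb h) = emb.toLinearMap.rTensor H (Coalgebra.comul h)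
  coaction_d : ∀ h : H,
    coaction (d (emb h)) = (d ∘ₗ emb.toLinearMap).rTensor H (Coalgebra.comul h)

/-! ### Skew tensor product of differential calculi -/

section Skew

open GradedTensorProduct

variable {A : Type u} [Ring A] [Algebra ℂ A] (Γ : DiffCalculus.{u, v} A)
variable {H : Type uH} [Ring H] [Algebra ℂ H] (Θ : DiffCalculus.{uH, v'} H)

/-- The skew tensor product `Γ ⊗̂ Θ`, with the product
`(γ ⊗ ρ)(ω ⊗ τ) = (-1)^{deg ρ deg ω} γω ⊗ ρτ`. -/
abbrev Skew : Type (max v v') := Γ.gr ᵍ⊗[ℂ] Θ.gr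

/-- The differential `d(γ ⊗ ρ) = dγ ⊗ ρ + (-1)^{deg γ} γ ⊗ dρ`. -/
def skewD : Skew Γ Θ →ₗ[ℂ] Skew Γ Θ :=
  (of ℂ Γ.gr Θ.gr).toLinearMap ∘ₗ
    (TensorProduct.map Γ.d LinearMap.id + TensorProduct.map Γ.parity Θ.d) ∘ₗ
      (of ℂ Γ.gr Θ.gr).symm.toLinearMap

/-- The forms of total degree `n` in `Γ ⊗̂ Θ`. -/
def skewDegree (n : ℕ) : Submodule ℂ (Skew Γ Θ) :=
  ⨆ p ∈ Finset.HasAntidiagonal.antidiagonal n,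
    (Submodule.map₂ (TensorProduct.mk ℂ Γ.Form Θ.Form) (Γ.gr p.1) (Θ.gr p.2)).map
      (of ℂ Γ.gr Θ.gr).toLinearMap

theorem commute_horizontal (γ : Γ.Form) (h : H) :
    Commute (includeLeft Γ.gr Θ.gr γ) (includeRight Γ.gr Θ.gr (Θ.emb h)) := by
  induction γ using DirectSum.Decomposition.inductionOn Γ.gr with
  | zero => rw [map_zero]; exact Commute.zero_left _
  | homogeneous m =>
    have h1 := tmul_zero_coe_mul_coe_tmul (R := ℂ) Γ.gr Θ.gr 1 ⟨Θ.emb h, Θ.emb_mem h⟩ m 1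
    have h2 := tmul_one_mul_one_tmul (R := ℂ) Γ.gr Θ.gr (m : Γ.Form) (Θ.emb h)
    simp only [one_mul, mul_one] at h1
    exact h2.trans h1.symm
  | add a b ha hb => rw [map_add]; exact ha.add_left hb

/-- The inclusion `Γ ⊗ H → Γ ⊗̂ Θ`, where `H` is the degree zero part of `Θ`. The factor `H`
being of degree zero, it is multiplicative for the usual product of `Γ ⊗ H`. -/
def horIncl : Γ.Form ⊗[ℂ] H →ₐ[ℂ] Skew Γ Θ :=
  Algebra.TensorProduct.lift (includeLeft Γ.gr Θ.gr) ((includeRight Γ.gr Θ.gr).comp Θ.emb)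
    (commute_horizontal Γ Θ)

theorem horIncl_tmul (γ : Γ.Form) (h : H) :
    horIncl Γ Θ (γ ⊗ₜ h) = γ ᵍ⊗ₜ[ℂ] Θ.emb h :=
  (Algebra.TensorProduct.lift_tmul _ _ _ γ h).trans
    (tmul_one_mul_one_tmul (R := ℂ) Γ.gr Θ.gr γ (Θ.emb h))

/-- The inclusion `A ⊗ H → Γ ⊗̂ Θ` of the elements of degree zero. -/
def zeroIncl : A ⊗[ℂ] H →ₐ[ℂ] Skew Γ Θ :=
  (horIncl Γ Θ).comp (Algebra.TensorProduct.map Γ.emb (AlgHom.id ℂ H))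

theorem zeroIncl_tmul (a : A) (h : H) :
    zeroIncl Γ Θ (a ⊗ₜ h) = Γ.emb a ᵍ⊗ₜ[ℂ] Θ.emb h := by
  simp [zeroIncl, horIncl_tmul]

theorem skewD_tmul_one (γ : Γ.Form) : skewD Γ Θ (γ ᵍ⊗ₜ[ℂ] 1) = Γ.d γ ᵍ⊗ₜ[ℂ] 1 := by
  simp [skewD, Θ.d_one]

theorem skewD_one_tmul (ρ : Θ.Form) : skewD Γ Θ (1 ᵍ⊗ₜ[ℂ] ρ) = 1 ᵍ⊗ₜ[ℂ] Θ.d ρ := by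
  have h1 : (1 : Γ.Form) ∈ Γ.gr 0 := by rw [← map_one Γ.emb]; exact Γ.emb_mem 1
  simp [skewD, Γ.d_one, Γ.parity_apply h1]

/-- `Γ ⊗̂ Θ` is generated by its elements of degree zero and their differentials. -/
theorem skew_generated :
    Algebra.adjoin ℂ (Set.range (zeroIncl Γ Θ) ∪
      Set.range fun x => skewD Γ Θ (zeroIncl Γ Θ x)) = ⊤ := by
  set S := Algebra.adjoin ℂ (Set.range (zeroIncl Γ Θ) ∪
      Set.range fun x => skewD Γ Θ (zeroIncl Γ Θ x)) with hS
  have hL : ∀ γ : Γ.Form, includeLeft Γ.gr Θ.gr γ ∈ S := by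
    have : (⊤ : Subalgebra ℂ Γ.Form) ≤ S.comap (includeLeft Γ.gr Θ.gr) := by
      rw [← Γ.generated]
      refine Algebra.adjoin_le ?_
      rintro _ (⟨a, rfl⟩ | ⟨a, rfl⟩)
      · refine Algebra.subset_adjoin (Or.inl ⟨a ⊗ₜ 1, ?_⟩)
        simp [zeroIncl_tmul]
      · refine Algebra.subset_adjoin (Or.inr ⟨a ⊗ₜ 1, ?_⟩)
        simp [zeroIncl_tmul, skewD_tmul_one]
    exact fun γ => this trivial
  have hR : ∀ ρ : Θ.Form, includeRight Γ.gr Θ.gr ρ ∈ S := by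
    have : (⊤ : Subalgebra ℂ Θ.Form) ≤ S.comap (includeRight Γ.gr Θ.gr) := by
      rw [← Θ.generated]
      refine Algebra.adjoin_le ?_
      rintro _ (⟨a, rfl⟩ | ⟨a, rfl⟩)
      · refine Algebra.subset_adjoin (Or.inl ⟨1 ⊗ₜ a, ?_⟩)
        simp [zeroIncl_tmul]
      · refine Algebra.subset_adjoin (Or.inr ⟨1 ⊗ₜ a, ?_⟩)
        simp [zeroIncl_tmul, skewD_one_tmul]
    exact fun ρ => this trivial
  refine eq_top_iff.2 fun x _ => ?_
  obtain ⟨t, rfl⟩ := (of ℂ Γ.gr Θ.gr).surjective x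
  induction t using TensorProduct.induction_on with
  | zero => simp
  | tmul γ ρ =>
    have h := S.mul_mem (hL γ) (hR ρ)
    rwa [includeLeft_apply, includeRight_apply, tmul_one_mul_one_tmul] at h
  | add a b ha hb => rw [map_add]; exact S.add_mem (ha trivial) (hb trivial)

end Skew

/-! ### The adapted differential calculus and its covering completion

Given an algebra `A`, algebras of forms `C i` with differentials `d i` and homomorphisms
`f i : A → C i` into the degree zero parts, let `Ω` be the universal differential calculus of `A`
and `Ω → C i` the extension of `f i`. -/

section Adapted

variable {I : Type w} {A : Type u} [Ring A] [Algebra ℂ A] {C : I → Type v}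
  [∀ i, Ring (C i)] [∀ i, Algebra ℂ (C i)] (f : ∀ i, A →ₐ[ℂ] C i) (d : ∀ i, C i →ₗ[ℂ] C i)

/-- The differential calculus `Ω / ⋂ i, ker (Ω → C i)`, realized as the image of `Ω` in the product
of the `C i`: the subalgebra generated by the elements `(f i a)_i` and `(d (f i a))_i`. -/
def adapted : Subalgebra ℂ (∀ i, C i) :=
  Algebra.adjoin ℂ ((Set.range fun (a : A) (i : I) => f i a) ∪
    Set.range fun (a : A) (i : I) => d i (f i a))

/-- An element of `A`, as an element of degree zero of the calculus. -/
def adaptedOf (a : A) : adapted f d :=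
  ⟨fun i => f i a, Algebra.subset_adjoin (Or.inl ⟨a, rfl⟩)⟩

/-- The differential of an element of `A`, as an element of the calculus. -/
def adaptedD (a : A) : adapted f d :=
  ⟨fun i => d i (f i a), Algebra.subset_adjoin (Or.inr ⟨a, rfl⟩)⟩

/-- The differential extension of `f i` to the calculus. -/
def adaptedProj (i : I) : adapted f d →ₐ[ℂ] C i :=
  (Pi.evalAlgHom ℂ C i).comp (adapted f d).val

/-- The ideals covering the calculus: the kernels of the extensions of the `f i`. -/
abbrev locKer (i : I) : Ideal (adapted f d) := RingHom.ker (adaptedProj f d i)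

theorem adaptedProj_surjective
    (hgen : ∀ i, Algebra.adjoin ℂ (Set.range (f i) ∪ Set.range fun a => d i (f i a)) = ⊤) (i : I) :
    Function.Surjective (adaptedProj f d i) := by
  rw [← AlgHom.range_eq_top, eq_top_iff, ← hgen i]
  refine Algebra.adjoin_le ?_
  rintro _ (⟨a, rfl⟩ | ⟨a, rfl⟩)
  · exact ⟨adaptedOf f d a, rfl⟩
  · exact ⟨adaptedD f d a, rfl⟩

/-- The quotient of the calculus by the sum of the `i`-th and the `j`-th kernels. -/
def Overlap (i j : I) : Type (max v w) := adapted f d ⧸ (locKer f d i ⊔ locKer f d j)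

instance (i j : I) : Ring (Overlap f d i j) :=
  inferInstanceAs (Ring (adapted f d ⧸ (locKer f d i ⊔ locKer f d j)))

instance (i j : I) : Algebra ℂ (Overlap f d i j) :=
  inferInstanceAs (Algebra ℂ (adapted f d ⧸ (locKer f d i ⊔ locKer f d j)))

/-- The quotient map. -/
def toOverlap (i j : I) : adapted f d →ₐ[ℂ] Overlap f d i j :=
  Ideal.Quotient.mkₐ ℂ (locKer f d i ⊔ locKer f d j)

theorem toOverlap_surjective (i j : I) : Function.Surjective (toOverlap f d i j) :=
  Ideal.Quotient.mkₐ_surjective ℂ (locKer f d i ⊔ locKer f d j)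

theorem toOverlap_eq_zero_iff (i j : I) (x : adapted f d) :
    toOverlap f d i j x = 0 ↔ ∃ a b, adaptedProj f d i a = 0 ∧ adaptedProj f d j b = 0 ∧
      a + b = x := by
  have h : toOverlap f d i j x = 0 ↔ x ∈ locKer f d i ⊔ locKer f d j :=
    Ideal.Quotient.eq_zero_iff_mem
  rw [h, Submodule.mem_sup]
  constructor
  · rintro ⟨a, ha, b, hb, hx⟩
    exact ⟨a, b, ha, hb, hx⟩
  · rintro ⟨a, b, ha, hb, hx⟩
    exact ⟨a, ha, b, hb, hx⟩

variable {f d} (hs : ∀ i, Function.Surjective (adaptedProj f d i))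

/-- The natural projection from `C i` (which is the quotient of the calculus by the `i`-th kernel)
to the quotient of the calculus by the sum of the `i`-th and the `j`-th kernels. -/
def overlapLeft (i j : I) : C i →ₐ[ℂ] Overlap f d i j :=
  AlgHom.comp (Ideal.Quotient.factorₐ ℂ (le_sup_left : locKer f d i ≤ locKer f d i ⊔ locKer f d j))
    (Ideal.quotientKerAlgEquivOfSurjective (hs i)).symm.toAlgHom

/-- The natural projection from `C j` to the quotient of the calculus by the sum of the `i`-th and
the `j`-th kernels. -/
def overlapRight (i j : I) : C j →ₐ[ℂ] Overlap f d i j :=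
  AlgHom.comp (Ideal.Quotient.factorₐ ℂ (le_sup_right : locKer f d j ≤ locKer f d i ⊔ locKer f d j))
    (Ideal.quotientKerAlgEquivOfSurjective (hs j)).symm.toAlgHom

theorem overlapLeft_apply (i j : I) (x : adapted f d) :
    overlapLeft hs i j (adaptedProj f d i x) = toOverlap f d i j x :=
  congrArg (Ideal.Quotient.factorₐ ℂ (le_sup_left : locKer f d i ≤ locKer f d i ⊔ locKer f d j))
    (Ideal.quotientKerAlgEquivOfSurjective_symm_apply (hs i) x)

theorem overlapRight_apply (i j : I) (x : adapted f d) :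
    overlapRight hs i j (adaptedProj f d j x) = toOverlap f d i j x :=
  congrArg (Ideal.Quotient.factorₐ ℂ (le_sup_right : locKer f d j ≤ locKer f d i ⊔ locKer f d j))
    (Ideal.quotientKerAlgEquivOfSurjective_symm_apply (hs j) x)

/-- The covering completion of the calculus: the families in the product of the `C i` whose
`i`-th and `j`-th members have the same class in the quotient of the calculus by
the sum of the `i`-th and the `j`-th kernels. -/
def completion : Subalgebra ℂ (∀ i, C i) :=
  ⨅ i, ⨅ j, AlgHom.equalizer ((overlapLeft hs i j).comp (Pi.evalAlgHom ℂ C i))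
    ((overlapRight hs i j).comp (Pi.evalAlgHom ℂ C j))

theorem mem_completion_iff {c : ∀ i, C i} : c ∈ completion hs ↔ ∀ i j,
    overlapLeft hs i j (c i) = overlapRight hs i j (c j) := by
  simp [completion, Algebra.mem_iInf, AlgHom.mem_equalizer]

/-- Two members of a compatible family have a common lift. -/
theorem mem_completion_iff_exists {c : ∀ i, C i} : c ∈ completion hs ↔ ∀ i j,
    ∃ x : adapted f d, adaptedProj f d i x = c i ∧ adaptedProj f d j x = c j := by
  rw [mem_completion_iff]
  refine forall_congr' fun i => forall_congr' fun j => ⟨fun h => ?_, ?_⟩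
  · obtain ⟨x, hx⟩ := hs i (c i)
    obtain ⟨y, hy⟩ := hs j (c j)
    rw [← hx, ← hy, overlapLeft_apply, overlapRight_apply, ← sub_eq_zero, ← map_sub,
      toOverlap_eq_zero_iff] at h
    obtain ⟨a, b, ha, hb, hab⟩ := h
    refine ⟨x - a, by rw [map_sub, ha, hx, sub_zero], ?_⟩
    have : x - a = y + b := by rw [sub_eq_iff_eq_add, add_assoc, add_comm b a, hab]; abel
    rw [this, map_add, hb, hy, add_zero]
  · rintro ⟨x, hx, hy⟩
    rw [← hx, ← hy, overlapLeft_apply, overlapRight_apply]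

end Adapted

/-! ### Locally trivial quantum principal fibre bundles -/

/-- A locally trivial quantum principal fibre bundle with structure group `H`, base `B`, total
space `P`, and local trivializations `χ i : P → (B / J i) ⊗ H`. -/
structure Bundle (H : Type uH) (B : Type uB) (P : Type uP) (I : Type w) [Ring H] [HopfAlgebra ℂ H] [Ring B] [Algebra ℂ B]
    [Ring P] [Algebra ℂ P] where
  /-- the right coaction of `H` on `P` -/
  coaction : P →ₐ[ℂ] P ⊗[ℂ] H
  isComoduleAlgebra : IsComoduleAlgebra coaction
  /-- the covering of the base -/
  J : I → Ideal B
  [twoSided : ∀ i, (J i).IsTwoSided]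
  complete_base : IsCompleteCovering J
  /-- the local trivializations -/
  χ : ∀ i, P →ₐ[ℂ] (B ⧸ J i) ⊗[ℂ] H
  χ_surjective : ∀ i, Function.Surjective (χ i)
  /-- `(id ⊗ Δ) ∘ χ i = (χ i ⊗ id) ∘ Δ_P` -/
  χ_colinear : IsColinear coaction χ
  /-- the embedding of the base -/
  ι : B →ₐ[ℂ] P
  ι_injective : Function.Injective ι
  χ_ι : ∀ i b, χ i (ι b) = Ideal.Quotient.mk (J i) b ⊗ₜ 1
  complete_total : KernelsCover χ
  range_ι : ∀ p, p ∈ Set.range ι ↔ coaction p = p ⊗ₜ 1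

attribute [instance] Bundle.twoSided

section Bundles

variable {H : Type uH} {B : Type uB} {P : Type uP} {I : Type w} [Ring H] [HopfAlgebra ℂ H] [Ring B] [Algebra ℂ B]
  [Ring P] [Algebra ℂ P]

namespace Bundle

variable (X : Bundle H B P I)

/-- The algebra `B i = B / J i`. -/
abbrev Loc (i : I) : Type uB := B ⧸ X.J i

/-- The algebra `B ij = B / (J i + J j)`. -/
abbrev Loc₂ (i j : I) : Type uB := B ⧸ (X.J i ⊔ X.J j)

/-- A linear right inverse of `χ k`. -/
def sect (k : I) : X.Loc k ⊗[ℂ] H →ₗ[ℂ] P :=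
  ((X.χ k).toLinearMap.exists_rightInverse_of_surjective
    (LinearMap.range_eq_top.2 (X.χ_surjective k))).choose

theorem χ_sect (k : I) (x : X.Loc k ⊗[ℂ] H) : X.χ k (X.sect k x) = x :=
  LinearMap.congr_fun ((X.χ k).toLinearMap.exists_rightInverse_of_surjective
    (LinearMap.range_eq_top.2 (X.χ_surjective k))).choose_spec x

/-- The map `(π ⊗ id) ∘ χ k` from `P` to `(B / L) ⊗ H`, where `L` contains `J k`. -/
def χRestrict {k : I} (L : Ideal B) [L.IsTwoSided] (hk : X.J k ≤ L) :
    P →ₗ[ℂ] (B ⧸ L) ⊗[ℂ] H :=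
  (Ideal.Quotient.factorₐ ℂ hk).toLinearMap.rTensor H ∘ₗ (X.χ k).toLinearMap

/-- The transition function `τ_kl`, with values in `B / L`, where `L = J k + J l`:
`τ_kl(h) = (id ⊗ ε)(φ_lk (1 ⊗ h))`, where `φ_lk` is the automorphism of `(B / L) ⊗ H` such that
`(π ⊗ id) ∘ χ l = φ_lk ∘ (π ⊗ id) ∘ χ k`. In other words, `τ_kl(h)` is the value of
`(id ⊗ ε) ∘ (π ⊗ id) ∘ χ l` at any element `p` of `P` with `χ k p = 1 ⊗ h`; it does not depend
on the choice of `p`. -/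
def transition (k l : I) (L : Ideal B) [L.IsTwoSided] (hl : X.J l ≤ L) :
    H →ₗ[ℂ] B ⧸ L :=
  (TensorProduct.rid ℂ (B ⧸ L)).toLinearMap ∘ₗ
    (Coalgebra.counit : H →ₗ[ℂ] ℂ).lTensor (B ⧸ L) ∘ₗ
      X.χRestrict L hl ∘ₗ X.sect k ∘ₗ TensorProduct.mk ℂ (X.Loc k) H 1

end Bundle

/-- The data determining a differential structure on a bundle: differential calculi over the
algebras `B i = B / J i`, and a right covariant differential calculus over `H`. -/
structure DiffStructure (X : Bundle H B P I) where
  /-- the calculus `Γ(B i)` -/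
  base : ∀ i, DiffCalculus.{uB, v} (X.Loc i)
  /-- the calculus `Γ(H)` -/
  fibre : RightCovariantCalculus.{uH, v'} H

namespace DiffStructure

open GradedTensorProduct

variable {X : Bundle H B P I} (S : DiffStructure.{v, v'} X)

/-- The forms on the local piece `B i`. -/
abbrev BForm (i : I) : Type v := (S.base i).Form

/-- The local differential calculus `Γ(B i) ⊗̂ Γ(H)`. -/
abbrev E (i : I) : Type (max v v') := Skew (S.base i) S.fibre.toDiffCalculus

/-- The differential of `Γ(B i) ⊗̂ Γ(H)`. -/
def dE (i : I) : S.E i →ₗ[ℂ] S.E i := skewD (S.base i) S.fibre.toDiffCalculus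

/-- The map `γ ↦ γ ⊗̂ 1`. -/
def left (i : I) : S.BForm i →ₐ[ℂ] S.E i := includeLeft (S.base i).gr S.fibre.gr

/-- The inclusion `Γ(B i) ⊗ H → Γ(B i) ⊗̂ Γ(H)`. -/
def hIncl (i : I) : S.BForm i ⊗[ℂ] H →ₐ[ℂ] S.E i :=
  horIncl (S.base i) S.fibre.toDiffCalculus

/-- The coaction `id ⊗ Δ^Γ` of `H` on `Γ(B i) ⊗̂ Γ(H)`. -/
def coE (i : I) : S.E i →ₗ[ℂ] S.E i ⊗[ℂ] H :=
  (of ℂ (S.base i).gr S.fibre.gr).toLinearMap.rTensor H ∘ₗ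
    (TensorProduct.assoc ℂ (S.BForm i) S.fibre.Form H).symm.toLinearMap ∘ₗ
      S.fibre.coaction.toLinearMap.lTensor (S.BForm i) ∘ₗ
        (of ℂ (S.base i).gr S.fibre.gr).symm.toLinearMap

/-! #### The calculi `Γ(B)` and `Γ(P)` and their covering completions -/

/-- The projection `B → B i`, with values in the calculus `Γ(B i)`. -/
def baseMap (i : I) : B →ₐ[ℂ] S.BForm i :=
  (S.base i).emb.comp (Ideal.Quotient.mkₐ ℂ (X.J i))

/-- The differential of `Γ(B i)`. -/
def dB (i : I) : S.BForm i →ₗ[ℂ] S.BForm i := (S.base i).d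

/-- The trivialization `χ i`, with values in the calculus `Γ(B i) ⊗̂ Γ(H)`. -/
def totalMap (i : I) : P →ₐ[ℂ] S.E i :=
  (zeroIncl (S.base i) S.fibre.toDiffCalculus).comp (X.χ i)

/-- The differential calculus `Γ(B)` over `B`, adapted to the covering of `B`. -/
abbrev ΓB : Subalgebra ℂ (∀ i, S.BForm i) := adapted S.baseMap S.dB

/-- The differential calculus `Γ(P)` over `P`, adapted to the covering of `P`. -/
abbrev ΓP : Subalgebra ℂ (∀ i, S.E i) := adapted S.totalMap S.dE

theorem base_surjective (i : I) : Function.Surjective (adaptedProj S.baseMap S.dB i) := by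
  refine adaptedProj_surjective _ _ (fun i => ?_) i
  rw [← (S.base i).generated]
  congr 2
  · exact (Ideal.Quotient.mk_surjective (I := X.J i)).range_comp (S.base i).emb
  · exact (Ideal.Quotient.mk_surjective (I := X.J i)).range_comp
      fun a => (S.base i).d ((S.base i).emb a)

theorem total_surjective (i : I) : Function.Surjective (adaptedProj S.totalMap S.dE i) := by
  refine adaptedProj_surjective _ _ (fun i => ?_) i
  rw [← skew_generated (S.base i) S.fibre.toDiffCalculus]
  congr 2
  · exact (X.χ_surjective i).range_comp (zeroIncl (S.base i) S.fibre.toDiffCalculus)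
  · exact (X.χ_surjective i).range_comp fun x => skewD (S.base i) S.fibre.toDiffCalculus
      (zeroIncl (S.base i) S.fibre.toDiffCalculus x)

/-- The covering completion `Γ_c(B)`. -/
abbrev ΓcB : Subalgebra ℂ (∀ i, S.BForm i) := completion S.base_surjective

/-- The covering completion `Γ_c(P)`. The extension of `χ i` to `Γ_c(P)` is the projection to the
`i`-th component. -/
abbrev ΓcP : Subalgebra ℂ (∀ i, S.E i) := completion S.total_surjective

/-- The differential of `Γ_c(P)`, which is componentwise, on the ambient product. -/
def dPi : (∀ i, S.E i) →ₗ[ℂ] (∀ i, S.E i) :=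
  LinearMap.pi fun i => S.dE i ∘ₗ LinearMap.proj i

/-- The algebra `hor Γ_c(P)` of horizontal forms: the elements of `Γ_c(P)` with all components
in `Γ(B i) ⊗̂ H`. -/
def hor : Subalgebra ℂ (∀ i, S.E i) :=
  S.ΓcP ⊓ ⨅ i, (S.hIncl i).range.comap (Pi.evalAlgHom ℂ S.E i)

theorem mem_hor {c : ∀ i, S.E i} :
    c ∈ S.hor ↔ c ∈ S.ΓcP ∧ ∀ i, ∃ x, S.hIncl i x = c i := by
  simp [hor, Algebra.mem_inf, Algebra.mem_iInf]

/-- The restriction of `χ i` to the horizontal forms. -/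
def horProj (i : I) : S.hor →ₗ[ℂ] S.E i := LinearMap.proj i ∘ₗ S.hor.val.toLinearMap

/-- The map `(γ i)_i ↦ (γ i ⊗̂ 1)_i`. -/
def leftPi : (∀ i, S.BForm i) →ₐ[ℂ] (∀ i, S.E i) :=
  AlgHom.pi fun i => (S.left i).comp (Pi.evalAlgHom ℂ S.BForm i)

theorem left_baseMap (i : I) (b : B) : S.left i (S.baseMap i b) = S.totalMap i (X.ι b) := by
  simp [left, baseMap, totalMap, X.χ_ι, zeroIncl_tmul]

theorem left_dB (i : I) (b : B) :
    S.left i (S.dB i (S.baseMap i b)) = S.dE i (S.totalMap i (X.ι b)) := by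
  rw [← left_baseMap]
  simp [left, dB, dE, skewD_tmul_one]

theorem leftPi_mem_ΓP {γ : ∀ i, S.BForm i} (hγ : γ ∈ S.ΓB) : S.leftPi γ ∈ S.ΓP := by
  have : S.ΓB ≤ S.ΓP.comap S.leftPi := by
    refine Algebra.adjoin_le ?_
    rintro _ (⟨b, rfl⟩ | ⟨b, rfl⟩)
    · exact Algebra.subset_adjoin (Or.inl ⟨X.ι b, funext fun i => (S.left_baseMap i b).symm⟩)
    · exact Algebra.subset_adjoin (Or.inr ⟨X.ι b, funext fun i => (S.left_dB i b).symm⟩)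
  exact this hγ

theorem leftPi_mem_hor {γ : ∀ i, S.BForm i} (hγ : γ ∈ S.ΓcB) : S.leftPi γ ∈ S.hor := by
  rw [mem_hor]
  refine ⟨?_, fun i => ⟨γ i ⊗ₜ 1, ?_⟩⟩
  · rw [mem_completion_iff_exists] at hγ ⊢
    intro i j
    obtain ⟨x, hi, hj⟩ := hγ i j
    exact ⟨⟨S.leftPi x, S.leftPi_mem_ΓP x.2⟩, congrArg (S.left i) hi, congrArg (S.left j) hj⟩
  · simp [hIncl, horIncl_tmul, leftPi, left]

/-- The embedding `Γ_c(B) → Γ_c(P)`, whose image is contained in `hor Γ_c(P)`. -/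
def ιc : S.ΓcB →ₐ[ℂ] S.hor :=
  (S.leftPi.comp S.ΓcB.val).codRestrict S.hor fun γ => S.leftPi_mem_hor γ.2

/-! #### The calculus `Γ_m` on the overlaps -/

/-- The quotient of `Γ(P)` by the sum of the kernels of the extensions of `χ i` and `χ j`.
By means of the extensions of `χ i` and `χ j` it is identified with each of the two calculi over
`B ij ⊗ H` obtained as quotients of `Γ(B i) ⊗̂ Γ(H)` and of `Γ(B j) ⊗̂ Γ(H)`, and then the
isomorphism between these two (the differential extension of `φ_ij`) becomes the identity. -/
abbrev Q (i j : I) : Type (max v v' w) := Overlap S.totalMap S.dE i j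

/-- The natural projection from `Γ(B i) ⊗̂ Γ(H)`. -/
def projLeft (i j : I) : S.E i →ₐ[ℂ] S.Q i j := overlapLeft S.total_surjective i j

/-- The natural projection from `Γ(B j) ⊗̂ Γ(H)`. -/
def projRight (i j : I) : S.E j →ₐ[ℂ] S.Q i j := overlapRight S.total_surjective i j

/-- The class of an element `b` of the base. -/
def classOf (i j : I) (b : B) : S.Q i j :=
  toOverlap S.totalMap S.dE i j (adaptedOf S.totalMap S.dE (X.ι b))

/-- The class of the differential of an element `b` of the base. -/
def classD (i j : I) (b : B) : S.Q i j :=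
  toOverlap S.totalMap S.dE i j (adaptedD S.totalMap S.dE (X.ι b))

/-- The differential calculus `Γ_m(B ij)` induced on the subalgebra `B ij = B ij ⊗ 1` by the
calculus over `B ij ⊗ H`: it consists of the sums of elements `a₀ da₁ ⋯ daₙ`, with the `aₖ`
in `B ij`. -/
def Γm (i j : I) : Subalgebra ℂ (S.Q i j) :=
  Algebra.adjoin ℂ (Set.range (S.classOf i j) ∪ Set.range (S.classD i j))

theorem projLeft_classOf (i j : I) (b : B) :
    S.projLeft i j (S.left i (S.baseMap i b)) = S.classOf i j b := by
  rw [left_baseMap]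
  exact overlapLeft_apply S.total_surjective i j (adaptedOf S.totalMap S.dE (X.ι b))

theorem projLeft_classD (i j : I) (b : B) :
    S.projLeft i j (S.left i (S.dB i (S.baseMap i b))) = S.classD i j b := by
  rw [left_dB]
  exact overlapLeft_apply S.total_surjective i j (adaptedD S.totalMap S.dE (X.ι b))

theorem projRight_classOf (i j : I) (b : B) :
    S.projRight i j (S.left j (S.baseMap j b)) = S.classOf i j b := by
  rw [left_baseMap]
  exact overlapRight_apply S.total_surjective i j (adaptedOf S.totalMap S.dE (X.ι b))

theorem projRight_classD (i j : I) (b : B) :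
    S.projRight i j (S.left j (S.dB j (S.baseMap j b))) = S.classD i j b := by
  rw [left_dB]
  exact overlapRight_apply S.total_surjective i j (adaptedD S.totalMap S.dE (X.ι b))

theorem baseMap_generated (i : I) : Algebra.adjoin ℂ (Set.range (S.baseMap i) ∪
    Set.range fun b => S.dB i (S.baseMap i b)) = ⊤ := by
  rw [← (S.base i).generated]
  congr 2
  · exact (Ideal.Quotient.mk_surjective (I := X.J i)).range_comp (S.base i).emb
  · exact (Ideal.Quotient.mk_surjective (I := X.J i)).range_comp
      fun a => (S.base i).d ((S.base i).emb a)

theorem projLeft_mem (i j : I) (γ : S.BForm i) : S.projLeft i j (S.left i γ) ∈ S.Γm i j := by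
  have : (⊤ : Subalgebra ℂ (S.BForm i)) ≤ (S.Γm i j).comap ((S.projLeft i j).comp (S.left i)) := by
    rw [← S.baseMap_generated i]
    refine Algebra.adjoin_le ?_
    rintro _ (⟨b, rfl⟩ | ⟨b, rfl⟩)
    · exact Algebra.subset_adjoin (Or.inl ⟨b, (S.projLeft_classOf i j b).symm⟩)
    · exact Algebra.subset_adjoin (Or.inr ⟨b, (S.projLeft_classD i j b).symm⟩)
  exact this trivial

theorem projRight_mem (i j : I) (γ : S.BForm j) : S.projRight i j (S.left j γ) ∈ S.Γm i j := by
  have : (⊤ : Subalgebra ℂ (S.BForm j)) ≤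
      (S.Γm i j).comap ((S.projRight i j).comp (S.left j)) := by
    rw [← S.baseMap_generated j]
    refine Algebra.adjoin_le ?_
    rintro _ (⟨b, rfl⟩ | ⟨b, rfl⟩)
    · exact Algebra.subset_adjoin (Or.inl ⟨b, (S.projRight_classOf i j b).symm⟩)
    · exact Algebra.subset_adjoin (Or.inr ⟨b, (S.projRight_classD i j b).symm⟩)
  exact this trivial

/-- The projection `Γ(B i) → Γ_m(B ij)`. -/
def πLeft (i j : I) : S.BForm i →ₐ[ℂ] S.Γm i j :=
  ((S.projLeft i j).comp (S.left i)).codRestrict _ (S.projLeft_mem i j)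

/-- The projection `Γ(B j) → Γ_m(B ij)`. -/
def πRight (i j : I) : S.BForm j →ₐ[ℂ] S.Γm i j :=
  ((S.projRight i j).comp (S.left j)).codRestrict _ (S.projRight_mem i j)

/-- The map `b ↦ [b]` from `B` to `Γ_m(B ij)`. -/
def mOf (i j : I) : B →ₗ[ℂ] S.Γm i j := (S.πLeft i j).toLinearMap ∘ₗ (S.baseMap i).toLinearMap

/-- The map `b ↦ [db]` from `B` to `Γ_m(B ij)`. -/
def mD (i j : I) : B →ₗ[ℂ] S.Γm i j :=
  (S.πLeft i j).toLinearMap ∘ₗ S.dB i ∘ₗ (S.baseMap i).toLinearMap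

theorem baseMap_eq_zero {i : I} {b : B} (hb : b ∈ X.J i) : S.baseMap i b = 0 := by
  simp [baseMap, Ideal.Quotient.eq_zero_iff_mem.2 hb]

theorem mOf_eq_zero (i j : I) {b : B} (hb : b ∈ X.J i ⊔ X.J j) : S.mOf i j b = 0 := by
  obtain ⟨x, hx, y, hy, rfl⟩ := Submodule.mem_sup.1 hb
  have h1 : S.mOf i j x = 0 := by simp [mOf, S.baseMap_eq_zero hx]
  have h2 : S.mOf i j y = 0 := Subtype.ext <| by
    change S.projLeft i j (S.left i (S.baseMap i y)) = 0
    rw [projLeft_classOf, ← projRight_classOf, S.baseMap_eq_zero hy, map_zero, map_zero]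
  rw [map_add, h1, h2, add_zero]

theorem mD_eq_zero (i j : I) {b : B} (hb : b ∈ X.J i ⊔ X.J j) : S.mD i j b = 0 := by
  obtain ⟨x, hx, y, hy, rfl⟩ := Submodule.mem_sup.1 hb
  have h1 : S.mD i j x = 0 := by simp [mD, S.baseMap_eq_zero hx]
  have h2 : S.mD i j y = 0 := Subtype.ext <| by
    change S.projLeft i j (S.left i (S.dB i (S.baseMap i y))) = 0
    rw [projLeft_classD, ← projRight_classD, S.baseMap_eq_zero hy, map_zero, map_zero, map_zero]
  rw [map_add, h1, h2, add_zero]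

/-- The inclusion of `B ij` into `Γ_m(B ij)` as the forms of degree zero. -/
def embM (i j : I) : X.Loc₂ i j →ₗ[ℂ] S.Γm i j :=
  Submodule.liftQ ((X.J i ⊔ X.J j).restrictScalars ℂ) (S.mOf i j) fun _ hb => S.mOf_eq_zero i j hb

/-- The differential `B ij → Γ_m(B ij)`. -/
def dM (i j : I) : X.Loc₂ i j →ₗ[ℂ] S.Γm i j :=
  Submodule.liftQ ((X.J i ⊔ X.J j).restrictScalars ℂ) (S.mD i j) fun _ hb => S.mD_eq_zero i j hb

/-! #### Covariant derivatives -/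

/-- The horizontal form `α` is homogeneous of degree `n`. -/
def HorDegree (n : ℕ) (α : S.hor) : Prop :=
  ∀ i, S.horProj i α ∈ skewDegree (S.base i) S.fibre.toDiffCalculus n

/-- The element `γ` of `Γ_c(B)` is homogeneous of degree `n`. -/
def BaseDegree (n : ℕ) (γ : S.ΓcB) : Prop := ∀ i, γ.1 i ∈ (S.base i).gr n

/-- `t = Δ(α)`, where `Δ` is the coaction of `H` on the horizontal forms, which is determined by
`(χ i ⊗ id) ∘ Δ = (id ⊗ Δ^Γ) ∘ χ i` for all `i`. -/
def IsCoactionOf (α : S.hor) (t : S.hor ⊗[ℂ] H) : Prop :=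
  ∀ i, (S.horProj i).rTensor H t = S.coE i (S.horProj i α)

/-- `(D ⊗ id) ∘ Δ = Δ ∘ D` -/
def IsCovariant (D : S.hor →ₗ[ℂ] S.hor) : Prop :=
  ∀ α, ∃ t, S.IsCoactionOf α t ∧ S.IsCoactionOf (D α) (D.rTensor H t)

/-- `D(hor Γⁿ_c(P)) ⊆ hor Γⁿ⁺¹_c(P)` -/
def RaisesDegree (D : S.hor →ₗ[ℂ] S.hor) : Prop :=
  ∀ n α, S.HorDegree n α → S.HorDegree (n + 1) (D α)

/-- `D(1) = 0` -/
def KillsOne (D : S.hor →ₗ[ℂ] S.hor) : Prop := D 1 = 0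

/-- `D` preserves the kernel of the restriction of `χ i` to the horizontal forms, for all `i`. -/
def PreservesKernels (D : S.hor →ₗ[ℂ] S.hor) : Prop :=
  ∀ i α, S.horProj i α = 0 → S.horProj i (D α) = 0

/-- `D(γ α) = (dγ) α + (-1)ⁿ γ D(α)` for `γ ∈ Γⁿ_c(B)` and `α ∈ hor Γ_c(P)` -/
def LeftLeibniz (D : S.hor →ₗ[ℂ] S.hor) : Prop :=
  ∀ n (γ : S.ΓcB), S.BaseDegree n γ → ∀ α : S.hor,
    (D (S.ιc γ * α) : ∀ i, S.E i) =
      S.dPi (S.ιc γ) * α + (-1 : ℂ) ^ n • ((S.ιc γ : ∀ i, S.E i) * D α)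

/-- `D(α γ) = D(α) γ + (-1)ⁿ α dγ` for `α ∈ hor Γⁿ_c(P)` and `γ ∈ Γ_c(B)` -/
def RightLeibniz (D : S.hor →ₗ[ℂ] S.hor) : Prop :=
  ∀ n (α : S.hor), S.HorDegree n α → ∀ γ : S.ΓcB,
    (D (α * S.ιc γ) : ∀ i, S.E i) =
      (D α : ∀ i, S.E i) * S.ιc γ + (-1 : ℂ) ^ n • ((α : ∀ i, S.E i) * S.dPi (S.ιc γ))

/-- Left covariant derivatives. -/
structure IsLeftCovDer (D : S.hor →ₗ[ℂ] S.hor) : Prop where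
  degree : S.RaisesDegree D
  map_one : S.KillsOne D
  leibniz : S.LeftLeibniz D
  covariant : S.IsCovariant D
  map_ker : S.PreservesKernels D

/-- Right covariant derivatives. -/
structure IsRightCovDer (D : S.hor →ₗ[ℂ] S.hor) : Prop where
  degree : S.RaisesDegree D
  map_one : S.KillsOne D
  leibniz : S.RightLeibniz D
  covariant : S.IsCovariant D
  map_ker : S.PreservesKernels D

/-! #### Families of local one-forms -/

/-- Families of linear maps `A i : H → Γ¹(B i)`. -/
abbrev LocalFamily : Type (max uH v w) := ∀ i, H →ₗ[ℂ] (S.base i).gr 1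

/-- The map `A i`, as a map to `Γ(B i)`. -/
def formOf (A : S.LocalFamily) (i : I) : H →ₗ[ℂ] S.BForm i := ((S.base i).gr 1).subtype ∘ₗ A i

/-- The transition function `τ_ij`, with values in `B ij`. -/
def τ (_ : DiffStructure.{v, v'} X) (i j : I) : H →ₗ[ℂ] X.Loc₂ i j :=
  X.transition i j _ le_sup_right

/-- The transition function `τ_ji`, with values in `B ij`. -/
def τ' (_ : DiffStructure.{v, v'} X) (i j : I) : H →ₗ[ℂ] X.Loc₂ i j :=
  X.transition j i _ le_sup_left

/-- The conditions `A i (1) = 0` and, in `Γ_m(B ij)`,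
`π(A i (h)) = ∑ τ_ij(h₁) π(A j (h₂)) τ_ji(h₃) + ∑ τ_ij(h₁) dτ_ji(h₂)`. -/
structure IsCompatible (A : S.LocalFamily) : Prop where
  map_one : ∀ i, A i 1 = 0
  gauge : ∀ i j, (S.πLeft i j).toLinearMap ∘ₗ S.formOf A i =
    conv (conv (S.embM i j ∘ₗ S.τ i j) ((S.πRight i j).toLinearMap ∘ₗ S.formOf A j))
      (S.embM i j ∘ₗ S.τ' i j) +
    conv (S.embM i j ∘ₗ S.τ i j) (S.dM i j ∘ₗ S.τ' i j)

/-- The linear map `Γ(B i) ⊗ H → Γ(B i) ⊗ H` given on forms `γ` of degree `n` by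
`γ ⊗ h ↦ dγ ⊗ h + (-1)^(n+1) ∑ γ a(h₁) ⊗ h₂`. -/
def localLeft {i : I} (a : H →ₗ[ℂ] S.BForm i) :
    S.BForm i ⊗[ℂ] H →ₗ[ℂ] S.BForm i ⊗[ℂ] H :=
  (S.base i).d.rTensor H -
    (LinearMap.mul' ℂ (S.BForm i)).rTensor H ∘ₗ
      (TensorProduct.assoc ℂ (S.BForm i) (S.BForm i) H).symm.toLinearMap ∘ₗ
        TensorProduct.map (S.base i).parity (a.rTensor H ∘ₗ Coalgebra.comul)

/-- The linear map `Γ(B i) ⊗ H → Γ(B i) ⊗ H` given by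
`γ ⊗ h ↦ dγ ⊗ h - ∑ a(h₁) γ ⊗ h₂`. -/
def localRight {i : I} (a : H →ₗ[ℂ] S.BForm i) :
    S.BForm i ⊗[ℂ] H →ₗ[ℂ] S.BForm i ⊗[ℂ] H :=
  (S.base i).d.rTensor H -
    (LinearMap.mul' ℂ (S.BForm i) ∘ₗ
        (TensorProduct.comm ℂ (S.BForm i) (S.BForm i)).toLinearMap).rTensor H ∘ₗ
      (TensorProduct.assoc ℂ (S.BForm i) (S.BForm i) H).symm.toLinearMap ∘ₗ
        (a.rTensor H ∘ₗ Coalgebra.comul).lTensor (S.BForm i)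

/-- The map `id ⊗ ε : Γ(B i) ⊗ H → Γ(B i)`. -/
def evalCounit (i : I) : S.BForm i ⊗[ℂ] H →ₗ[ℂ] S.BForm i :=
  (TensorProduct.rid ℂ (S.BForm i)).toLinearMap ∘ₗ
    (Coalgebra.counit : H →ₗ[ℂ] ℂ).lTensor (S.BForm i)

/-- `A i (h) = -(id ⊗ ε)(D i (1 ⊗ h))`, where `D i` is the map with `D i ∘ χ i = χ i ∘ D`. -/
def IsFamilyOf (D : S.hor →ₗ[ℂ] S.hor) (A : S.LocalFamily) : Prop :=
  ∀ i (h : H) (α : S.hor) (y : S.BForm i ⊗[ℂ] H),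
    S.horProj i α = S.hIncl i (1 ⊗ₜ h) → S.horProj i (D α) = S.hIncl i y →
      S.formOf A i h = -S.evalCounit i y

/-- `χ i ∘ D = D i ∘ χ i` on horizontal forms, for given maps `D i` of `Γ(B i) ⊗ H`. -/
def IsGluedFrom (D : S.hor →ₗ[ℂ] S.hor)
    (Dloc : ∀ i, S.BForm i ⊗[ℂ] H →ₗ[ℂ] S.BForm i ⊗[ℂ] H) : Prop :=
  ∀ i (α : S.hor) (x : S.BForm i ⊗[ℂ] H),
    S.horProj i α = S.hIncl i x → S.horProj i (D α) = S.hIncl i (Dloc i x)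

end DiffStructure

end Bundles

end QuantumBundle

end

/-!
A covariant derivative `D` descends to maps `D i` of `Γ(B i) ⊗ H`, and the Leibniz rule together
with colinearity forces `D i (γ ⊗ h) = dγ ⊗ h - ∑ m(γ, A i(h₁)) ⊗ h₂`, where `m(γ, α)` is
`(-1)ⁿ γ α` in the left case (for `γ` of degree `n`) and `α γ` in the right case.

Conversely, such local maps glue as soon as they preserve agreement on the overlaps. By the Leibniz
rule it suffices to test this on the sections `1 ⊗ h` over `i`, which over `j` become
`∑ τ_ij(h₁) ⊗ h₂`. Since `τ_ij` has the convolution inverse `τ_ji`, so that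
`dτ_ij * τ_ji + τ_ij * dτ_ji = 0`, agreement on these sections is exactly the gauge law for the
family `A`. The right case rests on one more fact: the values of `τ_ij` commute with the forms on
the base, because on the overlap `τ_ij` is the convolution of the inclusion of the fibre `H` over
`i` with the antipode followed by the inclusion of the fibre over `j`, and forms on the base
commute with both.
-/

noncomputable section

namespace QuantumBundle

universe u v v' w uH uB uP

section Graded

variable {R A ι : Type*} [DecidableEq ι] [AddMonoid ι] [CommSemiring R] [Semiring A] [Algebra R A]

theorem graded_le_of_adjoin_eq_top (𝒜 : ι → Submodule R A) [GradedAlgebra 𝒜]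
    (F : ι → Submodule R A) [SetLike.GradedMonoid F] {s : Set A}
    (hs : Algebra.adjoin R s = ⊤) (h : ∀ g ∈ s, ∃ n, g ∈ 𝒜 n ⊓ F n) (n : ι) : 𝒜 n ≤ F n := by
  let G : ι → Submodule R A := fun n => 𝒜 n ⊓ F n
  have : SetLike.GradedMonoid G :=
    { one_mem := ⟨SetLike.one_mem_graded 𝒜, SetLike.one_mem_graded F⟩
      mul_mem := fun _ _ _ _ hx hy =>
        ⟨SetLike.mul_mem_graded hx.1 hy.1, SetLike.mul_mem_graded hx.2 hy.2⟩ }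
  have htop : (DirectSum.coeAlgHom G).range = ⊤ := by
    refine top_le_iff.1 (hs ▸ Algebra.adjoin_le fun g hg => ?_)
    obtain ⟨k, hk⟩ := h g hg
    exact ⟨DirectSum.of (fun k => G k) k ⟨g, hk⟩, DirectSum.coeAlgHom_of G k ⟨g, hk⟩⟩
  have hproj : ∀ z : DirectSum ι fun k => G k,
      (DirectSum.decompose 𝒜 (DirectSum.coeAlgHom G z) n : A) ∈ F n := fun z => by
    induction z using DirectSum.induction_on with
    | zero => simp
    | of k g =>
      rw [DirectSum.coeAlgHom_of]
      obtain rfl | hkn := eq_or_ne k n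
      · rw [DirectSum.decompose_of_mem_same 𝒜 g.2.1]
        exact g.2.2
      · rw [DirectSum.decompose_of_mem_ne 𝒜 g.2.1 hkn]
        exact zero_mem _
    | add y z hy hz =>
      rw [map_add, DirectSum.decompose_add, DirectSum.add_apply]
      exact add_mem hy hz
  intro x hx
  obtain ⟨z, rfl⟩ : x ∈ (DirectSum.coeAlgHom G).range := htop ▸ trivial
  exact DirectSum.decompose_of_mem_same 𝒜 hx ▸ hproj z

end Graded

section TmulOne

variable {R A H : Type*} [CommSemiring R] [Semiring A] [Algebra R A] [Semiring H] [Algebra R H]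

theorem tmul_one_mul_eq_rTensor (c : A) (t : A ⊗[R] H) :
    (c ⊗ₜ 1) * t = (LinearMap.mulLeft R c).rTensor H t := by
  suffices LinearMap.mulLeft R (c ⊗ₜ[R] (1 : H)) = (LinearMap.mulLeft R c).rTensor H from
    LinearMap.congr_fun this t
  exact TensorProduct.ext' fun a h => by simp

theorem mul_tmul_one_eq_rTensor (c : A) (t : A ⊗[R] H) :
    t * (c ⊗ₜ 1) = (LinearMap.mulRight R c).rTensor H t := by
  suffices LinearMap.mulRight R (c ⊗ₜ[R] (1 : H)) = (LinearMap.mulRight R c).rTensor H from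
    LinearMap.congr_fun this t
  exact TensorProduct.ext' fun a h => by simp

end TmulOne

section Slice

variable {R H V W : Type*} [CommSemiring R] [AddCommMonoid H] [Module R H] [AddCommMonoid V]
  [Module R V] [AddCommMonoid W] [Module R W]

/-- The map `id ⊗ φ : V ⊗ H → V` for a linear functional `φ` on `H`. -/
def slice (V : Type*) [AddCommMonoid V] [Module R V] (φ : H →ₗ[R] R) : V ⊗[R] H →ₗ[R] V :=
  (TensorProduct.rid R V).toLinearMap ∘ₗ φ.lTensor V

theorem slice_tmul (φ : H →ₗ[R] R) (x : V) (h : H) : slice V φ (x ⊗ₜ h) = φ h • x := rfl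

theorem slice_rTensor (φ : H →ₗ[R] R) (f : V →ₗ[R] W) (t : V ⊗[R] H) :
    slice W φ (f.rTensor H t) = f (slice V φ t) := by
  suffices slice W φ ∘ₗ f.rTensor H = f ∘ₗ slice V φ from LinearMap.congr_fun this t
  exact TensorProduct.ext' fun x h => (map_smul f (φ h) x).symm

theorem eventually_sum_slice_coord_eq {κ : Type*} (b : Module.Basis κ R H) (t : V ⊗[R] H) :
    ∀ᶠ s : Finset κ in Filter.atTop, ∑ k ∈ s, slice V (b.coord k) t ⊗ₜ b k = t := by
  classical
  let x := TensorProduct.equivFinsuppOfBasisRight b t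
  have hx (k : κ) : slice V (b.coord k) t = x k :=
    (TensorProduct.equivFinsuppOfBasisRight_apply b t k).symm
  filter_upwards [Filter.eventually_ge_atTop x.support] with s hs
  simp only [hx]
  rw [← Finsupp.sum_of_support_subset x hs (fun k v => v ⊗ₜ[R] b k) fun k _ =>
    TensorProduct.zero_tmul V (b k), ← TensorProduct.equivFinsuppOfBasisRight_symm_apply]
  exact (TensorProduct.equivFinsuppOfBasisRight b).symm_apply_apply t

theorem slice_ext [Module.Free R H] {t t' : V ⊗[R] H} (h : ∀ φ, slice V φ t = slice V φ t') :
    t = t' := by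
  refine (TensorProduct.equivFinsuppOfBasisRight (Module.Free.chooseBasis R H)).injective
    (Finsupp.ext fun k => ?_)
  rw [TensorProduct.equivFinsuppOfBasisRight_apply, TensorProduct.equivFinsuppOfBasisRight_apply]
  exact h _

end Slice

section ConvAct

open WithConv

variable {R H U V W : Type*} [CommSemiring R] [AddCommMonoid H] [Module R H] [Coalgebra R H]
  [AddCommMonoid U] [Module R U] [AddCommMonoid V] [Module R V] [AddCommMonoid W] [Module R W]

/-- The map `V ⊗ H → W ⊗ H`, `x ⊗ h ↦ ∑ m(x, f(h₁)) ⊗ h₂`, by which a linear map `f` on a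
coalgebra acts through a pairing `m`. -/
def convAct (m : V →ₗ[R] U →ₗ[R] W) (f : H →ₗ[R] U) : V ⊗[R] H →ₗ[R] W ⊗[R] H :=
  (TensorProduct.lift m).rTensor H ∘ₗ (TensorProduct.assoc R V U H).symm.toLinearMap ∘ₗ
    (f.rTensor H ∘ₗ Coalgebra.comul).lTensor V

theorem convAct_tmul (m : V →ₗ[R] U →ₗ[R] W) (f : H →ₗ[R] U) (x : V) (h : H) :
    convAct m f (x ⊗ₜ h) = (m x ∘ₗ f).rTensor H (Coalgebra.comul h) := by
  suffices (TensorProduct.lift m).rTensor H ∘ₗ (TensorProduct.assoc R V U H).symm.toLinearMap ∘ₗ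
      TensorProduct.mk R V (U ⊗[R] H) x ∘ₗ f.rTensor H = (m x ∘ₗ f).rTensor H from
    LinearMap.congr_fun this (Coalgebra.comul h)
  exact TensorProduct.ext' fun _ _ => rfl

theorem rTensor_convAct {W' : Type*} [AddCommMonoid W'] [Module R W'] (g : W →ₗ[R] W')
    (m : V →ₗ[R] U →ₗ[R] W) (f : H →ₗ[R] U) (y : V ⊗[R] H) :
    g.rTensor H (convAct m f y) = convAct (m.compr₂ g) f y := by
  suffices g.rTensor H ∘ₗ convAct m f = convAct (m.compr₂ g) f from LinearMap.congr_fun this y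
  refine TensorProduct.ext' fun x h => ?_
  rw [LinearMap.comp_apply, convAct_tmul, convAct_tmul, ← LinearMap.rTensor_comp_apply]
  rfl

theorem rTensor_convAct_rTensor {V' V'' U' W' : Type*} [AddCommMonoid V'] [Module R V']
    [AddCommMonoid V''] [Module R V''] [AddCommMonoid U'] [Module R U'] [AddCommMonoid W']
    [Module R W'] {g : W →ₗ[R] W'} {m : V →ₗ[R] U →ₗ[R] W} {m' : V' →ₗ[R] U' →ₗ[R] W'}
    {p : V'' →ₗ[R] V} {q : V'' →ₗ[R] V'} {r : U →ₗ[R] U'}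
    (h : ∀ x u, g (m (p x) u) = m' (q x) (r u)) (f : H →ₗ[R] U) (y : V'' ⊗[R] H) :
    g.rTensor H (convAct m f (p.rTensor H y)) = convAct m' (r ∘ₗ f) (q.rTensor H y) := by
  rw [rTensor_convAct]
  suffices convAct (m.compr₂ g) f ∘ₗ p.rTensor H = convAct m' (r ∘ₗ f) ∘ₗ q.rTensor H from
    LinearMap.congr_fun this y
  refine TensorProduct.ext' fun x k => ?_
  rw [LinearMap.comp_apply, LinearMap.comp_apply, LinearMap.rTensor_tmul, LinearMap.rTensor_tmul,
    convAct_tmul, convAct_tmul]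
  congr 2
  exact LinearMap.ext fun k => h x (f k)

theorem convAct_rTensor_comul (m : V →ₗ[R] U →ₗ[R] W) (f : H →ₗ[R] U) (g : H →ₗ[R] V) (h : H) :
    convAct m f (g.rTensor H (Coalgebra.comul h)) =
      (TensorProduct.lift m ∘ₗ TensorProduct.map g f ∘ₗ Coalgebra.comul).rTensor H
        (Coalgebra.comul h) := by
  have hcomul : convAct m f ∘ₗ g.rTensor H = (TensorProduct.lift m ∘ₗ
      TensorProduct.map g f).rTensor H ∘ₗ (TensorProduct.assoc R H H H).symm.toLinearMap ∘ₗ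
        Coalgebra.comul.lTensor H := by
    refine TensorProduct.ext' fun k l => ?_
    suffices (m (g k) ∘ₗ f).rTensor H = (TensorProduct.lift m ∘ₗ TensorProduct.map g f).rTensor H ∘ₗ
        (TensorProduct.assoc R H H H).symm.toLinearMap ∘ₗ TensorProduct.mk R H (H ⊗[R] H) k from
      (convAct_tmul m f (g k) l).trans (LinearMap.congr_fun this (Coalgebra.comul l))
    exact TensorProduct.ext' fun _ _ => rfl
  rw [← LinearMap.comp_assoc, LinearMap.rTensor_comp_apply, ← Coalgebra.coassoc_symm_apply]
  exact LinearMap.congr_fun hcomul (Coalgebra.comul h)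

theorem convAct_mul_comp_convAct_mul {A : Type*} [Semiring A] [Algebra R A] (f g : H →ₗ[R] A) :
    convAct (LinearMap.mul R A) g ∘ₗ convAct (LinearMap.mul R A) f =
      convAct (LinearMap.mul R A) (toConv f * toConv g).ofConv := by
  refine TensorProduct.ext' fun x h => ?_
  rw [LinearMap.comp_apply, convAct_tmul, convAct_rTensor_comul, convAct_tmul]
  congr 2
  suffices TensorProduct.lift (LinearMap.mul R A) ∘ₗ
      TensorProduct.map (LinearMap.mul R A x ∘ₗ f) g =
        LinearMap.mul R A x ∘ₗ LinearMap.mul' R A ∘ₗ TensorProduct.map f g by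
    rw [← LinearMap.comp_assoc, this]
    rfl
  exact TensorProduct.ext' fun k l => mul_assoc x (f k) (g l)

theorem convAct_mul_one (A : Type*) [Semiring A] [Algebra R A] :
    convAct (LinearMap.mul R A) (1 : WithConv (H →ₗ[R] A)).ofConv = LinearMap.id := by
  refine TensorProduct.ext' fun x h => ?_
  have : LinearMap.mul R A x ∘ₗ (1 : WithConv (H →ₗ[R] A)).ofConv =
      LinearMap.toSpanSingleton R A x ∘ₗ Coalgebra.counit :=
    LinearMap.ext fun k => by simp [Algebra.algebraMap_eq_smul_one]
  rw [convAct_tmul, this, LinearMap.rTensor_comp_apply, Coalgebra.rTensor_counit_comul]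
  simp

/-- The coaction `id ⊗ Δ` of a coalgebra `H` on the cofree comodule `V ⊗ H`. -/
def cofreeCoaction (V H : Type*) [AddCommMonoid H] [Module R H] [Coalgebra R H]
    [AddCommMonoid V] [Module R V] : V ⊗[R] H →ₗ[R] (V ⊗[R] H) ⊗[R] H :=
  convAct (TensorProduct.mk R V H) LinearMap.id

theorem cofreeCoaction_tmul (x : V) (h : H) :
    cofreeCoaction V H (x ⊗ₜ[R] h) = (TensorProduct.mk R V H x).rTensor H (Coalgebra.comul h) :=
  convAct_tmul _ _ x h

theorem assoc_cofreeCoaction (y : V ⊗[R] H) :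
    TensorProduct.assoc R V H H (cofreeCoaction V H y) = Coalgebra.comul.lTensor V y := by
  suffices (TensorProduct.assoc R V H H).toLinearMap ∘ₗ cofreeCoaction V H =
      Coalgebra.comul.lTensor V from LinearMap.congr_fun this y
  refine TensorProduct.ext' fun x h => ?_
  suffices (TensorProduct.assoc R V H H).toLinearMap ∘ₗ (TensorProduct.mk R V H x).rTensor H =
      TensorProduct.mk R V (H ⊗[R] H) x from
    (congrArg (TensorProduct.assoc R V H H) (cofreeCoaction_tmul x h)).trans
      (LinearMap.congr_fun this (Coalgebra.comul h))
  exact TensorProduct.ext' fun _ _ => rfl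

theorem cofreeCoaction_convAct (m : V →ₗ[R] U →ₗ[R] W) (f : H →ₗ[R] U) (y : V ⊗[R] H) :
    cofreeCoaction W H (convAct m f y) = (convAct m f).rTensor H (cofreeCoaction V H y) := by
  suffices cofreeCoaction W H ∘ₗ convAct m f = (convAct m f).rTensor H ∘ₗ cofreeCoaction V H from
    LinearMap.congr_fun this y
  refine TensorProduct.ext' fun x h => ?_
  have hx : convAct m f ∘ₗ TensorProduct.mk R V H x = (m x ∘ₗ f).rTensor H ∘ₗ Coalgebra.comul :=
    LinearMap.ext (convAct_tmul m f x)
  rw [LinearMap.comp_apply, convAct_tmul, LinearMap.comp_apply, cofreeCoaction_tmul,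
    ← LinearMap.rTensor_comp_apply, hx]
  refine (convAct_rTensor_comul (TensorProduct.mk R W H) LinearMap.id (m x ∘ₗ f) h).trans ?_
  rw [TensorProduct.lift_mk, LinearMap.id_comp]
  rfl

theorem cofreeCoaction_rTensor (g : V →ₗ[R] W) (y : V ⊗[R] H) :
    cofreeCoaction W H (g.rTensor H y) = (g.rTensor H).rTensor H (cofreeCoaction V H y) := by
  suffices cofreeCoaction W H ∘ₗ g.rTensor H = (g.rTensor H).rTensor H ∘ₗ cofreeCoaction V H from
    LinearMap.congr_fun this y
  refine TensorProduct.ext' fun x h => ?_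
  rw [LinearMap.comp_apply, LinearMap.rTensor_tmul, cofreeCoaction_tmul, LinearMap.comp_apply,
    cofreeCoaction_tmul, ← LinearMap.rTensor_comp_apply]
  rfl

/-- The right translation `h ↦ ∑ φ(h₂) h₁` of a coalgebra by a linear functional `φ`. -/
def hit (φ : H →ₗ[R] R) : H →ₗ[R] H := slice H φ ∘ₗ Coalgebra.comul

theorem hit_one {H : Type*} [Semiring H] [Bialgebra R H] (φ : H →ₗ[R] R) :
    hit φ 1 = φ 1 • (1 : H) := by
  rw [hit, LinearMap.comp_apply, Bialgebra.comul_one, Algebra.TensorProduct.one_def, slice_tmul]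

theorem counit_hit (φ : H →ₗ[R] R) (h : H) : Coalgebra.counit (R := R) (hit φ h) = φ h := by
  rw [hit, LinearMap.comp_apply, ← slice_rTensor, Coalgebra.rTensor_counit_comul, slice_tmul,
    smul_eq_mul, mul_one]

theorem slice_cofreeCoaction (φ : H →ₗ[R] R) (y : V ⊗[R] H) :
    slice (V ⊗[R] H) φ (cofreeCoaction V H y) = (hit φ).lTensor V y := by
  suffices slice (V ⊗[R] H) φ ∘ₗ cofreeCoaction V H = (hit φ).lTensor V from
    LinearMap.congr_fun this y
  refine TensorProduct.ext' fun x h => ?_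
  rw [LinearMap.comp_apply, cofreeCoaction_tmul, slice_rTensor]
  rfl

theorem slice_counit_hit (φ : H →ₗ[R] R) (y : V ⊗[R] H) :
    slice V Coalgebra.counit ((hit φ).lTensor V y) = slice V φ y := by
  suffices slice V Coalgebra.counit ∘ₗ (hit φ).lTensor V = slice V φ from
    LinearMap.congr_fun this y
  refine TensorProduct.ext' fun x h => ?_
  rw [LinearMap.comp_apply, LinearMap.lTensor_tmul, slice_tmul, slice_tmul, counit_hit]

theorem slice_counit_rTensor_comul (f : H →ₗ[R] V) (h : H) :
    slice V Coalgebra.counit (f.rTensor H (Coalgebra.comul h)) = f h := by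
  rw [slice_rTensor, slice, LinearMap.comp_apply, Coalgebra.lTensor_counit_comul]
  simp

theorem slice_counit_convAct (m : V →ₗ[R] U →ₗ[R] W) (f : H →ₗ[R] U) (x : V) (h : H) :
    slice W Coalgebra.counit (convAct m f (x ⊗ₜ h)) = m x (f h) := by
  rw [convAct_tmul, slice_counit_rTensor_comul]
  rfl

theorem rTensor_slice_counit_cofreeCoaction (y : V ⊗[R] H) :
    (slice V Coalgebra.counit).rTensor H (cofreeCoaction V H y) = y := by
  suffices (slice V Coalgebra.counit).rTensor H ∘ₗ cofreeCoaction V H = LinearMap.id from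
    LinearMap.congr_fun this y
  refine TensorProduct.ext' fun x h => ?_
  have hx : slice V Coalgebra.counit ∘ₗ TensorProduct.mk R V H x =
      LinearMap.toSpanSingleton R V x ∘ₗ Coalgebra.counit := rfl
  rw [LinearMap.comp_apply, cofreeCoaction_tmul, ← LinearMap.rTensor_comp_apply, hx,
    LinearMap.rTensor_comp_apply, Coalgebra.rTensor_counit_comul, LinearMap.rTensor_tmul,
    LinearMap.toSpanSingleton_apply, one_smul, LinearMap.id_apply]

theorem eq_slice_counit_of_colinear {f : V ⊗[R] H →ₗ[R] W ⊗[R] H}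
    (hf : ∀ y, cofreeCoaction W H (f y) = f.rTensor H (cofreeCoaction V H y)) (x : V) (h : H) :
    f (x ⊗ₜ h) = (slice W Coalgebra.counit ∘ₗ f ∘ₗ TensorProduct.mk R V H x).rTensor H
      (Coalgebra.comul h) := by
  rw [← rTensor_slice_counit_cofreeCoaction (f (x ⊗ₜ h)), hf, cofreeCoaction_tmul,
    ← LinearMap.rTensor_comp_apply, ← LinearMap.rTensor_comp_apply, LinearMap.comp_assoc]

end ConvAct

section Convolution

open WithConv

variable {R H A : Type*} [CommSemiring R] [Semiring A] [Algebra R A]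

theorem convAct_mul_injective [AddCommMonoid H] [Module R H] [Coalgebra R H] {f g : H →ₗ[R] A}
    (hfg : toConv f * toConv g = 1) :
    Function.Injective (convAct (LinearMap.mul R A) f : A ⊗[R] H →ₗ[R] A ⊗[R] H) := by
  refine Function.LeftInverse.injective (g := convAct (LinearMap.mul R A) g) fun y => ?_
  rw [← LinearMap.comp_apply, convAct_mul_comp_convAct_mul, hfg, convAct_mul_one,
    LinearMap.id_apply]

theorem toConv_mul_toConv_comp_antipode [Semiring H] [HopfAlgebra R H] (u : H →ₐ[R] A) :
    toConv u.toLinearMap * toConv (u.toLinearMap ∘ₗ HopfAlgebra.antipode R) = 1 := by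
  have h := LinearMap.algHom_comp_convMul_distrib u (toConv LinearMap.id)
    (toConv (HopfAlgebra.antipode R))
  rw [LinearMap.id_mul_antipode] at h
  refine (congrArg toConv h).symm.trans ?_
  ext k
  simp

end Convolution

section TensorDegree

variable {R A M ι : Type*} [CommSemiring R] [Semiring A] [Algebra R A]

/-- The part `𝒜 n ⊗ M` of degree `n` of `A ⊗ M`. -/
def tensorDegree (𝒜 : ι → Submodule R A) (M : Type*) [AddCommMonoid M] [Module R M] (n : ι) :
    Submodule R (A ⊗[R] M) :=
  Submodule.map₂ (TensorProduct.mk R A M) (𝒜 n) ⊤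

section Module

variable [AddCommMonoid M] [Module R M] {𝒜 : ι → Submodule R A} {n : ι}

theorem tmul_mem_tensorDegree {a : A} (ha : a ∈ 𝒜 n) (m : M) : a ⊗ₜ m ∈ tensorDegree 𝒜 M n :=
  Submodule.apply_mem_map₂ _ ha trivial

theorem tensorDegree_le {N : Submodule R (A ⊗[R] M)} :
    tensorDegree 𝒜 M n ≤ N ↔ ∀ a ∈ 𝒜 n, ∀ m, a ⊗ₜ m ∈ N := by
  simp [tensorDegree, Submodule.map₂_le]

theorem rTensor_mem_tensorDegree {V : Type*} [AddCommMonoid V] [Module R V] {g : V →ₗ[R] A}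
    (hg : ∀ x, g x ∈ 𝒜 n) (t : V ⊗[R] M) : g.rTensor M t ∈ tensorDegree 𝒜 M n := by
  induction t using TensorProduct.induction_on with
  | zero => rw [map_zero]; exact zero_mem _
  | tmul x m => exact tmul_mem_tensorDegree (hg x) m
  | add t t' ht ht' => rw [map_add]; exact add_mem ht ht'

theorem slice_mem_of_mem_tensorDegree {y : A ⊗[R] M} (hy : y ∈ tensorDegree 𝒜 M n)
    (φ : M →ₗ[R] R) : slice A φ y ∈ 𝒜 n := by
  suffices tensorDegree 𝒜 M n ≤ (𝒜 n).comap (slice A φ) from this hy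
  exact tensorDegree_le.2 fun a ha m => Submodule.smul_mem _ (φ m) ha

end Module

instance tensorDegree_gradedMonoid [Semiring M] [Algebra R M] [AddMonoid ι]
    (𝒜 : ι → Submodule R A) [SetLike.GradedMonoid 𝒜] :
    SetLike.GradedMonoid (tensorDegree 𝒜 M) where
  one_mem := tmul_mem_tensorDegree (SetLike.one_mem_graded 𝒜) 1
  mul_mem m n x y hx hy := by
    suffices tensorDegree 𝒜 M m ≤
        (tensorDegree 𝒜 M (m + n)).comap (LinearMap.mulRight R y) from this hx
    refine tensorDegree_le.2 fun a ha k => ?_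
    suffices tensorDegree 𝒜 M n ≤
        (tensorDegree 𝒜 M (m + n)).comap (LinearMap.mulLeft R (a ⊗ₜ k)) from this hy
    refine tensorDegree_le.2 fun b hb l => ?_
    change (a ⊗ₜ k) * (b ⊗ₜ l) ∈ tensorDegree 𝒜 M (m + n)
    rw [Algebra.TensorProduct.tmul_mul_tmul]
    exact tmul_mem_tensorDegree (SetLike.mul_mem_graded ha hb) (k * l)

end TensorDegree

namespace DiffCalculus

variable {A : Type u} [Ring A] [Algebra ℂ A] (Γ : DiffCalculus.{u, v} A)

theorem parity_emb (a : A) : Γ.parity (Γ.emb a) = Γ.emb a := by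
  rw [Γ.parity_apply (Γ.emb_mem a), pow_zero, one_smul]

theorem parity_one : Γ.parity 1 = 1 := by rw [← map_one Γ.emb, parity_emb]

theorem parity_mem {n : ℕ} {x : Γ.Form} (hx : x ∈ Γ.gr n) : Γ.parity x ∈ Γ.gr n := by
  rw [Γ.parity_apply hx]; exact Submodule.smul_mem _ _ hx

theorem rTensor_parity {M : Type*} [AddCommMonoid M] [Module ℂ M] {n : ℕ} {y : Γ.Form ⊗[ℂ] M}
    (hy : y ∈ tensorDegree Γ.gr M n) : Γ.parity.rTensor M y = (-1 : ℂ) ^ n • y := by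
  suffices tensorDegree Γ.gr M n ≤ LinearMap.eqLocus (Γ.parity.rTensor M)
      ((-1 : ℂ) ^ n • LinearMap.id) from this hy
  exact tensorDegree_le.2 fun γ hγ m => congrArg (· ⊗ₜ m) (Γ.parity_apply hγ)

theorem d_parity (x : Γ.Form) : Γ.d (Γ.parity x) = -Γ.parity (Γ.d x) := by
  induction x using DirectSum.Decomposition.inductionOn Γ.gr with
  | zero => simp
  | homogeneous m =>
    rw [Γ.parity_apply m.2, map_smul, Γ.parity_apply (Γ.d_mem m.2), pow_succ]; simp
  | add a b ha hb => rw [map_add, map_add, ha, hb, map_add, map_add]; abel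

theorem parity_mul (x y : Γ.Form) : Γ.parity (x * y) = Γ.parity x * Γ.parity y := by
  induction x using DirectSum.Decomposition.inductionOn Γ.gr with
  | zero => simp
  | homogeneous a =>
    induction y using DirectSum.Decomposition.inductionOn Γ.gr with
    | zero => simp
    | homogeneous b =>
      rw [Γ.parity_apply a.2, Γ.parity_apply b.2, Γ.parity_apply (SetLike.mul_mem_graded a.2 b.2),
        smul_mul_smul_comm, pow_add]
    | add a b ha hb => rw [mul_add, map_add, ha, hb, map_add, mul_add]
  | add a b ha hb => rw [add_mul, map_add, ha, hb, map_add, add_mul]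

theorem d_mul (x y : Γ.Form) : Γ.d (x * y) = Γ.d x * y + Γ.parity x * Γ.d y := by
  induction x using DirectSum.Decomposition.inductionOn Γ.gr with
  | zero => simp
  | homogeneous a => rw [Γ.leibniz a.2, Γ.parity_apply a.2, smul_mul_assoc]
  | add a b ha hb => rw [add_mul, map_add, ha, hb, map_add, map_add, add_mul, add_mul]; abel

/-- The projection of the forms onto their part of degree zero, identified with `A`. -/
def projZero : Γ.Form →ₗ[ℂ] A :=
  ((LinearEquiv.ofInjective Γ.emb.toLinearMap Γ.emb_injective).trans
      (LinearEquiv.ofEq _ _ Γ.range_emb)).symm.toLinearMap ∘ₗ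
    DirectSum.component ℂ ℕ (fun n => Γ.gr n) 0 ∘ₗ
      (DirectSum.decomposeLinearEquiv Γ.gr).toLinearMap

theorem projZero_emb (a : A) : Γ.projZero (Γ.emb a) = a := by
  refine (LinearEquiv.symm_apply_eq _).2 (Subtype.ext ?_)
  exact DirectSum.decompose_of_mem_same Γ.gr (Γ.emb_mem a)

theorem projZero_eq_zero {n : ℕ} (hn : n ≠ 0) {x : Γ.Form} (hx : x ∈ Γ.gr n) :
    Γ.projZero x = 0 := by
  refine (LinearEquiv.symm_apply_eq _).2 (Subtype.ext ?_)
  rw [map_zero]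
  exact DirectSum.decompose_of_mem_ne Γ.gr hx hn

end DiffCalculus

theorem RightCovariantCalculus.coaction_mem {H : Type u} [Ring H] [HopfAlgebra ℂ H]
    (Θ : RightCovariantCalculus.{u, v} H) {n : ℕ} {ρ : Θ.Form} (hρ : ρ ∈ Θ.gr n) :
    Θ.coaction ρ ∈ tensorDegree Θ.gr H n := by
  let F : ℕ → Submodule ℂ Θ.Form := fun n =>
    (tensorDegree Θ.gr H n).comap Θ.coaction.toLinearMap
  have : SetLike.GradedMonoid F :=
    { one_mem := by
        change Θ.coaction 1 ∈ tensorDegree Θ.gr H 0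
        rw [map_one]
        exact SetLike.one_mem_graded (tensorDegree Θ.gr H)
      mul_mem := fun k l x y hx hy => by
        change Θ.coaction (x * y) ∈ tensorDegree Θ.gr H (k + l)
        rw [map_mul]
        exact SetLike.mul_mem_graded (A := tensorDegree Θ.gr H) hx hy }
  refine graded_le_of_adjoin_eq_top Θ.gr F Θ.generated ?_ n hρ
  rintro _ (⟨h, rfl⟩ | ⟨h, rfl⟩)
  · refine ⟨0, Θ.emb_mem h, ?_⟩
    change Θ.coaction (Θ.emb h) ∈ tensorDegree Θ.gr H 0
    rw [Θ.coaction_emb]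
    exact rTensor_mem_tensorDegree Θ.emb_mem _
  · refine ⟨1, Θ.d_mem (Θ.emb_mem h), ?_⟩
    change Θ.coaction (Θ.d (Θ.emb h)) ∈ tensorDegree Θ.gr H 1
    rw [Θ.coaction_d]
    exact rTensor_mem_tensorDegree (g := Θ.d ∘ₗ Θ.emb.toLinearMap)
      (fun k => Θ.d_mem (Θ.emb_mem k)) _

section Skew

open GradedTensorProduct

variable {A : Type u} [Ring A] [Algebra ℂ A] (Γ : DiffCalculus.{u, v} A)
variable {H : Type uH} [Ring H]

section Algebra

variable [Algebra ℂ H] (Θ : DiffCalculus.{uH, v'} H)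

@[elab_as_elim]
theorem skew_induction {p : Skew Γ Θ → Prop} (x : Skew Γ Θ) (zero : p 0)
    (tmul : ∀ {m n : ℕ} {γ : Γ.Form} {ρ : Θ.Form}, γ ∈ Γ.gr m → ρ ∈ Θ.gr n → p (γ ᵍ⊗ₜ[ℂ] ρ))
    (add : ∀ x y, p x → p y → p (x + y)) : p x := by
  obtain ⟨t, rfl⟩ := (of ℂ Γ.gr Θ.gr).surjective x
  induction t using TensorProduct.induction_on with
  | zero => rwa [map_zero]
  | tmul γ ρ =>
    induction γ using DirectSum.Decomposition.inductionOn Γ.gr with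
    | zero => rwa [TensorProduct.zero_tmul, map_zero]
    | homogeneous γ =>
      induction ρ using DirectSum.Decomposition.inductionOn Θ.gr with
      | zero => rwa [TensorProduct.tmul_zero, map_zero]
      | homogeneous ρ => exact tmul γ.2 ρ.2
      | add a b ha hb => rw [TensorProduct.tmul_add, map_add]; exact add _ _ ha hb
    | add a b ha hb => rw [TensorProduct.add_tmul, map_add]; exact add _ _ ha hb
  | add a b ha hb => rw [map_add]; exact add _ _ ha hb

variable {Γ Θ}

theorem gtmul_mul_gtmul {p q : ℕ} {ρ : Θ.Form} {ω : Γ.Form} (hρ : ρ ∈ Θ.gr p) (hω : ω ∈ Γ.gr q)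
    (γ : Γ.Form) (τ : Θ.Form) :
    (γ ᵍ⊗ₜ[ℂ] ρ * ω ᵍ⊗ₜ[ℂ] τ : Skew Γ Θ) = (-1 : ℂ) ^ (p * q) • (γ * ω) ᵍ⊗ₜ[ℂ] (ρ * τ) := by
  refine (tmul_coe_mul_coe_tmul (R := ℂ) Γ.gr Θ.gr γ ⟨ρ, hρ⟩ ⟨ω, hω⟩ τ).trans ?_
  obtain h | h := Nat.even_or_odd (p * q) <;> simp [h.neg_one_pow]

variable (Γ Θ)

/-- The linear map which is multiplication by `(-1)ⁿ` in total degree `n`. -/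
def skewParity : Skew Γ Θ →ₗ[ℂ] Skew Γ Θ :=
  (of ℂ Γ.gr Θ.gr).toLinearMap ∘ₗ TensorProduct.map Γ.parity Θ.parity ∘ₗ
    (of ℂ Γ.gr Θ.gr).symm.toLinearMap

theorem skewParity_gtmul (γ : Γ.Form) (ρ : Θ.Form) :
    skewParity Γ Θ (γ ᵍ⊗ₜ[ℂ] ρ) = Γ.parity γ ᵍ⊗ₜ[ℂ] Θ.parity ρ := rfl

theorem skewD_gtmul (γ : Γ.Form) (ρ : Θ.Form) :
    skewD Γ Θ (γ ᵍ⊗ₜ[ℂ] ρ) = Γ.d γ ᵍ⊗ₜ[ℂ] ρ + Γ.parity γ ᵍ⊗ₜ[ℂ] Θ.d ρ := rfl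

theorem skewParity_mul (x y : Skew Γ Θ) :
    skewParity Γ Θ (x * y) = skewParity Γ Θ x * skewParity Γ Θ y := by
  induction x using skew_induction with
  | zero => simp
  | tmul _ hρ =>
    induction y using skew_induction with
    | zero => simp
    | tmul hω _ =>
      rw [gtmul_mul_gtmul hρ hω, map_smul, skewParity_gtmul, skewParity_gtmul, skewParity_gtmul,
        gtmul_mul_gtmul (Θ.parity_mem hρ) (Γ.parity_mem hω), Γ.parity_mul, Θ.parity_mul]
    | add x y hx hy => rw [mul_add, map_add, hx, hy, map_add, mul_add]
  | add x y hx hy => rw [add_mul, map_add, hx, hy, map_add, add_mul]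

theorem skewD_mul (x y : Skew Γ Θ) :
    skewD Γ Θ (x * y) = skewD Γ Θ x * y + skewParity Γ Θ x * skewD Γ Θ y := by
  induction x using skew_induction with
  | zero => simp
  | @tmul _ p γ ρ _ hρ =>
    induction y using skew_induction with
    | zero => simp
    | @tmul q _ ω τ hω _ =>
      rw [gtmul_mul_gtmul hρ hω, map_smul, skewD_gtmul, skewD_gtmul, skewD_gtmul, skewParity_gtmul,
        add_mul, mul_add, gtmul_mul_gtmul hρ hω, gtmul_mul_gtmul (Θ.d_mem hρ) hω,
        gtmul_mul_gtmul (Θ.parity_mem hρ) (Γ.d_mem hω),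
        gtmul_mul_gtmul (Θ.parity_mem hρ) (Γ.parity_mem hω), Γ.d_mul, Θ.d_mul, Γ.parity_mul,
        Γ.parity_apply hω, Θ.parity_apply hρ]
      simp only [tmul, TensorProduct.add_tmul, TensorProduct.tmul_add, map_add, mul_smul_comm,
        smul_mul_assoc, TensorProduct.tmul_smul, ← TensorProduct.smul_tmul', map_smul]
      match_scalars <;> ring_nf
      rw [(even_two.mul_left p).neg_one_pow, one_mul]
    | add x y hx hy => rw [mul_add, map_add, hx, hy, map_add, mul_add, mul_add]; abel
  | add x y hx hy => rw [add_mul, map_add, hx, hy, map_add, map_add, add_mul, add_mul]; abel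

theorem skewD_skewD (x : Skew Γ Θ) : skewD Γ Θ (skewD Γ Θ x) = 0 := by
  suffices skewD Γ Θ ∘ₗ skewD Γ Θ ∘ₗ (of ℂ Γ.gr Θ.gr).toLinearMap = 0 from
    LinearMap.congr_fun this ((of ℂ Γ.gr Θ.gr).symm x)
  refine TensorProduct.ext' fun γ ρ => ?_
  change skewD Γ Θ (skewD Γ Θ (γ ᵍ⊗ₜ[ℂ] ρ)) = 0
  rw [skewD_gtmul, map_add, skewD_gtmul, skewD_gtmul, Γ.d_d, Θ.d_d, Γ.d_parity]
  simp [tmul, TensorProduct.neg_tmul]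

theorem skewParity_skewD (x : Skew Γ Θ) :
    skewParity Γ Θ (skewD Γ Θ x) = -skewD Γ Θ (skewParity Γ Θ x) := by
  suffices skewParity Γ Θ ∘ₗ skewD Γ Θ ∘ₗ (of ℂ Γ.gr Θ.gr).toLinearMap =
      -(skewD Γ Θ ∘ₗ skewParity Γ Θ ∘ₗ (of ℂ Γ.gr Θ.gr).toLinearMap) from
    LinearMap.congr_fun this ((of ℂ Γ.gr Θ.gr).symm x)
  refine TensorProduct.ext' fun γ ρ => ?_
  change skewParity Γ Θ (skewD Γ Θ (γ ᵍ⊗ₜ[ℂ] ρ)) = -skewD Γ Θ (skewParity Γ Θ (γ ᵍ⊗ₜ[ℂ] ρ))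
  rw [skewD_gtmul, map_add, skewParity_gtmul, skewParity_gtmul, skewParity_gtmul, skewD_gtmul,
    Γ.d_parity, Θ.d_parity]
  simp [tmul, TensorProduct.neg_tmul, TensorProduct.tmul_neg, add_comm]

theorem skewParity_horIncl (y : Γ.Form ⊗[ℂ] H) :
    skewParity Γ Θ (horIncl Γ Θ y) = horIncl Γ Θ (Γ.parity.rTensor H y) := by
  suffices skewParity Γ Θ ∘ₗ (horIncl Γ Θ).toLinearMap =
      (horIncl Γ Θ).toLinearMap ∘ₗ Γ.parity.rTensor H from LinearMap.congr_fun this y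
  refine TensorProduct.ext' fun γ h => ?_
  change skewParity Γ Θ (horIncl Γ Θ (γ ⊗ₜ h)) = horIncl Γ Θ (Γ.parity γ ⊗ₜ h)
  rw [horIncl_tmul, horIncl_tmul, skewParity_gtmul, Θ.parity_emb]

theorem skewParity_zeroIncl (y : A ⊗[ℂ] H) :
    skewParity Γ Θ (zeroIncl Γ Θ y) = zeroIncl Γ Θ y := by
  refine (skewParity_horIncl Γ Θ _).trans (congrArg (horIncl Γ Θ) ?_)
  suffices Γ.parity.rTensor H ∘ₗ
      (Algebra.TensorProduct.map Γ.emb (AlgHom.id ℂ H)).toLinearMap =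
      (Algebra.TensorProduct.map Γ.emb (AlgHom.id ℂ H)).toLinearMap from LinearMap.congr_fun this y
  exact TensorProduct.ext' fun a h => congrArg (· ⊗ₜ h) (Γ.parity_emb a)

/-- The linear map `Γ ⊗̂ Θ → Γ ⊗ H` which is left inverse to `horIncl` and kills the forms of
positive degree in the factor `Θ`. -/
def horRetract : Skew Γ Θ →ₗ[ℂ] Γ.Form ⊗[ℂ] H :=
  Θ.projZero.lTensor Γ.Form ∘ₗ (of ℂ Γ.gr Θ.gr).symm.toLinearMap

theorem horRetract_gtmul (γ : Γ.Form) (ρ : Θ.Form) :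
    horRetract Γ Θ (γ ᵍ⊗ₜ[ℂ] ρ) = γ ⊗ₜ Θ.projZero ρ := rfl

theorem horRetract_horIncl (y : Γ.Form ⊗[ℂ] H) : horRetract Γ Θ (horIncl Γ Θ y) = y := by
  suffices horRetract Γ Θ ∘ₗ (horIncl Γ Θ).toLinearMap = LinearMap.id from
    LinearMap.congr_fun this y
  refine TensorProduct.ext' fun γ h => ?_
  change horRetract Γ Θ (horIncl Γ Θ (γ ⊗ₜ h)) = γ ⊗ₜ h
  rw [horIncl_tmul, horRetract_gtmul, Θ.projZero_emb]

theorem horRetract_mem_tensorDegree {n : ℕ} {x : Skew Γ Θ} (hx : x ∈ skewDegree Γ Θ n) :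
    horRetract Γ Θ x ∈ tensorDegree Γ.gr H n := by
  suffices skewDegree Γ Θ n ≤ (tensorDegree Γ.gr H n).comap (horRetract Γ Θ) from this hx
  refine iSup₂_le fun ⟨p, q⟩ hpq =>
    Submodule.map_le_iff_le_comap.2 (Submodule.map₂_le.2 fun γ hγ ρ hρ => ?_)
  change γ ⊗ₜ Θ.projZero ρ ∈ tensorDegree Γ.gr H n
  obtain rfl | hq := eq_or_ne q 0
  · obtain rfl : p = n := by simpa using hpq
    exact tmul_mem_tensorDegree hγ _
  · rw [Θ.projZero_eq_zero hq hρ, TensorProduct.tmul_zero]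
    exact zero_mem _

theorem horIncl_mem_skewDegree {n : ℕ} {y : Γ.Form ⊗[ℂ] H} (hy : y ∈ tensorDegree Γ.gr H n) :
    horIncl Γ Θ y ∈ skewDegree Γ Θ n := by
  suffices tensorDegree Γ.gr H n ≤ (skewDegree Γ Θ n).comap (horIncl Γ Θ).toLinearMap from this hy
  refine tensorDegree_le.2 fun γ hγ h => ?_
  change horIncl Γ Θ (γ ⊗ₜ h) ∈ skewDegree Γ Θ n
  rw [horIncl_tmul]
  have hn : (n, 0) ∈ Finset.HasAntidiagonal.antidiagonal n := by simp
  exact Submodule.mem_iSup_of_mem (n, 0) (Submodule.mem_iSup_of_mem hn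
    (Submodule.mem_map_of_mem (Submodule.apply_mem_map₂ _ hγ (Θ.emb_mem h))))

end Algebra

section Coaction

variable [HopfAlgebra ℂ H] (Θ : RightCovariantCalculus.{uH, v'} H)

theorem includeLeft_mul_includeRight {m n : ℕ} (γ : Γ.gr m) (ρ : Θ.gr n) :
    includeLeft Γ.gr Θ.gr (γ : Γ.Form) * includeRight Γ.gr Θ.gr (ρ : Θ.Form) =
      (-1 : ℤˣ) ^ (n * m) • (includeRight Γ.gr Θ.gr (ρ : Θ.Form) *
        includeLeft Γ.gr Θ.gr (γ : Γ.Form)) := by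
  rw [includeLeft_apply, includeRight_apply, tmul_coe_mul_coe_tmul, one_mul, mul_one,
    tmul_one_mul_one_tmul, smul_smul, Int.units_mul_self, one_smul]

/-- The coaction `id ⊗ Δ^Γ` of `H` on `Γ ⊗̂ Θ`, as a homomorphism. -/
def skewCoaction : Skew Γ Θ.toDiffCalculus →ₐ[ℂ] Skew Γ Θ.toDiffCalculus ⊗[ℂ] H :=
  lift Γ.gr Θ.gr (Algebra.TensorProduct.includeLeft.comp (includeLeft Γ.gr Θ.gr))
    ((Algebra.TensorProduct.map (includeRight Γ.gr Θ.gr) (AlgHom.id ℂ H)).comp Θ.coaction)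
    fun m n γ ρ => by
      let L := LinearMap.mulLeft ℂ (includeLeft Γ.gr Θ.gr (γ : Γ.Form) ⊗ₜ[ℂ] (1 : H))
      let R := LinearMap.mulRight ℂ (includeLeft Γ.gr Θ.gr (γ : Γ.Form) ⊗ₜ[ℂ] (1 : H))
      let g := (Algebra.TensorProduct.map (includeRight Γ.gr Θ.gr) (AlgHom.id ℂ H)).toLinearMap
      suffices tensorDegree Θ.gr H n ≤ LinearMap.eqLocus (L ∘ₗ g) ((-1 : ℤˣ) ^ (n * m) • R ∘ₗ g)
        from this (Θ.coaction_mem ρ.2)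
      refine tensorDegree_le.2 fun τ hτ h => ?_
      change includeLeft Γ.gr Θ.gr (γ : Γ.Form) ⊗ₜ[ℂ] (1 : H) * includeRight Γ.gr Θ.gr τ ⊗ₜ h =
        (-1 : ℤˣ) ^ (n * m) • (includeRight Γ.gr Θ.gr τ ⊗ₜ h *
          includeLeft Γ.gr Θ.gr (γ : Γ.Form) ⊗ₜ[ℂ] (1 : H))
      rw [Algebra.TensorProduct.tmul_mul_tmul, Algebra.TensorProduct.tmul_mul_tmul, one_mul,
        mul_one, includeLeft_mul_includeRight Γ Θ γ ⟨τ, hτ⟩]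
      obtain hs | hs := Int.units_eq_one_or ((-1) ^ (n * m)) <;>
        simp only [hs, one_smul, Units.neg_smul, TensorProduct.neg_tmul]

theorem skewCoaction_gtmul (γ : Γ.Form) (ρ : Θ.Form) :
    skewCoaction Γ Θ (γ ᵍ⊗ₜ[ℂ] ρ) =
      ((of ℂ Γ.gr Θ.gr).toLinearMap ∘ₗ TensorProduct.mk ℂ Γ.Form Θ.Form γ).rTensor H
        (Θ.coaction ρ) := by
  suffices LinearMap.mulLeft ℂ (includeLeft Γ.gr Θ.gr γ ⊗ₜ[ℂ] (1 : H)) ∘ₗ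
      (Algebra.TensorProduct.map (includeRight Γ.gr Θ.gr) (AlgHom.id ℂ H)).toLinearMap =
      ((of ℂ Γ.gr Θ.gr).toLinearMap ∘ₗ TensorProduct.mk ℂ Γ.Form Θ.Form γ).rTensor H from
    LinearMap.congr_fun this (Θ.coaction ρ)
  refine TensorProduct.ext' fun τ h => ?_
  change includeLeft Γ.gr Θ.gr γ ⊗ₜ[ℂ] (1 : H) * includeRight Γ.gr Θ.gr τ ⊗ₜ h =
    (γ ᵍ⊗ₜ[ℂ] τ) ⊗ₜ h
  rw [Algebra.TensorProduct.tmul_mul_tmul, one_mul, includeLeft_apply, includeRight_apply,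
    tmul_one_mul_one_tmul]

theorem skewCoaction_horIncl (y : Γ.Form ⊗[ℂ] H) :
    skewCoaction Γ Θ (horIncl Γ Θ.toDiffCalculus y) =
      (horIncl Γ Θ.toDiffCalculus).toLinearMap.rTensor H (cofreeCoaction Γ.Form H y) := by
  suffices (skewCoaction Γ Θ).toLinearMap ∘ₗ (horIncl Γ Θ.toDiffCalculus).toLinearMap =
      (horIncl Γ Θ.toDiffCalculus).toLinearMap.rTensor H ∘ₗ cofreeCoaction Γ.Form H from
    LinearMap.congr_fun this y
  refine TensorProduct.ext' fun γ h => ?_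
  change skewCoaction Γ Θ (horIncl Γ Θ.toDiffCalculus (γ ⊗ₜ h)) =
    (horIncl Γ Θ.toDiffCalculus).toLinearMap.rTensor H (cofreeCoaction Γ.Form H (γ ⊗ₜ h))
  rw [horIncl_tmul, skewCoaction_gtmul, Θ.coaction_emb, cofreeCoaction_tmul,
    ← LinearMap.rTensor_comp_apply, ← LinearMap.rTensor_comp_apply]
  congr 2
  exact LinearMap.ext fun k => (horIncl_tmul Γ Θ.toDiffCalculus γ k).symm

theorem skewCoaction_skewD_zeroIncl (y : A ⊗[ℂ] H) :
    skewCoaction Γ Θ (skewD Γ Θ.toDiffCalculus (zeroIncl Γ Θ.toDiffCalculus y)) =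
      (skewD Γ Θ.toDiffCalculus ∘ₗ (zeroIncl Γ Θ.toDiffCalculus).toLinearMap).rTensor H
        (cofreeCoaction A H y) := by
  suffices (skewCoaction Γ Θ).toLinearMap ∘ₗ skewD Γ Θ.toDiffCalculus ∘ₗ
      (zeroIncl Γ Θ.toDiffCalculus).toLinearMap =
      (skewD Γ Θ.toDiffCalculus ∘ₗ (zeroIncl Γ Θ.toDiffCalculus).toLinearMap).rTensor H ∘ₗ
        cofreeCoaction A H from LinearMap.congr_fun this y
  refine TensorProduct.ext' fun a h => ?_
  change skewCoaction Γ Θ (skewD Γ Θ.toDiffCalculus (zeroIncl Γ Θ.toDiffCalculus (a ⊗ₜ h))) =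
    (skewD Γ Θ.toDiffCalculus ∘ₗ (zeroIncl Γ Θ.toDiffCalculus).toLinearMap).rTensor H
      (cofreeCoaction A H (a ⊗ₜ h))
  rw [zeroIncl_tmul, skewD_gtmul, map_add, skewCoaction_gtmul, skewCoaction_gtmul, Γ.parity_emb,
    Θ.coaction_emb, Θ.coaction_d, cofreeCoaction_tmul, ← LinearMap.rTensor_comp_apply,
    ← LinearMap.rTensor_comp_apply, ← LinearMap.rTensor_comp_apply, ← LinearMap.add_apply,
    ← LinearMap.rTensor_add]
  congr 2
  refine LinearMap.ext fun k => ?_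
  change Γ.d (Γ.emb a) ᵍ⊗ₜ[ℂ] Θ.emb k + Γ.emb a ᵍ⊗ₜ[ℂ] Θ.d (Θ.emb k) =
    skewD Γ Θ.toDiffCalculus (zeroIncl Γ Θ.toDiffCalculus (a ⊗ₜ k))
  rw [zeroIncl_tmul, skewD_gtmul, Γ.parity_emb]

end Coaction

end Skew

namespace Bundle

variable {H : Type uH} {B : Type uB} {P : Type uP} {I : Type w} [Ring H] [HopfAlgebra ℂ H]
  [Ring B] [Algebra ℂ B] [Ring P] [Algebra ℂ P] (X : Bundle H B P I)

theorem cofreeCoaction_χ (k : I) (p : P) :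
    cofreeCoaction (X.Loc k) H (X.χ k p) = (X.χ k).toLinearMap.rTensor H (X.coaction p) :=
  (TensorProduct.assoc ℂ (X.Loc k) H H).injective
    ((assoc_cofreeCoaction (X.χ k p)).trans (X.χ_colinear k p))

/-- The action `p ↦ ∑ φ(p₁) p₀` on `P` of a linear functional `φ` on `H`. -/
def act (φ : H →ₗ[ℂ] ℂ) : P →ₗ[ℂ] P := slice P φ ∘ₗ X.coaction.toLinearMap

theorem χ_act (k : I) (φ : H →ₗ[ℂ] ℂ) (p : P) :
    X.χ k (X.act φ p) = (hit φ).lTensor (X.Loc k) (X.χ k p) := by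
  rw [← slice_cofreeCoaction, cofreeCoaction_χ, slice_rTensor]
  rfl

theorem χ_act_of_eq_tmul_one {k : I} {p : P} {c : X.Loc k} (hp : X.χ k p = c ⊗ₜ 1)
    (φ : H →ₗ[ℂ] ℂ) : X.χ k (X.act φ p) = φ 1 • X.χ k p := by
  rw [χ_act, hp, LinearMap.lTensor_tmul, hit_one, TensorProduct.tmul_smul]

theorem slice_counit_χ_act (k : I) (φ : H →ₗ[ℂ] ℂ) (p : P) :
    slice (X.Loc k) Coalgebra.counit (X.χ k (X.act φ p)) = slice (X.Loc k) φ (X.χ k p) := by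
  rw [χ_act, slice_counit_hit]

/-- The map `p ↦ ∑ p₀ s(S(p₁))`, where `s h` is a lift of `1 ⊗ h` from the `k`-th trivialization.
Over the `k`-th chart it is the projection to the elements `c ⊗ 1`. -/
def trace (k : I) : P →ₗ[ℂ] P :=
  LinearMap.mul' ℂ P ∘ₗ
    (X.sect k ∘ₗ TensorProduct.mk ℂ (X.Loc k) H 1 ∘ₗ HopfAlgebra.antipode ℂ).lTensor P ∘ₗ
      X.coaction.toLinearMap

theorem χ_trace_eq (k l : I) (p : P) :
    X.χ l (X.trace k p) = LinearMap.mul' ℂ (X.Loc l ⊗[ℂ] H)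
      (((X.χ l).toLinearMap ∘ₗ X.sect k ∘ₗ TensorProduct.mk ℂ (X.Loc k) H 1 ∘ₗ
        HopfAlgebra.antipode ℂ).lTensor _ (cofreeCoaction (X.Loc l) H (X.χ l p))) := by
  let s := X.sect k ∘ₗ TensorProduct.mk ℂ (X.Loc k) H 1 ∘ₗ HopfAlgebra.antipode ℂ
  suffices (X.χ l).toLinearMap ∘ₗ LinearMap.mul' ℂ P ∘ₗ s.lTensor P =
      LinearMap.mul' ℂ (X.Loc l ⊗[ℂ] H) ∘ₗ ((X.χ l).toLinearMap ∘ₗ s).lTensor _ ∘ₗ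
        (X.χ l).toLinearMap.rTensor H by
    rw [cofreeCoaction_χ]
    exact LinearMap.congr_fun this (X.coaction p)
  exact TensorProduct.ext' fun q h => map_mul (X.χ l) q (s h)

theorem χ_trace (k : I) (p : P) :
    X.χ k (X.trace k p) = slice (X.Loc k) Coalgebra.counit (X.χ k p) ⊗ₜ 1 := by
  let s := (X.χ k).toLinearMap ∘ₗ X.sect k ∘ₗ TensorProduct.mk ℂ (X.Loc k) H 1 ∘ₗ
    HopfAlgebra.antipode ℂ
  suffices LinearMap.mul' ℂ (X.Loc k ⊗[ℂ] H) ∘ₗ s.lTensor _ ∘ₗ cofreeCoaction (X.Loc k) H =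
      (TensorProduct.mk ℂ (X.Loc k) H).flip 1 ∘ₗ slice (X.Loc k) Coalgebra.counit from
    (X.χ_trace_eq k k p).trans (LinearMap.congr_fun this (X.χ k p))
  refine TensorProduct.ext' fun b h => ?_
  have hb : LinearMap.mul' ℂ (X.Loc k ⊗[ℂ] H) ∘ₗ s.lTensor _ ∘ₗ
      (TensorProduct.mk ℂ (X.Loc k) H b).rTensor H =
        TensorProduct.mk ℂ (X.Loc k) H b ∘ₗ LinearMap.mul' ℂ H ∘ₗ
          (HopfAlgebra.antipode ℂ).lTensor H := by
    refine TensorProduct.ext' fun a c => ?_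
    change b ⊗ₜ a * X.χ k (X.sect k (1 ⊗ₜ HopfAlgebra.antipode ℂ c)) =
      b ⊗ₜ[ℂ] (a * HopfAlgebra.antipode ℂ c)
    rw [χ_sect, Algebra.TensorProduct.tmul_mul_tmul, mul_one]
  rw [LinearMap.comp_apply, LinearMap.comp_apply, cofreeCoaction_tmul]
  refine (LinearMap.congr_fun hb (Coalgebra.comul h)).trans ?_
  rw [LinearMap.comp_apply, LinearMap.comp_apply, HopfAlgebra.mul_antipode_lTensor_comul_apply,
    Algebra.algebraMap_eq_smul_one, map_smul, LinearMap.comp_apply, slice_tmul, map_smul]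
  rfl

/-- The elements of `P` which vanish in the local trivializations over `T`. -/
def vanish (T : Set I) : Ideal P := ⨅ l ∈ T, RingHom.ker (X.χ l)

theorem mem_vanish {T : Set I} {p : P} : p ∈ X.vanish T ↔ ∀ l ∈ T, X.χ l p = 0 := by
  simp [vanish, Submodule.mem_iInf]

theorem trace_mem_vanish (k : I) {T : Set I} {p : P} (hp : p ∈ X.vanish T) :
    X.trace k p ∈ X.vanish T := by
  refine X.mem_vanish.2 fun l hl => ?_
  rw [χ_trace_eq, X.mem_vanish.1 hp l hl, map_zero, map_zero, map_zero]

/-- Since `trace k` preserves `vanish T`, the coefficients of `t` in a basis of `H` can be lifted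
one by one. -/
theorem exists_mem_vanish (k : I) {T : Set I} {t : X.Loc k ⊗[ℂ] H}
    (h : ∀ φ, ∃ n ∈ X.vanish T, slice (X.Loc k) Coalgebra.counit (X.χ k n) = slice (X.Loc k) φ t) :
    ∃ n ∈ X.vanish T, X.χ k n = t := by
  let b := Module.Basis.ofVectorSpace ℂ H
  obtain ⟨s, hs⟩ := (eventually_sum_slice_coord_eq b t).exists
  choose n hn hn' using fun i => h (b.coord i)
  refine ⟨∑ i ∈ s, X.trace k (n i) * X.sect k (1 ⊗ₜ b i), Submodule.sum_mem _ fun i _ =>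
    X.mem_vanish.2 fun l hl => ?_, ?_⟩
  · rw [map_mul, X.mem_vanish.1 (X.trace_mem_vanish k (hn i)) l hl, zero_mul]
  · refine (map_sum (X.χ k) _ s).trans (Eq.trans ?_ hs)
    refine Finset.sum_congr rfl fun i _ => ?_
    rw [map_mul, χ_trace, χ_sect, hn', Algebra.TensorProduct.tmul_mul_tmul, one_mul, mul_one]

theorem exists_coinvariant_correction {T : Set I} (k : I) {p : P}
    (h : ∀ l ∈ T, ∃ c, X.χ l p = c ⊗ₜ 1) :
    ∃ n ∈ X.vanish T, ∃ c, X.χ k (p - n) = c ⊗ₜ 1 := by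
  obtain ⟨n, hn, hn'⟩ := X.exists_mem_vanish k (T := T)
    (t := X.χ k p - slice (X.Loc k) Coalgebra.counit (X.χ k p) ⊗ₜ 1) fun φ => by
      refine ⟨X.act φ p - φ 1 • p, X.mem_vanish.2 fun l hl => ?_, ?_⟩
      · obtain ⟨c, hc⟩ := h l hl
        rw [map_sub, map_smul, X.χ_act_of_eq_tmul_one hc, sub_self]
      · rw [map_sub, map_sub, slice_counit_χ_act, map_sub, slice_tmul, map_smul, map_smul]
  exact ⟨n, hn, slice (X.Loc k) Coalgebra.counit (X.χ k p), by rw [map_sub, hn', sub_sub_cancel]⟩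

theorem exists_coinvariant_extension {S T : Set I} (hS : S.Finite) {p : P}
    (h : ∀ l ∈ T, ∃ c, X.χ l p = c ⊗ₜ 1) :
    ∃ q, (∀ l ∈ T, X.χ l q = X.χ l p) ∧ ∀ l ∈ T ∪ S, ∃ c, X.χ l q = c ⊗ₜ 1 := by
  induction S, hS using Set.Finite.induction_on with
  | empty => exact ⟨p, fun _ _ => rfl, by rwa [Set.union_empty]⟩
  | @insert k S _ _ ih =>
    obtain ⟨q, hqp, hq⟩ := ih
    obtain ⟨n, hn, hk⟩ := X.exists_coinvariant_correction k hq
    have hn' : ∀ l ∈ T ∪ S, X.χ l (q - n) = X.χ l q := fun l hl => by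
      rw [map_sub, X.mem_vanish.1 hn l hl, sub_zero]
    rw [Set.union_insert]
    exact ⟨q - n, fun l hl => (hn' l (Or.inl hl)).trans (hqp l hl),
      Set.forall_mem_insert.2 ⟨hk, fun l hl => hn' l hl ▸ hq l hl⟩⟩

theorem exists_ι_eq {p : P} (h : ∀ l, ∃ c, X.χ l p = c ⊗ₜ 1) : ∃ b, X.ι b = p := by
  refine (X.range_ι p).2 (slice_ext fun φ => ?_)
  suffices X.act φ p - φ 1 • p ∈ (⨅ l, RingHom.ker (X.χ l) : Ideal P) by
    rw [X.complete_total.1] at this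
    exact sub_eq_zero.1 this
  refine (Submodule.mem_iInf _).2 fun l => ?_
  obtain ⟨c, hc⟩ := h l
  rw [RingHom.mem_ker, map_sub, map_smul, X.χ_act_of_eq_tmul_one hc, sub_self]

section Finite

variable [Finite I]

theorem exists_χ_ι_eq (T : Set I) {p : P} (h : ∀ l ∈ T, ∃ c, X.χ l p = c ⊗ₜ 1) :
    ∃ b, ∀ l ∈ T, X.χ l (X.ι b) = X.χ l p := by
  obtain ⟨q, hqp, hq⟩ := X.exists_coinvariant_extension Set.finite_univ h
  obtain ⟨b, rfl⟩ := X.exists_ι_eq fun l => hq l (Or.inr trivial)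
  exact ⟨b, hqp⟩

theorem mem_sup_of_χ {k l : I} {p : P} (hk : X.χ k p = 0) {b : B}
    (hl : X.χ l p = Ideal.Quotient.mk (X.J l) b ⊗ₜ 1) : b ∈ X.J k ⊔ X.J l := by
  obtain ⟨c, hc⟩ := X.exists_χ_ι_eq {k, l} (p := p) (by
    rintro m (rfl | rfl)
    · exact ⟨0, by rw [hk, TensorProduct.zero_tmul]⟩
    · exact ⟨_, hl⟩)
  have hε : ∀ (m : I) (b : B), slice (X.Loc m) (Coalgebra.counit : H →ₗ[ℂ] ℂ)
      (X.χ m (X.ι b)) = Ideal.Quotient.mk (X.J m) b := fun m b => by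
    rw [X.χ_ι, slice_tmul, Bialgebra.counit_one, one_smul]
  have hck : c ∈ X.J k := by
    rw [← Ideal.Quotient.eq_zero_iff_mem, ← hε, hc k (Or.inl rfl), hk, map_zero]
  have hbc : b - c ∈ X.J l := by
    rw [← Ideal.Quotient.eq, ← hε, ← hε l c, hc l (Or.inr rfl), hl, X.χ_ι]
  rw [← add_sub_cancel c b]
  exact Submodule.add_mem_sup hck hbc

variable {k l : I} (L : Ideal B) [L.IsTwoSided] (hk : X.J k ≤ L) (hl : X.J l ≤ L)

include hk in
theorem χRestrict_eq_zero {p : P} (hp : X.χ k p = 0) : X.χRestrict L hl p = 0 := by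
  refine slice_ext fun φ => ?_
  obtain ⟨b, hb⟩ := Ideal.Quotient.mk_surjective
    (slice (X.Loc l) (Coalgebra.counit : H →ₗ[ℂ] ℂ) (X.χ l (X.act φ p)))
  have hact : X.act φ p ∈ X.vanish {k} := X.mem_vanish.2 fun m hm => by
    rw [Set.mem_singleton_iff.1 hm, χ_act, hp, map_zero]
  have hbL : b ∈ X.J k ⊔ X.J l :=
    X.mem_sup_of_χ (X.mem_vanish.1 (X.trace_mem_vanish l hact) k rfl) (by rw [χ_trace, hb])
  rw [map_zero, χRestrict, LinearMap.comp_apply, slice_rTensor]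
  change Ideal.Quotient.factorₐ ℂ hl (slice (X.Loc l) φ (X.χ l p)) = 0
  rw [← slice_counit_χ_act, ← hb]
  exact Ideal.Quotient.eq_zero_iff_mem.2 (sup_le hk hl hbL)

include hk in
theorem χRestrict_congr {p q : P} (h : X.χ k p = X.χ k q) :
    X.χRestrict L hl p = X.χRestrict L hl q := by
  rw [← sub_eq_zero, ← map_sub]
  exact X.χRestrict_eq_zero L hk hl (by rw [map_sub, h, sub_self])

include hk in
theorem χRestrict_sect (h : H) :
    X.χRestrict L hl (X.sect k (1 ⊗ₜ h)) =
      (X.transition k l L hl).rTensor H (Coalgebra.comul h) := by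
  refine slice_ext fun φ => ?_
  have hact : X.χ k (X.act φ (X.sect k (1 ⊗ₜ h))) = X.χ k (X.sect k (1 ⊗ₜ hit φ h)) := by
    rw [χ_act, χ_sect, χ_sect, LinearMap.lTensor_tmul]
  have hslice : ∀ (φ : H →ₗ[ℂ] ℂ) p, slice _ φ (X.χRestrict L hl p) =
      Ideal.Quotient.factorₐ ℂ hl (slice (X.Loc l) φ (X.χ l p)) := fun φ p => slice_rTensor φ _ _
  rw [hslice, ← slice_counit_χ_act, ← hslice, X.χRestrict_congr L hk hl hact, slice_rTensor]
  rfl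

end Finite

end Bundle

section Adapted

variable {I : Type w} {A : Type u} [Ring A] [Algebra ℂ A] {C : I → Type v}
  [∀ i, Ring (C i)] [∀ i, Algebra ℂ (C i)] {f : ∀ i, A →ₐ[ℂ] C i} {d : ∀ i, C i →ₗ[ℂ] C i}

section Stable

variable {σ : ∀ i, C i →ₐ[ℂ] C i} (hσ : ∀ i a, σ i (f i a) = f i a)
  (hσd : ∀ i a, σ i (d i (f i a)) = -d i (f i a))

include hσ hσd

theorem map_mem_adapted {x : ∀ i, C i} (hx : x ∈ adapted f d) :
    (fun i => σ i (x i)) ∈ adapted f d := by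
  suffices adapted f d ≤
      (adapted f d).comap (AlgHom.pi fun i => (σ i).comp (Pi.evalAlgHom ℂ C i)) from this hx
  refine Algebra.adjoin_le ?_
  rintro _ (⟨a, rfl⟩ | ⟨a, rfl⟩)
  · change (fun i => σ i (f i a)) ∈ adapted f d
    simp only [hσ]
    exact (adaptedOf f d a).2
  · change (fun i => σ i (d i (f i a))) ∈ adapted f d
    simp only [hσd]
    exact neg_mem (adaptedD f d a).2

theorem differential_mem_adapted (hdd : ∀ i a, d i (d i (f i a)) = 0)
    (hd : ∀ i x y, d i (x * y) = d i x * y + σ i x * d i y) {x : ∀ i, C i}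
    (hx : x ∈ adapted f d) : (fun i => d i (x i)) ∈ adapted f d := by
  induction hx using Algebra.adjoin_induction with
  | mem x hx =>
    obtain ⟨a, rfl⟩ | ⟨a, rfl⟩ := hx
    · exact (adaptedD f d a).2
    · simp only [hdd]
      exact zero_mem _
  | algebraMap r =>
    simp only [Pi.algebraMap_apply, ← fun i => (f i).commutes r]
    exact (adaptedD f d (algebraMap ℂ A r)).2
  | add x y _ _ hx hy =>
    simp only [Pi.add_apply, map_add]
    exact add_mem hx hy
  | mul x y hx hy hdx hdy =>
    simp only [Pi.mul_apply, hd]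
    exact add_mem (mul_mem hdx hy) (mul_mem (map_mem_adapted hσ hσd hx) hdy)

end Stable

variable {hs : ∀ i, Function.Surjective (adaptedProj f d i)} {i j : I} {a : C i} {b : C j}

theorem overlapLeft_eq_overlapRight_iff :
    overlapLeft hs i j a = overlapRight hs i j b ↔
      ∃ x : adapted f d, adaptedProj f d i x = a ∧ adaptedProj f d j x = b := by
  refine ⟨fun h => ?_, ?_⟩
  · obtain ⟨x, rfl⟩ := hs i a
    obtain ⟨y, rfl⟩ := hs j b
    rw [overlapLeft_apply, overlapRight_apply, ← sub_eq_zero, ← map_sub,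
      toOverlap_eq_zero_iff] at h
    obtain ⟨z, t, hz, ht, hzt⟩ := h
    refine ⟨x - z, by rw [map_sub, hz, sub_zero], ?_⟩
    rw [show x - z = y + t by rw [sub_eq_iff_eq_add, add_assoc, add_comm t z, hzt]; abel, map_add,
      ht, add_zero]
  · rintro ⟨x, rfl, rfl⟩
    rw [overlapLeft_apply, overlapRight_apply]

variable (hab : overlapLeft hs i j a = overlapRight hs i j b)

include hab

theorem eq_of_overlapLeft_eq_overlapRight {R : Type*} [Ring R] [Algebra ℂ R] {g : C i →ₐ[ℂ] R}
    {g' : C j →ₐ[ℂ] R} (hf : ∀ a, g (f i a) = g' (f j a))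
    (hd : ∀ a, g (d i (f i a)) = g' (d j (f j a))) : g a = g' b := by
  obtain ⟨x, rfl, rfl⟩ := overlapLeft_eq_overlapRight_iff.1 hab
  suffices adapted f d ≤ AlgHom.equalizer (g.comp (Pi.evalAlgHom ℂ C i))
    (g'.comp (Pi.evalAlgHom ℂ C j)) from this x.2
  refine Algebra.adjoin_le ?_
  rintro _ (⟨a, rfl⟩ | ⟨a, rfl⟩)
  exacts [hf a, hd a]

theorem overlapLeft_eq_overlapRight_of_stable {T : ∀ k, C k → C k}
    (hT : ∀ x ∈ adapted f d, (fun k => T k (x k)) ∈ adapted f d) :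
    overlapLeft hs i j (T i a) = overlapRight hs i j (T j b) := by
  obtain ⟨x, rfl, rfl⟩ := overlapLeft_eq_overlapRight_iff.1 hab
  exact overlapLeft_eq_overlapRight_iff.2 ⟨⟨_, hT x x.2⟩, rfl, rfl⟩

end Adapted

namespace DiffStructure

open GradedTensorProduct

variable {H : Type uH} {B : Type uB} {P : Type uP} {I : Type w} [Ring H] [HopfAlgebra ℂ H]
  [Ring B] [Algebra ℂ B] [Ring P] [Algebra ℂ P] {X : Bundle H B P I}
  (S : DiffStructure.{v, v'} X)

/-- The algebra homomorphism of `Γ(B i) ⊗̂ Γ(H)` which is multiplication by `(-1)ⁿ` in total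
degree `n`. -/
def parityE (i : I) : S.E i →ₐ[ℂ] S.E i :=
  AlgHom.ofLinearMap (skewParity (S.base i) S.fibre.toDiffCalculus)
    (by rw [← map_one (zeroIncl (S.base i) S.fibre.toDiffCalculus), skewParity_zeroIncl])
    (skewParity_mul (S.base i) S.fibre.toDiffCalculus)

theorem parityE_totalMap (i : I) (p : P) : S.parityE i (S.totalMap i p) = S.totalMap i p :=
  skewParity_zeroIncl _ _ _

theorem parityE_dE_totalMap (i : I) (p : P) :
    S.parityE i (S.dE i (S.totalMap i p)) = -S.dE i (S.totalMap i p) :=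
  (skewParity_skewD _ _ _).trans (congrArg (fun x => -S.dE i x) (S.parityE_totalMap i p))

variable {S} {i j : I}

section Overlap

variable {x : S.E i} {y : S.E j} (h : S.projLeft i j x = S.projRight i j y)

include h

theorem projLeft_parityE : S.projLeft i j (S.parityE i x) = S.projRight i j (S.parityE j y) :=
  overlapLeft_eq_overlapRight_of_stable h fun _ =>
    map_mem_adapted S.parityE_totalMap S.parityE_dE_totalMap

theorem projLeft_dE : S.projLeft i j (S.dE i x) = S.projRight i j (S.dE j y) :=
  overlapLeft_eq_overlapRight_of_stable h (T := fun k => S.dE k) fun _ =>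
    differential_mem_adapted S.parityE_totalMap S.parityE_dE_totalMap
      (fun _ _ => skewD_skewD _ _ _) fun _ => skewD_mul _ _

end Overlap

variable (S)

theorem coE_apply (i : I) (x : S.E i) : S.coE i x = skewCoaction (S.base i) S.fibre x := by
  suffices S.coE i ∘ₗ (of ℂ (S.base i).gr S.fibre.gr).toLinearMap =
      (skewCoaction (S.base i) S.fibre).toLinearMap ∘ₗ
        (of ℂ (S.base i).gr S.fibre.gr).toLinearMap from
    LinearMap.congr_fun this ((of ℂ (S.base i).gr S.fibre.gr).symm x)
  refine TensorProduct.ext' fun γ ρ => ?_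
  refine Eq.trans ?_ (skewCoaction_gtmul (S.base i) S.fibre γ ρ).symm
  change (of ℂ (S.base i).gr S.fibre.gr).toLinearMap.rTensor H
    ((TensorProduct.assoc ℂ (S.BForm i) S.fibre.Form H).symm (γ ⊗ₜ S.fibre.coaction ρ)) = _
  induction S.fibre.coaction ρ using TensorProduct.induction_on with
  | zero => simp only [TensorProduct.tmul_zero, map_zero]
  | tmul σ h => rfl
  | add s t hs ht => simp only [TensorProduct.tmul_add, map_add, hs, ht]

theorem coE_totalMap (i : I) (p : P) :
    S.coE i (S.totalMap i p) = (S.totalMap i).toLinearMap.rTensor H (X.coaction p) := by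
  refine (S.coE_apply i _).trans ((skewCoaction_horIncl _ _ _).trans ?_)
  change (S.hIncl i).toLinearMap.rTensor H (cofreeCoaction (S.BForm i) H
    ((S.base i).emb.toLinearMap.rTensor H (X.χ i p))) = _
  rw [cofreeCoaction_rTensor, X.cofreeCoaction_χ, ← LinearMap.rTensor_comp_apply,
    ← LinearMap.rTensor_comp_apply]
  rfl

theorem coE_dE_totalMap (i : I) (p : P) :
    S.coE i (S.dE i (S.totalMap i p)) =
      (S.dE i ∘ₗ (S.totalMap i).toLinearMap).rTensor H (X.coaction p) := by
  rw [coE_apply]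
  refine (skewCoaction_skewD_zeroIncl _ _ (X.χ i p)).trans ?_
  rw [X.cofreeCoaction_χ, ← LinearMap.rTensor_comp_apply]
  rfl

theorem coE_hIncl (i : I) (x : S.BForm i ⊗[ℂ] H) :
    S.coE i (S.hIncl i x) =
      (S.hIncl i).toLinearMap.rTensor H (cofreeCoaction (S.BForm i) H x) :=
  (S.coE_apply i _).trans (skewCoaction_horIncl _ _ _)

theorem projLeft_totalMap (i j : I) (p : P) :
    S.projLeft i j (S.totalMap i p) = S.projRight i j (S.totalMap j p) :=
  overlapLeft_eq_overlapRight_iff.2 ⟨adaptedOf S.totalMap S.dE p, rfl, rfl⟩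

variable {S}

theorem projLeft_coE {x : S.E i} {y : S.E j} (h : S.projLeft i j x = S.projRight i j y) :
    (S.projLeft i j).toLinearMap.rTensor H (S.coE i x) =
      (S.projRight i j).toLinearMap.rTensor H (S.coE j y) := by
  let g : S.E i →ₐ[ℂ] S.Q i j ⊗[ℂ] H :=
    (Algebra.TensorProduct.map (S.projLeft i j) (AlgHom.id ℂ H)).comp
      (skewCoaction (S.base i) S.fibre)
  let g' : S.E j →ₐ[ℂ] S.Q i j ⊗[ℂ] H :=
    (Algebra.TensorProduct.map (S.projRight i j) (AlgHom.id ℂ H)).comp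
      (skewCoaction (S.base j) S.fibre)
  rw [coE_apply, coE_apply]
  refine eq_of_overlapLeft_eq_overlapRight h (g := g) (g' := g') (fun p => ?_) fun p => ?_
  · change (S.projLeft i j).toLinearMap.rTensor H (skewCoaction _ _ (S.totalMap i p)) =
      (S.projRight i j).toLinearMap.rTensor H (skewCoaction _ _ (S.totalMap j p))
    rw [← coE_apply, ← coE_apply, coE_totalMap, coE_totalMap, ← LinearMap.rTensor_comp_apply,
      ← LinearMap.rTensor_comp_apply]
    congr 2
    exact LinearMap.ext fun p => S.projLeft_totalMap i j p
  · change (S.projLeft i j).toLinearMap.rTensor H (skewCoaction _ _ (S.dE i (S.totalMap i p))) =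
      (S.projRight i j).toLinearMap.rTensor H (skewCoaction _ _ (S.dE j (S.totalMap j p)))
    rw [← coE_apply, ← coE_apply, coE_dE_totalMap, coE_dE_totalMap,
      ← LinearMap.rTensor_comp_apply, ← LinearMap.rTensor_comp_apply]
    congr 2
    exact LinearMap.ext fun p => projLeft_dE (S.projLeft_totalMap i j p)

end DiffStructure

section Convolution

open WithConv

variable {H : Type*} [Ring H] [HopfAlgebra ℂ H] {R : Type*} [Ring R] [Algebra ℂ R]

theorem toConv_conv (f g : H →ₗ[ℂ] R) : toConv (conv f g) = toConv f * toConv g := rfl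

theorem comp_conv {R' : Type*} [Ring R'] [Algebra ℂ R'] (k : R →ₐ[ℂ] R') (f g : H →ₗ[ℂ] R) :
    k.toLinearMap ∘ₗ conv f g = conv (k.toLinearMap ∘ₗ f) (k.toLinearMap ∘ₗ g) :=
  LinearMap.algHom_comp_convMul_distrib k (toConv f) (toConv g)

theorem commute_conv {f g : H →ₗ[ℂ] R} {x : R} (hf : ∀ h, Commute (f h) x)
    (hg : ∀ h, Commute (g h) x) (h : H) : Commute (conv f g h) x := by
  suffices LinearMap.mulRight ℂ x ∘ₗ LinearMap.mul' ℂ R ∘ₗ TensorProduct.map f g =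
      LinearMap.mulLeft ℂ x ∘ₗ LinearMap.mul' ℂ R ∘ₗ TensorProduct.map f g from
    LinearMap.congr_fun this (Coalgebra.comul h)
  exact TensorProduct.ext' fun a b => (hf a).mul_left (hg b)

end Convolution

namespace Bundle

open WithConv

variable {H : Type uH} {B : Type uB} {P : Type uP} {I : Type w} [Ring H] [HopfAlgebra ℂ H]
  [Ring B] [Algebra ℂ B] [Ring P] [Algebra ℂ P] (X : Bundle H B P I) {k l : I}
  (L : Ideal B) [L.IsTwoSided] (hk : X.J k ≤ L) (hl : X.J l ≤ L)

theorem χRestrict_ι_mul (b : B) (p : P) :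
    X.χRestrict L hl (X.ι b * p) = (Ideal.Quotient.mk L b ⊗ₜ 1) * X.χRestrict L hl p := by
  change Algebra.TensorProduct.map (Ideal.Quotient.factorₐ ℂ hl) (AlgHom.id ℂ H) (X.χ l _) =
    _ * Algebra.TensorProduct.map (Ideal.Quotient.factorₐ ℂ hl) (AlgHom.id ℂ H) (X.χ l p)
  rw [map_mul, map_mul, X.χ_ι, Algebra.TensorProduct.map_tmul, map_one]
  rfl

variable [Finite I]

theorem χRestrict_eq_convAct (p : P) :
    X.χRestrict L hl p =
      convAct (LinearMap.mul ℂ (B ⧸ L)) (X.transition k l L hl) (X.χRestrict L hk p) := by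
  rw [X.χRestrict_congr L hk hl (q := X.sect k (X.χ k p)) (X.χ_sect k _).symm]
  suffices X.χRestrict L hl ∘ₗ X.sect k =
      convAct (LinearMap.mul ℂ (B ⧸ L)) (X.transition k l L hl) ∘ₗ
        (Ideal.Quotient.factorₐ ℂ hk).toLinearMap.rTensor H from
    LinearMap.congr_fun this (X.χ k p)
  refine TensorProduct.ext' fun c h => ?_
  obtain ⟨b, rfl⟩ := Ideal.Quotient.mk_surjective c
  have hb : X.χ k (X.sect k (Ideal.Quotient.mk _ b ⊗ₜ h)) =
      X.χ k (X.ι b * X.sect k (1 ⊗ₜ h)) := by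
    rw [map_mul, X.χ_sect, X.χ_sect, X.χ_ι, Algebra.TensorProduct.tmul_mul_tmul, mul_one, one_mul]
  rw [LinearMap.comp_apply, X.χRestrict_congr L hk hl hb, χRestrict_ι_mul,
    X.χRestrict_sect L hk hl, LinearMap.comp_apply, LinearMap.rTensor_tmul, convAct_tmul,
    LinearMap.rTensor_comp_apply]
  exact tmul_one_mul_eq_rTensor _ _

theorem transition_mul_transition :
    toConv (X.transition k l L hl) * toConv (X.transition l k L hk) = 1 := by
  ext h
  have hχ : X.χRestrict L hk (X.sect k (1 ⊗ₜ h)) = 1 ⊗ₜ h := by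
    rw [χRestrict, LinearMap.comp_apply]
    change (Ideal.Quotient.factorₐ ℂ hk).toLinearMap.rTensor H (X.χ k _) = _
    rw [X.χ_sect, LinearMap.rTensor_tmul, AlgHom.toLinearMap_apply, map_one]
  have hconv := X.χRestrict_eq_convAct L hl hk (X.sect k (1 ⊗ₜ h))
  rw [X.χRestrict_eq_convAct L hk hl, hχ] at hconv
  replace hconv := hconv.trans (LinearMap.congr_fun (convAct_mul_comp_convAct_mul ..) _)
  have hε := congrArg (slice (B ⧸ L) Coalgebra.counit) hconv
  rw [slice_counit_convAct, slice_tmul, LinearMap.mul_apply', one_mul] at hε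
  exact hε.symm.trans (Algebra.algebraMap_eq_smul_one _).symm

end Bundle

namespace DiffStructure

variable {H : Type uH} {B : Type uB} {P : Type uP} {I : Type w} [Ring H] [HopfAlgebra ℂ H]
  [Ring B] [Algebra ℂ B] [Ring P] [Algebra ℂ P] {X : Bundle H B P I}
  (S : DiffStructure.{v, v'} X)

theorem hIncl_tmul_one (i : I) (γ : S.BForm i) : S.hIncl i (γ ⊗ₜ 1) = S.left i γ := by
  refine (horIncl_tmul _ _ γ 1).trans ?_
  rw [map_one]
  rfl

theorem left_d (i : I) (γ : S.BForm i) : S.left i ((S.base i).d γ) = S.dE i (S.left i γ) :=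
  (skewD_tmul_one _ _ γ).symm

theorem left_parity (i : I) (γ : S.BForm i) :
    S.left i ((S.base i).parity γ) = S.parityE i (S.left i γ) := by
  rw [← hIncl_tmul_one, ← hIncl_tmul_one]
  exact (skewParity_horIncl _ _ (γ ⊗ₜ 1)).symm

theorem totalMap_sect (k : I) (h : H) :
    S.totalMap k (X.sect k (1 ⊗ₜ h)) = S.hIncl k (1 ⊗ₜ h) := by
  change S.hIncl k (Algebra.TensorProduct.map (S.base k).emb (AlgHom.id ℂ H) (X.χ k _)) = _
  rw [X.χ_sect, Algebra.TensorProduct.map_tmul, map_one, AlgHom.id_apply]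

variable {S}

section Restriction

variable {k : I} {R : Type*} [Ring R] [Algebra ℂ R] (g : S.E k →ₐ[ℂ] R)

/-- The restriction of a homomorphism on `Γ(B k) ⊗̂ Γ(H)` to the forms on the base. -/
def onBase : S.BForm k →ₐ[ℂ] R := g.comp (S.left k)

/-- The restriction of a homomorphism on `Γ(B k) ⊗̂ Γ(H)` to `H`. -/
def onFibre : H →ₐ[ℂ] R := (g.comp (S.hIncl k)).comp Algebra.TensorProduct.includeRight

theorem onBase_mul_onFibre (γ : S.BForm k) (h : H) :
    onBase g γ * onFibre g h = g (S.hIncl k (γ ⊗ₜ h)) := by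
  change g (S.left k γ) * g (S.hIncl k (1 ⊗ₜ h)) = _
  rw [← hIncl_tmul_one, ← map_mul, ← map_mul, Algebra.TensorProduct.tmul_mul_tmul, mul_one,
    one_mul]

theorem commute_onFibre_onBase (h : H) (γ : S.BForm k) :
    Commute (onFibre g h) (onBase g γ) := by
  refine Eq.trans ?_ (onBase_mul_onFibre g γ h).symm
  change g (S.hIncl k (1 ⊗ₜ h)) * g (S.left k γ) = _
  rw [← hIncl_tmul_one, ← map_mul, ← map_mul, Algebra.TensorProduct.tmul_mul_tmul, mul_one,
    one_mul]

theorem apply_hIncl (y : S.BForm k ⊗[ℂ] H) :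
    g (S.hIncl k y) = LinearMap.mul' ℂ R
      (TensorProduct.map (onBase g).toLinearMap (onFibre g).toLinearMap y) := by
  suffices g.toLinearMap ∘ₗ (S.hIncl k).toLinearMap = LinearMap.mul' ℂ R ∘ₗ
      TensorProduct.map (onBase g).toLinearMap (onFibre g).toLinearMap from
    LinearMap.congr_fun this y
  exact TensorProduct.ext' fun γ h => (onBase_mul_onFibre g γ h).symm

theorem rTensor_cofreeCoaction (y : S.BForm k ⊗[ℂ] H) :
    (g.comp (S.hIncl k)).toLinearMap.rTensor H (cofreeCoaction (S.BForm k) H y) =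
      convAct (LinearMap.mul ℂ R) (onFibre g).toLinearMap
        ((onBase g).toLinearMap.rTensor H y) := by
  suffices (g.comp (S.hIncl k)).toLinearMap.rTensor H ∘ₗ cofreeCoaction (S.BForm k) H =
      convAct (LinearMap.mul ℂ R) (onFibre g).toLinearMap ∘ₗ (onBase g).toLinearMap.rTensor H from
    LinearMap.congr_fun this y
  refine TensorProduct.ext' fun γ h => ?_
  rw [LinearMap.comp_apply, LinearMap.comp_apply, cofreeCoaction_tmul, LinearMap.rTensor_tmul,
    convAct_tmul, ← LinearMap.rTensor_comp_apply]
  congr 2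
  exact LinearMap.ext fun k => (onBase_mul_onFibre g γ k).symm

variable {L : Ideal B} [L.IsTwoSided] (hk : X.J k ≤ L)

theorem apply_hIncl_rTensor_χ {e : B ⧸ L →ₗ[ℂ] R} {T : X.Loc k →ₗ[ℂ] S.BForm k}
    (he : ∀ b, onBase g (T (Ideal.Quotient.mk _ b)) = e (Ideal.Quotient.mk _ b)) (p : P) :
    g (S.hIncl k (T.rTensor H (X.χ k p))) = LinearMap.mul' ℂ R
      (TensorProduct.map e (onFibre g).toLinearMap (X.χRestrict L hk p)) := by
  rw [apply_hIncl, LinearMap.map_rTensor]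
  refine Eq.trans ?_ (congrArg _ (LinearMap.map_rTensor ..)).symm
  congr 3
  refine LinearMap.ext fun c => ?_
  obtain ⟨b, rfl⟩ := Ideal.Quotient.mk_surjective c
  exact he b

end Restriction

end DiffStructure

theorem gauge_iff {W : Type*} [Ring W] {t t' δ δ' u v s a c : W} (htt' : t * t' = 1)
    (ht't : t' * t = 1) (hδ : δ * t' + t * δ' = 0) (hvs : v * s = 1) (hu : u = t * v) :
    a * u = t * c * v - δ * v ↔ a = t * c * t' + t * δ' := by
  rw [hu, ← mul_assoc, ← sub_mul]
  have hcancel : a * t * v = (t * c - δ) * v ↔ a * t = t * c - δ :=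
    ⟨fun h => by simpa [mul_assoc, hvs] using congrArg (· * s) h, congrArg (· * v)⟩
  rw [hcancel, eq_neg_of_add_eq_zero_right hδ, ← sub_eq_add_neg, ← sub_mul]
  exact ⟨fun h => by rw [← h, mul_assoc, htt', mul_one],
    fun h => by rw [h, mul_assoc, ht't, mul_one]⟩

section Convolution

open WithConv

variable {H : Type*} [Ring H] [HopfAlgebra ℂ H] {C R : Type*} [Ring C] [Algebra ℂ C] [Ring R]
  [Algebra ℂ R]

theorem comp_conv_of_leibniz {k : C →ₐ[ℂ] R} {D : C →ₗ[ℂ] R}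
    (hD : ∀ x y, D (x * y) = D x * k y + k x * D y) (f g : H →ₗ[ℂ] C) :
    D ∘ₗ conv f g = conv (D ∘ₗ f) (k.toLinearMap ∘ₗ g) + conv (k.toLinearMap ∘ₗ f) (D ∘ₗ g) := by
  suffices D ∘ₗ LinearMap.mul' ℂ C ∘ₗ TensorProduct.map f g =
      LinearMap.mul' ℂ R ∘ₗ TensorProduct.map (D ∘ₗ f) (k.toLinearMap ∘ₗ g) +
        LinearMap.mul' ℂ R ∘ₗ TensorProduct.map (k.toLinearMap ∘ₗ f) (D ∘ₗ g) from
    LinearMap.ext fun h => LinearMap.congr_fun this (Coalgebra.comul h)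
  exact TensorProduct.ext' fun h l => hD (f h) (g l)

theorem comp_one_of_leibniz {k : C →ₐ[ℂ] R} {D : C →ₗ[ℂ] R}
    (hD : ∀ x y, D (x * y) = D x * k y + k x * D y) :
    D ∘ₗ (1 : WithConv (H →ₗ[ℂ] C)).ofConv = 0 := by
  have hone : D 1 = 0 := by simpa using hD 1 1
  ext h
  simp [Algebra.algebraMap_eq_smul_one, hone]

theorem toConv_comp_mul_toConv_comp (k : C →ₐ[ℂ] R) {f g : H →ₗ[ℂ] C}
    (hfg : toConv f * toConv g = 1) :
    toConv (k.toLinearMap ∘ₗ f) * toConv (k.toLinearMap ∘ₗ g) = 1 := by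
  have h := LinearMap.algHom_comp_convMul_distrib k (toConv f) (toConv g)
  refine (congrArg toConv h).symm.trans ?_
  rw [hfg]
  ext h
  simp

end Convolution

namespace DiffStructure

variable {H : Type uH} {B : Type uB} {P : Type uP} {I : Type w} [Ring H] [HopfAlgebra ℂ H]
  [Ring B] [Algebra ℂ B] [Ring P] [Algebra ℂ P] {X : Bundle H B P I}
  (S : DiffStructure.{v, v'} X)

section Transition

open WithConv

variable (i j : I)

/-- The inclusion of `B ij` into `Q i j`, through `Γ_m(B ij)`. -/
def overlapEmb : X.Loc₂ i j →ₐ[ℂ] S.Q i j :=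
  Ideal.Quotient.liftₐ (X.J i ⊔ X.J j) ((onBase (S.projLeft i j)).comp (S.baseMap i))
    fun _ hb => congrArg Subtype.val (S.mOf_eq_zero i j hb)

/-- The differential of `B ij`, with values in `Q i j`. -/
def overlapD : X.Loc₂ i j →ₗ[ℂ] S.Q i j := (S.Γm i j).val.toLinearMap ∘ₗ S.dM i j

theorem val_comp_embM :
    (S.Γm i j).val.toLinearMap ∘ₗ S.embM i j = (S.overlapEmb i j).toLinearMap := by
  refine LinearMap.ext fun c => ?_
  obtain ⟨b, rfl⟩ := Ideal.Quotient.mk_surjective c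
  rfl

theorem onBase_projRight_emb_mk (b : B) :
    onBase (S.projRight i j) ((S.base j).emb (Ideal.Quotient.mk _ b)) =
      S.overlapEmb i j (Ideal.Quotient.mk _ b) :=
  (S.projRight_classOf i j b).trans (S.projLeft_classOf i j b).symm

theorem onBase_projRight_d_emb_mk (b : B) :
    onBase (S.projRight i j) ((S.base j).d ((S.base j).emb (Ideal.Quotient.mk _ b))) =
      S.overlapD i j (Ideal.Quotient.mk _ b) :=
  (S.projRight_classD i j b).trans (S.projLeft_classD i j b).symm

theorem overlapD_mul (x y : X.Loc₂ i j) :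
    S.overlapD i j (x * y) =
      S.overlapD i j x * S.overlapEmb i j y + S.overlapEmb i j x * S.overlapD i j y := by
  obtain ⟨b, rfl⟩ := Ideal.Quotient.mk_surjective x
  obtain ⟨c, rfl⟩ := Ideal.Quotient.mk_surjective y
  rw [← map_mul, ← onBase_projRight_d_emb_mk, ← onBase_projRight_d_emb_mk,
    ← onBase_projRight_d_emb_mk, ← onBase_projRight_emb_mk, ← onBase_projRight_emb_mk, map_mul,
    map_mul, DiffCalculus.d_mul, DiffCalculus.parity_emb, map_add, map_mul, map_mul]

/-- The transition function `τ_ij`, with values in `Q i j`. -/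
def overlapτ : H →ₗ[ℂ] S.Q i j := (S.overlapEmb i j).toLinearMap ∘ₗ S.τ i j

/-- The transition function `τ_ji`, with values in `Q i j`. -/
def overlapτ' : H →ₗ[ℂ] S.Q i j := (S.overlapEmb i j).toLinearMap ∘ₗ S.τ' i j

/-- The map `h ↦ dτ_ij(h)`, with values in `Q i j`. -/
def overlapDτ : H →ₗ[ℂ] S.Q i j := S.overlapD i j ∘ₗ S.τ i j

/-- The map `h ↦ dτ_ji(h)`, with values in `Q i j`. -/
def overlapDτ' : H →ₗ[ℂ] S.Q i j := S.overlapD i j ∘ₗ S.τ' i j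

theorem gauge_iff_overlap (a : H →ₗ[ℂ] S.BForm i) (a' : H →ₗ[ℂ] S.BForm j) :
    (S.πLeft i j).toLinearMap ∘ₗ a =
        conv (conv (S.embM i j ∘ₗ S.τ i j) ((S.πRight i j).toLinearMap ∘ₗ a'))
          (S.embM i j ∘ₗ S.τ' i j) + conv (S.embM i j ∘ₗ S.τ i j) (S.dM i j ∘ₗ S.τ' i j) ↔
      toConv ((onBase (S.projLeft i j)).toLinearMap ∘ₗ a) =
        toConv (S.overlapτ i j) * toConv ((onBase (S.projRight i j)).toLinearMap ∘ₗ a') *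
          toConv (S.overlapτ' i j) + toConv (S.overlapτ i j) * toConv (S.overlapDτ' i j) := by
  have hval : Function.Injective ((S.Γm i j).val.toLinearMap ∘ₗ · : (H →ₗ[ℂ] S.Γm i j) → _) :=
    fun _ _ h => LinearMap.ext fun k => Subtype.ext (LinearMap.congr_fun h k)
  rw [← hval.eq_iff, ← toConv_injective.eq_iff]
  simp only [LinearMap.comp_add, comp_conv, ← LinearMap.comp_assoc, val_comp_embM]
  rfl

theorem onBase_projLeft_eq_onBase_projRight {γ : ∀ k, S.BForm k} (hγ : γ ∈ S.ΓB) :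
    onBase (S.projLeft i j) (γ i) = onBase (S.projRight i j) (γ j) :=
  (overlapLeft_eq_overlapRight_iff (hs := S.total_surjective)).2
    ⟨⟨_, S.leftPi_mem_ΓP hγ⟩, rfl, rfl⟩

variable [Finite I]

theorem overlapτ_mul_overlapτ' : toConv (S.overlapτ i j) * toConv (S.overlapτ' i j) = 1 :=
  toConv_comp_mul_toConv_comp _ (X.transition_mul_transition ..)

theorem overlapτ'_mul_overlapτ : toConv (S.overlapτ' i j) * toConv (S.overlapτ i j) = 1 :=
  toConv_comp_mul_toConv_comp _ (X.transition_mul_transition ..)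

theorem overlapDτ_mul_add :
    toConv (S.overlapDτ i j) * toConv (S.overlapτ' i j) +
      toConv (S.overlapτ i j) * toConv (S.overlapDτ' i j) = 0 := by
  have h := congrArg (fun f => S.overlapD i j ∘ₗ f.ofConv)
    (X.transition_mul_transition _ le_sup_left le_sup_right :
      toConv (S.τ i j) * toConv (S.τ' i j) = 1)
  rw [comp_one_of_leibniz (S.overlapD_mul i j)] at h
  exact congrArg toConv ((comp_conv_of_leibniz (S.overlapD_mul i j) _ _).symm.trans h)

variable {S i j}

theorem apply_hIncl_rTensor_χ_sect {e : X.Loc₂ i j →ₗ[ℂ] S.Q i j} {T : X.Loc j →ₗ[ℂ] S.BForm j}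
    (he : ∀ b, onBase (S.projRight i j) (T (Ideal.Quotient.mk _ b)) = e (Ideal.Quotient.mk _ b))
    (h : H) :
    S.projRight i j (S.hIncl j (T.rTensor H (X.χ j (X.sect i (1 ⊗ₜ h))))) =
      conv (e ∘ₗ S.τ i j) (onFibre (S.projRight i j)).toLinearMap h := by
  rw [apply_hIncl_rTensor_χ (S.projRight i j) le_sup_right he,
    X.χRestrict_sect _ le_sup_left le_sup_right]
  exact congrArg _ (LinearMap.map_rTensor ..)

variable (S i j)

theorem onFibre_projLeft :
    toConv (onFibre (S.projLeft i j)).toLinearMap =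
      toConv (S.overlapτ i j) * toConv (onFibre (S.projRight i j)).toLinearMap := by
  refine congrArg toConv (LinearMap.ext fun h => ?_)
  change S.projLeft i j (S.hIncl i (1 ⊗ₜ h)) = _
  rw [← totalMap_sect, projLeft_totalMap]
  exact apply_hIncl_rTensor_χ_sect (T := (S.base j).emb.toLinearMap)
    (e := (S.overlapEmb i j).toLinearMap) (S.onBase_projRight_emb_mk i j) h

theorem commute_overlapτ_onBase (h : H) (γ : S.BForm j) :
    Commute (S.overlapτ i j h) (onBase (S.projRight i j) γ) := by
  obtain ⟨x, rfl⟩ := S.base_surjective j γ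
  have hτ : S.overlapτ i j = conv (onFibre (S.projLeft i j)).toLinearMap
      ((onFibre (S.projRight i j)).toLinearMap ∘ₗ HopfAlgebra.antipode ℂ) := by
    refine toConv_injective ((?_ : _ = toConv _ * toConv _).trans (toConv_conv ..).symm)
    rw [onFibre_projLeft, mul_assoc, toConv_mul_toConv_comp_antipode, mul_one]
  rw [hτ]
  refine commute_conv (fun h => ?_) (fun h => ?_) h
  · exact S.onBase_projLeft_eq_onBase_projRight i j x.2 ▸
      commute_onFibre_onBase (S.projLeft i j) h (x.1 i)
  · exact commute_onFibre_onBase (S.projRight i j) _ _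

end Transition

section LocalDer

/-- The map `γ ⊗ h ↦ dγ ⊗ h - ∑ m(γ, a(h₁)) ⊗ h₂` of `Γ(B i) ⊗ H`, the common form of
`localLeft a` and `localRight a`. -/
def localDer {i : I} (m : S.BForm i →ₗ[ℂ] S.BForm i →ₗ[ℂ] S.BForm i) (a : H →ₗ[ℂ] S.BForm i) :
    S.BForm i ⊗[ℂ] H →ₗ[ℂ] S.BForm i ⊗[ℂ] H :=
  (S.base i).d.rTensor H - convAct m a

/-- The product `(γ, α) ↦ (-1)ⁿ γ α`, for `γ` of degree `n`, by which a one-form `α` enters left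
covariant derivatives. -/
def leftMul (i : I) : S.BForm i →ₗ[ℂ] S.BForm i →ₗ[ℂ] S.BForm i :=
  LinearMap.mul ℂ (S.BForm i) ∘ₗ (S.base i).parity

/-- The product `(γ, α) ↦ α γ`, by which a one-form `α` enters right covariant derivatives. -/
def rightMul (i : I) : S.BForm i →ₗ[ℂ] S.BForm i →ₗ[ℂ] S.BForm i :=
  (LinearMap.mul ℂ (S.BForm i)).flip

variable {i j : I}

theorem localLeft_eq_localDer (a : H →ₗ[ℂ] S.BForm i) :
    S.localLeft a = S.localDer (S.leftMul i) a := by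
  refine congrArg ((S.base i).d.rTensor H - ·) (TensorProduct.ext' fun γ h => ?_)
  refine Eq.trans ?_ (convAct_tmul ..).symm
  rw [LinearMap.rTensor_comp_apply]
  change (LinearMap.mul' ℂ (S.BForm i)).rTensor H ((TensorProduct.assoc ℂ (S.BForm i) (S.BForm i)
    H).symm ((S.base i).parity γ ⊗ₜ a.rTensor H (Coalgebra.comul h))) = _
  induction a.rTensor H (Coalgebra.comul h) using TensorProduct.induction_on with
  | zero => simp only [TensorProduct.tmul_zero, map_zero]
  | tmul α l => rfl
  | add s t hs ht => simp only [TensorProduct.tmul_add, map_add, hs, ht]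

theorem localRight_eq_localDer (a : H →ₗ[ℂ] S.BForm i) :
    S.localRight a = S.localDer (S.rightMul i) a :=
  congrArg ((S.base i).d.rTensor H - LinearMap.rTensor H · ∘ₗ
    (TensorProduct.assoc ℂ (S.BForm i) (S.BForm i) H).symm.toLinearMap ∘ₗ
      (a.rTensor H ∘ₗ Coalgebra.comul).lTensor (S.BForm i)) (TensorProduct.ext' fun _ _ => rfl)

theorem cofreeCoaction_localDer (m : S.BForm i →ₗ[ℂ] S.BForm i →ₗ[ℂ] S.BForm i)
    (a : H →ₗ[ℂ] S.BForm i) (y : S.BForm i ⊗[ℂ] H) :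
    cofreeCoaction (S.BForm i) H (S.localDer m a y) =
      (S.localDer m a).rTensor H (cofreeCoaction (S.BForm i) H y) := by
  rw [localDer, LinearMap.sub_apply, map_sub, cofreeCoaction_rTensor, cofreeCoaction_convAct,
    LinearMap.rTensor_sub, LinearMap.sub_apply]

/-- The properties of the products `leftMul` and `rightMul` for which the maps `localDer` glue. -/
structure IsConnectionProduct
    (m : ∀ i, S.BForm i →ₗ[ℂ] S.BForm i →ₗ[ℂ] S.BForm i) : Prop where
  one_apply : ∀ i α, m i 1 α = α
  mem_gr : ∀ {i n γ α}, γ ∈ (S.base i).gr n → α ∈ (S.base i).gr 1 → m i γ α ∈ (S.base i).gr (n + 1)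
  onBase_eq_zero : ∀ {i j γ}, onBase (S.projRight i j) γ = 0 →
    ∀ α, onBase (S.projRight i j) (m j γ α) = 0
  exists_overlap : ∀ i j, ∃ m' : X.Loc₂ i j →ₗ[ℂ] S.Q i j →ₗ[ℂ] S.Q i j,
    (∀ b α, onBase (S.projRight i j) (m j (S.baseMap j b) α) =
      m' (Ideal.Quotient.mk _ b) (onBase (S.projRight i j) α)) ∧
    ∀ h α, m' (S.τ i j h) (onBase (S.projRight i j) α) =
      S.overlapτ i j h * onBase (S.projRight i j) α

theorem isConnectionProduct_leftMul : S.IsConnectionProduct S.leftMul where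
  one_apply i α := by
    change (S.base i).parity 1 * α = α
    rw [DiffCalculus.parity_one, one_mul]
  mem_gr hγ hα := SetLike.mul_mem_graded (DiffCalculus.parity_mem _ hγ) hα
  onBase_eq_zero {i j γ} hγ α := by
    change onBase (S.projRight i j) ((S.base j).parity γ * α) = 0
    have h0 : S.projLeft i j 0 = S.projRight i j (S.left j γ) := (map_zero _).trans hγ.symm
    have h := projLeft_parityE h0
    rw [map_zero, map_zero, ← left_parity] at h
    rw [map_mul]
    exact (congrArg (· * _) h.symm).trans (zero_mul _)
  exists_overlap i j := by
    refine ⟨LinearMap.mul ℂ (S.Q i j) ∘ₗ (S.overlapEmb i j).toLinearMap, fun b α => ?_,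
      fun _ _ => rfl⟩
    change onBase (S.projRight i j) ((S.base j).parity ((S.base j).emb _) * α) = _
    rw [DiffCalculus.parity_emb, map_mul]
    exact congrArg (· * _) (S.onBase_projRight_emb_mk i j b)

variable [Finite I]

theorem isConnectionProduct_rightMul : S.IsConnectionProduct S.rightMul where
  one_apply i α := mul_one α
  mem_gr hγ hα := add_comm 1 _ ▸ SetLike.mul_mem_graded hα hγ
  onBase_eq_zero {i j γ} hγ α := (map_mul _ α γ).trans (by rw [hγ, mul_zero])
  exists_overlap i j := by
    refine ⟨(LinearMap.mul ℂ (S.Q i j)).flip ∘ₗ (S.overlapEmb i j).toLinearMap, fun b α => ?_,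
      fun h α => (S.commute_overlapτ_onBase i j h α).symm⟩
    refine (map_mul (onBase (S.projRight i j)) α (S.baseMap j b)).trans ?_
    exact congrArg (_ * ·) (S.onBase_projRight_emb_mk i j b)

end LocalDer

section Leibniz

variable {i j : I}

theorem localDer_leftMul_mul (a : H →ₗ[ℂ] S.BForm i) (γ : S.BForm i) (y : S.BForm i ⊗[ℂ] H) :
    S.localDer (S.leftMul i) a ((γ ⊗ₜ 1) * y) =
      ((S.base i).d γ ⊗ₜ 1) * y + ((S.base i).parity γ ⊗ₜ 1) * S.localDer (S.leftMul i) a y := by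
  simp only [tmul_one_mul_eq_rTensor]
  suffices S.localDer (S.leftMul i) a ∘ₗ (LinearMap.mulLeft ℂ γ).rTensor H =
      (LinearMap.mulLeft ℂ ((S.base i).d γ)).rTensor H +
        (LinearMap.mulLeft ℂ ((S.base i).parity γ)).rTensor H ∘ₗ S.localDer (S.leftMul i) a from
    LinearMap.congr_fun this y
  refine TensorProduct.ext' fun α h => ?_
  have hmul : S.leftMul i (γ * α) ∘ₗ a =
      LinearMap.mulLeft ℂ ((S.base i).parity γ) ∘ₗ S.leftMul i α ∘ₗ a := by
    refine LinearMap.ext fun k => ?_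
    change (S.base i).parity (γ * α) * a k = (S.base i).parity γ * ((S.base i).parity α * a k)
    rw [DiffCalculus.parity_mul, mul_assoc]
  simp only [localDer, LinearMap.comp_apply, LinearMap.add_apply, LinearMap.sub_apply,
    LinearMap.rTensor_tmul, LinearMap.mulLeft_apply, convAct_tmul, map_sub, hmul,
    DiffCalculus.d_mul, TensorProduct.add_tmul, ← LinearMap.rTensor_comp_apply]
  abel

theorem localDer_rightMul_mul (a : H →ₗ[ℂ] S.BForm i) (y : S.BForm i ⊗[ℂ] H) (γ : S.BForm i) :
    S.localDer (S.rightMul i) a (y * (γ ⊗ₜ 1)) =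
      S.localDer (S.rightMul i) a y * (γ ⊗ₜ 1) +
        (S.base i).parity.rTensor H y * ((S.base i).d γ ⊗ₜ 1) := by
  simp only [mul_tmul_one_eq_rTensor]
  suffices S.localDer (S.rightMul i) a ∘ₗ (LinearMap.mulRight ℂ γ).rTensor H =
      (LinearMap.mulRight ℂ γ).rTensor H ∘ₗ S.localDer (S.rightMul i) a +
        (LinearMap.mulRight ℂ ((S.base i).d γ)).rTensor H ∘ₗ (S.base i).parity.rTensor H from
    LinearMap.congr_fun this y
  refine TensorProduct.ext' fun α h => ?_
  have hmul : S.rightMul i (α * γ) ∘ₗ a = LinearMap.mulRight ℂ γ ∘ₗ S.rightMul i α ∘ₗ a :=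
    LinearMap.ext fun k => (mul_assoc (a k) α γ).symm
  simp only [localDer, LinearMap.comp_apply, LinearMap.add_apply, LinearMap.sub_apply,
    LinearMap.rTensor_tmul, LinearMap.mulRight_apply, convAct_tmul, map_sub, hmul,
    DiffCalculus.d_mul, TensorProduct.add_tmul, ← LinearMap.rTensor_comp_apply]
  abel

theorem rTensor_onBase_eq_zero {y : S.BForm j ⊗[ℂ] H}
    (hy : S.projRight i j (S.hIncl j y) = 0) :
    (onBase (S.projRight i j)).toLinearMap.rTensor H y = 0 := by
  have h := projLeft_coE (i := i) (x := 0) ((map_zero _).trans hy.symm)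
  rw [map_zero, map_zero, coE_hIncl, ← LinearMap.rTensor_comp_apply] at h
  refine convAct_mul_injective
    (toConv_mul_toConv_comp_antipode (onFibre (S.projRight i j))) (Eq.trans ?_ (map_zero _).symm)
  exact (rTensor_cofreeCoaction (S.projRight i j) y).symm.trans h.symm

variable {S} {m : ∀ i, S.BForm i →ₗ[ℂ] S.BForm i →ₗ[ℂ] S.BForm i}

namespace IsConnectionProduct

variable (hm : S.IsConnectionProduct m)

include hm

theorem localDer_one_tmul (a : H →ₗ[ℂ] S.BForm i) (h : H) :
    S.localDer (m i) a (1 ⊗ₜ h) = -a.rTensor H (Coalgebra.comul h) := by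
  have hone : m i 1 = LinearMap.id := LinearMap.ext (hm.one_apply i)
  rw [localDer, LinearMap.sub_apply, LinearMap.rTensor_tmul, DiffCalculus.d_one,
    TensorProduct.zero_tmul, zero_sub, convAct_tmul, hone, LinearMap.id_comp]

theorem localDer_mem_tensorDegree {a : H →ₗ[ℂ] S.BForm i} (ha : ∀ h, a h ∈ (S.base i).gr 1)
    {n : ℕ} {y : S.BForm i ⊗[ℂ] H} (hy : y ∈ tensorDegree (S.base i).gr H n) :
    S.localDer (m i) a y ∈ tensorDegree (S.base i).gr H (n + 1) := by
  suffices tensorDegree (S.base i).gr H n ≤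
      (tensorDegree (S.base i).gr H (n + 1)).comap (S.localDer (m i) a) from this hy
  refine tensorDegree_le.2 fun γ hγ h => ?_
  change S.localDer (m i) a (γ ⊗ₜ h) ∈ tensorDegree (S.base i).gr H (n + 1)
  rw [localDer, LinearMap.sub_apply, LinearMap.rTensor_tmul, convAct_tmul]
  exact sub_mem (tmul_mem_tensorDegree ((S.base i).d_mem hγ) h)
    (rTensor_mem_tensorDegree (g := m i γ ∘ₗ a) (fun k => hm.mem_gr hγ (ha k)) _)

theorem projRight_localDer_eq_zero (a : H →ₗ[ℂ] S.BForm j) {y : S.BForm j ⊗[ℂ] H}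
    (hy : S.projRight i j (S.hIncl j y) = 0) :
    S.projRight i j (S.hIncl j (S.localDer (m j) a y)) = 0 := by
  let K := LinearMap.ker (onBase (S.projRight i j)).toLinearMap
  obtain ⟨z, rfl⟩ := (Module.Flat.rTensor_exact H (LinearMap.exact_subtype_ker_map _) y).1
    (S.rTensor_onBase_eq_zero hy)
  suffices (S.projRight i j).toLinearMap ∘ₗ (S.hIncl j).toLinearMap ∘ₗ S.localDer (m j) a ∘ₗ
      K.subtype.rTensor H = 0 from LinearMap.congr_fun this z
  refine TensorProduct.ext' fun γ h => ?_
  have hγ : S.projLeft i j 0 = S.projRight i j (S.left j γ) := (map_zero _).trans γ.2.symm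
  have hd : onBase (S.projRight i j) ((S.base j).d γ) = 0 := by
    refine (congrArg (S.projRight i j) (S.left_d j γ)).trans ((projLeft_dE hγ).symm.trans ?_)
    rw [map_zero, map_zero]
  change S.projRight i j (S.hIncl j ((S.base j).d γ ⊗ₜ h - convAct (m j) a (γ.1 ⊗ₜ h))) = 0
  rw [map_sub, map_sub, ← onBase_mul_onFibre, hd, zero_mul, zero_sub, neg_eq_zero, convAct_tmul,
    apply_hIncl, LinearMap.map_rTensor, ← LinearMap.comp_assoc]
  have hγa : (onBase (S.projRight i j)).toLinearMap ∘ₗ m j γ = 0 :=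
    LinearMap.ext (hm.onBase_eq_zero γ.2)
  rw [hγa, LinearMap.zero_comp, TensorProduct.map_zero_left, LinearMap.zero_apply, map_zero]

end IsConnectionProduct

end Leibniz

section Agree

open WithConv

variable {i j : I}

/-- The elements `x` of `Γ(B i) ⊗ H` and `y` of `Γ(B j) ⊗ H` have the same restriction to the
overlap, that is, the same image in `Q i j`. -/
def Agree (x : S.BForm i ⊗[ℂ] H) (y : S.BForm j ⊗[ℂ] H) : Prop :=
  S.projLeft i j (S.hIncl i x) = S.projRight i j (S.hIncl j y)

variable (i j) in
/-- The section `1 ⊗ h` of the `i`-th trivialization, expressed in the `j`-th one: it is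
`∑ τ_ij(h₁) ⊗ h₂` up to forms which vanish on the overlap. -/
def overlapSect (h : H) : S.BForm j ⊗[ℂ] H :=
  (S.base j).emb.toLinearMap.rTensor H (X.χ j (X.sect i (1 ⊗ₜ h)))

variable {S}

theorem Agree.mul {x x' : S.BForm i ⊗[ℂ] H} {y y' : S.BForm j ⊗[ℂ] H} (h : S.Agree x y)
    (h' : S.Agree x' y') : S.Agree (x * x') (y * y') := by
  unfold Agree at *
  rw [map_mul, map_mul, map_mul, map_mul, h, h']

theorem Agree.add {x x' : S.BForm i ⊗[ℂ] H} {y y' : S.BForm j ⊗[ℂ] H} (h : S.Agree x y)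
    (h' : S.Agree x' y') : S.Agree (x + x') (y + y') := by
  unfold Agree at *
  rw [map_add, map_add, map_add, map_add, h, h']

theorem Agree.parity {x : S.BForm i ⊗[ℂ] H} {y : S.BForm j ⊗[ℂ] H} (h : S.Agree x y) :
    S.Agree ((S.base i).parity.rTensor H x) ((S.base j).parity.rTensor H y) := by
  refine (congrArg _ (skewParity_horIncl _ _ x).symm).trans ?_
  exact (projLeft_parityE h).trans (congrArg _ (skewParity_horIncl _ _ y))

theorem Agree.d {γ : S.BForm i} {γ' : S.BForm j} (h : S.Agree (γ ⊗ₜ 1) (γ' ⊗ₜ 1)) :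
    S.Agree ((S.base i).d γ ⊗ₜ 1) ((S.base j).d γ' ⊗ₜ 1) := by
  unfold Agree at *
  simp only [hIncl_tmul_one, left_d] at *
  exact projLeft_dE h

variable (S)

theorem exists_agree_tmul_one (i j : I) (γ : S.BForm i) :
    ∃ γ' : S.BForm j, S.Agree (γ ⊗ₜ 1) (γ' ⊗ₜ 1) := by
  obtain ⟨x, rfl⟩ := S.base_surjective i γ
  refine ⟨x.1 j, ?_⟩
  unfold Agree
  rw [hIncl_tmul_one, hIncl_tmul_one]
  exact S.onBase_projLeft_eq_onBase_projRight i j x.2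

theorem agree_overlapSect (i j : I) (h : H) :
    S.Agree (1 ⊗ₜ h : S.BForm i ⊗[ℂ] H) (S.overlapSect i j h) :=
  (congrArg _ (S.totalMap_sect i h).symm).trans (S.projLeft_totalMap i j _)

variable {S} {m : ∀ i, S.BForm i →ₗ[ℂ] S.BForm i →ₗ[ℂ] S.BForm i}

/-- Since `D'` preserves the forms which vanish on the overlap, one choice of `y` for each generator
suffices. -/
theorem agree_of_forall_tmul {D : S.BForm i ⊗[ℂ] H →ₗ[ℂ] S.BForm i ⊗[ℂ] H}
    {D' : S.BForm j ⊗[ℂ] H →ₗ[ℂ] S.BForm j ⊗[ℂ] H}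
    (hker : ∀ y, S.projRight i j (S.hIncl j y) = 0 → S.projRight i j (S.hIncl j (D' y)) = 0)
    (htmul : ∀ γ h, ∃ y, S.Agree (γ ⊗ₜ h) y ∧ S.Agree (D (γ ⊗ₜ h)) (D' y))
    {x : S.BForm i ⊗[ℂ] H} {y : S.BForm j ⊗[ℂ] H} (hxy : S.Agree x y) : S.Agree (D x) (D' y) := by
  have hexists : ∃ z, S.Agree x z ∧ S.Agree (D x) (D' z) := by
    clear hxy
    induction x using TensorProduct.induction_on with
    | zero => exact ⟨0, by simp [Agree], by simp [Agree]⟩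
    | tmul γ h => exact htmul γ h
    | add x x' hx hx' =>
      obtain ⟨z, hz, hDz⟩ := hx
      obtain ⟨z', hz', hDz'⟩ := hx'
      exact ⟨z + z', hz.add hz', by simpa only [map_add] using hDz.add hDz'⟩
  obtain ⟨z, hz, hDz⟩ := hexists
  refine hDz.trans (sub_eq_zero.1 ?_)
  rw [← map_sub, ← map_sub, ← map_sub]
  exact hker _ (by rw [map_sub, map_sub, ← hz, ← hxy, sub_self])

theorem agree_localDer_leftMul {a : H →ₗ[ℂ] S.BForm i} {a' : H →ₗ[ℂ] S.BForm j}
    (hsect : ∀ h, S.Agree (S.localDer (S.leftMul i) a (1 ⊗ₜ h))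
      (S.localDer (S.leftMul j) a' (S.overlapSect i j h)))
    {x : S.BForm i ⊗[ℂ] H} {y : S.BForm j ⊗[ℂ] H} (hxy : S.Agree x y) :
    S.Agree (S.localDer (S.leftMul i) a x) (S.localDer (S.leftMul j) a' y) := by
  refine agree_of_forall_tmul
    (fun _ => S.isConnectionProduct_leftMul.projRight_localDer_eq_zero a') (fun γ h => ?_) hxy
  obtain ⟨γ', hγ⟩ := S.exists_agree_tmul_one i j γ
  have hmul : γ ⊗ₜ[ℂ] h = (γ ⊗ₜ 1) * (1 ⊗ₜ h) := by
    rw [Algebra.TensorProduct.tmul_mul_tmul, mul_one, one_mul]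
  refine ⟨(γ' ⊗ₜ 1) * S.overlapSect i j h, hmul ▸ hγ.mul (S.agree_overlapSect i j h), ?_⟩
  rw [hmul, localDer_leftMul_mul, localDer_leftMul_mul]
  exact (hγ.d.mul (S.agree_overlapSect i j h)).add (hγ.parity.mul (hsect h))

variable [Finite I]

namespace IsConnectionProduct

variable (hm : S.IsConnectionProduct m)

include hm

theorem projRight_convAct_overlapSect (i j : I) (a : H →ₗ[ℂ] S.BForm j) (h : H) :
    S.projRight i j (S.hIncl j (convAct (m j) a (S.overlapSect i j h))) =
      conv (conv (S.overlapτ i j) ((onBase (S.projRight i j)).toLinearMap ∘ₗ a))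
        (onFibre (S.projRight i j)).toLinearMap h := by
  obtain ⟨m', hm', hmτ⟩ := hm.exists_overlap i j
  let q : X.Loc j →ₗ[ℂ] X.Loc₂ i j := (Ideal.Quotient.factorₐ ℂ le_sup_right).toLinearMap
  let r : S.BForm j →ₗ[ℂ] S.Q i j := (onBase (S.projRight i j)).toLinearMap
  have hq : q.rTensor H (X.χ j (X.sect i (1 ⊗ₜ h))) = (S.τ i j).rTensor H (Coalgebra.comul h) :=
    X.χRestrict_sect _ le_sup_left le_sup_right h
  have hr (c : X.Loc j) (α : S.BForm j) :
      r (m j ((S.base j).emb.toLinearMap c) α) = m' (q c) (r α) := by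
    obtain ⟨b, rfl⟩ := Ideal.Quotient.mk_surjective c
    exact hm' b α
  have hconv : TensorProduct.lift m' ∘ₗ TensorProduct.map (S.τ i j) (r ∘ₗ a) =
      LinearMap.mul' ℂ (S.Q i j) ∘ₗ TensorProduct.map (S.overlapτ i j) (r ∘ₗ a) :=
    TensorProduct.ext' fun k l => hmτ k (a l)
  have hbase : r.rTensor H (convAct (m j) a (S.overlapSect i j h)) =
      (conv (S.overlapτ i j) (r ∘ₗ a)).rTensor H (Coalgebra.comul h) := by
    refine (rTensor_convAct_rTensor hr a _).trans ?_
    rw [hq, convAct_rTensor_comul, ← LinearMap.comp_assoc, hconv]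
    rfl
  have hmap := congrArg (fun t => LinearMap.mul' ℂ (S.Q i j)
    (TensorProduct.map LinearMap.id (onFibre (S.projRight i j)).toLinearMap t)) hbase
  simp only [LinearMap.map_rTensor, LinearMap.id_comp] at hmap
  exact (apply_hIncl _ _).trans hmap

theorem agree_localDer_one_tmul_iff (a : H →ₗ[ℂ] S.BForm i) (a' : H →ₗ[ℂ] S.BForm j) :
    (∀ h, S.Agree (S.localDer (m i) a (1 ⊗ₜ h)) (S.localDer (m j) a' (S.overlapSect i j h))) ↔
      (S.πLeft i j).toLinearMap ∘ₗ a =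
        conv (conv (S.embM i j ∘ₗ S.τ i j) ((S.πRight i j).toLinearMap ∘ₗ a'))
          (S.embM i j ∘ₗ S.τ' i j) + conv (S.embM i j ∘ₗ S.τ i j) (S.dM i j ∘ₗ S.τ' i j) := by
  have hleft (h : H) : S.projLeft i j (S.hIncl i (S.localDer (m i) a (1 ⊗ₜ h))) =
      -conv ((onBase (S.projLeft i j)).toLinearMap ∘ₗ a)
        (onFibre (S.projLeft i j)).toLinearMap h := by
    rw [hm.localDer_one_tmul, map_neg, map_neg, apply_hIncl, LinearMap.map_rTensor]
    rfl
  have hright (h : H) :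
      S.projRight i j (S.hIncl j (S.localDer (m j) a' (S.overlapSect i j h))) =
        conv (S.overlapDτ i j) (onFibre (S.projRight i j)).toLinearMap h -
          conv (conv (S.overlapτ i j) ((onBase (S.projRight i j)).toLinearMap ∘ₗ a'))
            (onFibre (S.projRight i j)).toLinearMap h := by
    rw [localDer, LinearMap.sub_apply, map_sub, map_sub, hm.projRight_convAct_overlapSect,
      overlapSect, ← LinearMap.rTensor_comp_apply]
    congr 1
    exact apply_hIncl_rTensor_χ_sect (T := (S.base j).d ∘ₗ (S.base j).emb.toLinearMap)
      (e := S.overlapD i j) (S.onBase_projRight_d_emb_mk i j) h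
  rw [gauge_iff_overlap, ← gauge_iff (S.overlapτ_mul_overlapτ' i j) (S.overlapτ'_mul_overlapτ i j)
    (S.overlapDτ_mul_add i j) (toConv_mul_toConv_comp_antipode (onFibre (S.projRight i j)))
    (S.onFibre_projLeft i j), ← ofConv_injective.eq_iff]
  refine Iff.trans (forall_congr' fun h => ?_) LinearMap.ext_iff.symm
  rw [Agree, hleft, hright, neg_eq_iff_eq_neg, neg_sub]
  rfl

end IsConnectionProduct

theorem agree_localDer_rightMul {a : H →ₗ[ℂ] S.BForm i} {a' : H →ₗ[ℂ] S.BForm j}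
    (hsect : ∀ h, S.Agree (S.localDer (S.rightMul i) a (1 ⊗ₜ h))
      (S.localDer (S.rightMul j) a' (S.overlapSect i j h)))
    {x : S.BForm i ⊗[ℂ] H} {y : S.BForm j ⊗[ℂ] H} (hxy : S.Agree x y) :
    S.Agree (S.localDer (S.rightMul i) a x) (S.localDer (S.rightMul j) a' y) := by
  refine agree_of_forall_tmul
    (fun _ => S.isConnectionProduct_rightMul.projRight_localDer_eq_zero a') (fun γ h => ?_) hxy
  obtain ⟨γ', hγ⟩ := S.exists_agree_tmul_one i j γ
  have hmul : γ ⊗ₜ[ℂ] h = (1 ⊗ₜ h) * (γ ⊗ₜ 1) := by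
    rw [Algebra.TensorProduct.tmul_mul_tmul, mul_one, one_mul]
  refine ⟨S.overlapSect i j h * (γ' ⊗ₜ 1), hmul ▸ (S.agree_overlapSect i j h).mul hγ, ?_⟩
  rw [hmul, localDer_rightMul_mul, localDer_rightMul_mul]
  exact ((hsect h).mul hγ).add ((S.agree_overlapSect i j h).parity.mul hγ.d)

end Agree

section Components

theorem hIncl_injective (i : I) : Function.Injective (S.hIncl i) :=
  Function.LeftInverse.injective (horRetract_horIncl (S.base i) S.fibre.toDiffCalculus)

/-- The `i`-th component of a horizontal form, as an element of `Γ(B i) ⊗ H`. -/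
def comp (i : I) : S.hor →ₗ[ℂ] S.BForm i ⊗[ℂ] H :=
  horRetract (S.base i) S.fibre.toDiffCalculus ∘ₗ S.horProj i

theorem hIncl_comp (i : I) (α : S.hor) : S.hIncl i (S.comp i α) = S.horProj i α := by
  obtain ⟨x, hx⟩ : ∃ x, S.hIncl i x = S.horProj i α := (S.mem_hor.1 α.2).2 i
  have hcomp : S.comp i α = x := by
    rw [comp, LinearMap.comp_apply, ← hx]
    exact horRetract_horIncl (S.base i) S.fibre.toDiffCalculus x
  rw [hcomp, hx]

variable {S} in
theorem comp_eq_iff {i : I} {α : S.hor} {x : S.BForm i ⊗[ℂ] H} :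
    S.comp i α = x ↔ S.horProj i α = S.hIncl i x := by
  rw [← hIncl_comp, (S.hIncl_injective i).eq_iff]

theorem comp_eq_zero_iff {i : I} {α : S.hor} : S.comp i α = 0 ↔ S.horProj i α = 0 := by
  rw [comp_eq_iff, map_zero]

variable {S} in
theorem hor_ext {α β : S.hor} (h : ∀ i, S.comp i α = S.comp i β) : α = β :=
  Subtype.ext (funext fun i => (comp_eq_iff.1 (h i)).trans (S.hIncl_comp i β))

theorem comp_mul (i : I) (α β : S.hor) : S.comp i (α * β) = S.comp i α * S.comp i β := by
  rw [comp_eq_iff, map_mul (S.hIncl i), hIncl_comp, hIncl_comp]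
  rfl

theorem comp_one (i : I) : S.comp i 1 = 1 := by
  rw [comp_eq_iff, map_one (S.hIncl i)]
  rfl

theorem comp_ιc (i : I) (γ : S.ΓcB) : S.comp i (S.ιc γ) = γ.1 i ⊗ₜ 1 := by
  rw [comp_eq_iff, hIncl_tmul_one]
  rfl

theorem agree_comp (i j : I) (α : S.hor) : S.Agree (S.comp i α) (S.comp j α) := by
  rw [Agree, hIncl_comp, hIncl_comp]
  exact (mem_completion_iff S.total_surjective).1 (S.mem_hor.1 α.2).1 i j

theorem exists_of_comp {x : ∀ i, S.BForm i ⊗[ℂ] H} (hx : ∀ i j, S.Agree (x i) (x j)) :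
    ∃ α : S.hor, ∀ i, S.comp i α = x i := by
  refine ⟨⟨fun i => S.hIncl i (x i), S.mem_hor.2 ⟨?_, fun i => ⟨x i, rfl⟩⟩⟩, fun i => ?_⟩
  · exact (mem_completion_iff S.total_surjective).2 hx
  · exact comp_eq_iff.2 rfl

theorem horDegree_iff {n : ℕ} {α : S.hor} :
    S.HorDegree n α ↔ ∀ i, S.comp i α ∈ tensorDegree (S.base i).gr H n := by
  refine forall_congr' fun i => ⟨fun h => horRetract_mem_tensorDegree _ _ h, fun h => ?_⟩
  rw [← hIncl_comp]
  exact horIncl_mem_skewDegree _ _ h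

theorem ΓB_le_ΓcB : S.ΓB ≤ S.ΓcB := fun y hy =>
  (mem_completion_iff_exists S.base_surjective).2 fun _ _ => ⟨⟨y, hy⟩, rfl, rfl⟩

theorem exists_homogeneous_lift (i : I) {n : ℕ} {γ : S.BForm i} (hγ : γ ∈ (S.base i).gr n) :
    ∃ γ' : S.ΓcB, S.BaseDegree n γ' ∧ γ'.1 i = γ := by
  let F (n : ℕ) : Submodule ℂ (S.BForm i) :=
    { carrier := {γ | ∃ γ' : S.ΓcB, S.BaseDegree n γ' ∧ γ'.1 i = γ}
      add_mem' := by
        rintro _ _ ⟨x, hx, rfl⟩ ⟨y, hy, rfl⟩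
        exact ⟨x + y, fun k => add_mem (hx k) (hy k), rfl⟩
      zero_mem' := ⟨0, fun k => zero_mem _, rfl⟩
      smul_mem' := by
        rintro c _ ⟨x, hx, rfl⟩
        exact ⟨c • x, fun k => Submodule.smul_mem _ c (hx k), rfl⟩ }
  have : SetLike.GradedMonoid F :=
    { one_mem := ⟨1, fun k => SetLike.one_mem_graded _, rfl⟩
      mul_mem := by
        rintro _ _ _ _ ⟨x, hx, rfl⟩ ⟨y, hy, rfl⟩
        exact ⟨x * y, fun k => SetLike.mul_mem_graded (hx k) (hy k), rfl⟩ }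
  refine graded_le_of_adjoin_eq_top (S.base i).gr F (S.baseMap_generated i) ?_ n hγ
  rintro _ (⟨b, rfl⟩ | ⟨b, rfl⟩)
  · have hb (k : I) : S.baseMap k b ∈ (S.base k).gr 0 := (S.base k).emb_mem _
    exact ⟨0, hb i, ⟨⟨_, S.ΓB_le_ΓcB (adaptedOf S.baseMap S.dB b).2⟩, hb, rfl⟩⟩
  · have hb (k : I) : S.dB k (S.baseMap k b) ∈ (S.base k).gr 1 :=
      (S.base k).d_mem ((S.base k).emb_mem _)
    exact ⟨1, hb i, ⟨⟨_, S.ΓB_le_ΓcB (adaptedD S.baseMap S.dB b).2⟩, hb, rfl⟩⟩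

theorem overlapSect_self (i : I) (h : H) : S.overlapSect i i h = 1 ⊗ₜ h := by
  rw [overlapSect, X.χ_sect, LinearMap.rTensor_tmul]
  exact congrArg (· ⊗ₜ h) (map_one (S.base i).emb)

theorem exists_comp_eq_overlapSect (i : I) (h : H) :
    ∃ α : S.hor, S.HorDegree 0 α ∧ ∀ j, S.comp j α = S.overlapSect i j h := by
  obtain ⟨α, hα⟩ := S.exists_of_comp (x := fun j => S.overlapSect i j h) fun j k =>
    S.projLeft_totalMap j k (X.sect i (1 ⊗ₜ h))
  refine ⟨α, S.horDegree_iff.2 fun k => ?_, hα⟩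
  rw [hα]
  exact rTensor_mem_tensorDegree (S.base k).emb_mem _

theorem exists_homogeneous_comp_eq (i : I) {n : ℕ} {y : S.BForm i ⊗[ℂ] H}
    (hy : y ∈ tensorDegree (S.base i).gr H n) : ∃ α : S.hor, S.HorDegree n α ∧ S.comp i α = y := by
  let N : Submodule ℂ S.hor := ⨅ k, (tensorDegree (S.base k).gr H n).comap (S.comp k)
  have hN {α : S.hor} : α ∈ N ↔ S.HorDegree n α :=
    (Submodule.mem_iInf _).trans S.horDegree_iff.symm
  suffices tensorDegree (S.base i).gr H n ≤ N.map (S.comp i) by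
    obtain ⟨α, hα, hαy⟩ := this hy
    exact ⟨α, hN.1 hα, hαy⟩
  refine tensorDegree_le.2 fun γ hγ h => ?_
  obtain ⟨γ', hγ', hγi⟩ := S.exists_homogeneous_lift i hγ
  obtain ⟨α, hα0, hα⟩ := S.exists_comp_eq_overlapSect i h
  refine ⟨S.ιc γ' * α, hN.2 (S.horDegree_iff.2 fun k => ?_), ?_⟩
  · rw [comp_mul, comp_ιc, ← add_zero n]
    exact SetLike.mul_mem_graded (tmul_mem_tensorDegree (hγ' k) 1) (S.horDegree_iff.1 hα0 k)
  · rw [comp_mul, comp_ιc, hγi, hα, overlapSect_self, Algebra.TensorProduct.tmul_mul_tmul,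
      one_mul, mul_one]

theorem comp_surjective (i : I) : Function.Surjective (S.comp i) := by
  intro x
  induction x using TensorProduct.induction_on with
  | zero => exact ⟨0, map_zero _⟩
  | tmul γ h =>
    induction γ using DirectSum.Decomposition.inductionOn (S.base i).gr with
    | zero => exact ⟨0, by rw [map_zero, TensorProduct.zero_tmul]⟩
    | homogeneous γ =>
      obtain ⟨α, -, hα⟩ := S.exists_homogeneous_comp_eq i (tmul_mem_tensorDegree γ.2 h)
      exact ⟨α, hα⟩
    | add γ δ hγ hδ =>
      obtain ⟨α, hα⟩ := hγ
      obtain ⟨β, hβ⟩ := hδ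
      exact ⟨α + β, by rw [map_add, hα, hβ, TensorProduct.add_tmul]⟩
  | add x y hx hy =>
    obtain ⟨α, rfl⟩ := hx
    obtain ⟨β, rfl⟩ := hy
    exact ⟨α + β, map_add _ _ _⟩

variable {S}

theorem isCoactionOf_iff {α : S.hor} {t : S.hor ⊗[ℂ] H} : S.IsCoactionOf α t ↔
    ∀ i, (S.comp i).rTensor H t = cofreeCoaction (S.BForm i) H (S.comp i α) := by
  refine forall_congr' fun i => ?_
  have hproj : S.horProj i = (S.hIncl i).toLinearMap ∘ₗ S.comp i :=
    LinearMap.ext fun α => (S.hIncl_comp i α).symm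
  rw [← hIncl_comp, coE_hIncl, hproj, LinearMap.rTensor_comp_apply]
  exact (Module.Flat.rTensor_preserves_injective_linearMap (M := H) (S.hIncl i).toLinearMap
    (S.hIncl_injective i)).eq_iff

theorem Agree.hit {i j : I} {x : S.BForm i ⊗[ℂ] H} {y : S.BForm j ⊗[ℂ] H} (h : S.Agree x y)
    (φ : H →ₗ[ℂ] ℂ) : S.Agree ((hit φ).lTensor _ x) ((hit φ).lTensor _ y) := by
  have hslice := congrArg (slice _ φ) (projLeft_coE h)
  simp only [coE_hIncl, slice_rTensor, slice_cofreeCoaction] at hslice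
  exact hslice

theorem exists_isCoactionOf [Finite I] (α : S.hor) : ∃ t, S.IsCoactionOf α t := by
  let b := Module.Basis.ofVectorSpace ℂ H
  have hhit (k) : ∃ β : S.hor, ∀ i, S.comp i β = (hit (b.coord k)).lTensor _ (S.comp i α) :=
    S.exists_of_comp fun i j => (S.agree_comp i j α).hit _
  choose β hβ using hhit
  obtain ⟨s, hs⟩ := (Filter.eventually_all.2 fun i => eventually_sum_slice_coord_eq b
    (cofreeCoaction (S.BForm i) H (S.comp i α))).exists
  refine ⟨∑ k ∈ s, β k ⊗ₜ b k, isCoactionOf_iff.2 fun i => ?_⟩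
  simp only [map_sum, LinearMap.rTensor_tmul, hβ, ← slice_cofreeCoaction]
  exact hs i

end Components

section Gluing

variable {S} {D : S.hor →ₗ[ℂ] S.hor} {L : ∀ i, S.BForm i ⊗[ℂ] H →ₗ[ℂ] S.BForm i ⊗[ℂ] H}

theorem isGluedFrom_iff : S.IsGluedFrom D L ↔ ∀ i α, S.comp i (D α) = L i (S.comp i α) := by
  refine forall₂_congr fun i α => ⟨fun h => ?_, fun h x hx => ?_⟩
  · exact comp_eq_iff.2 (h _ (S.hIncl_comp i α).symm)
  · rw [← comp_eq_iff] at hx ⊢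
    rw [h, hx]

theorem exists_isGluedFrom_of_agree
    (hL : ∀ i j x y, S.Agree x y → S.Agree (L i x) (L j y)) : ∃ D, S.IsGluedFrom D L := by
  choose D hD using fun α : S.hor =>
    S.exists_of_comp (x := fun i => L i (S.comp i α)) fun i j => hL i j _ _ (S.agree_comp i j α)
  refine ⟨{ toFun := D, map_add' := fun α β => ?_, map_smul' := fun c α => ?_ },
    isGluedFrom_iff.2 fun i α => hD α i⟩
  · exact hor_ext fun i => by simp only [hD, map_add]
  · exact hor_ext fun i => by simp only [hD, map_smul, RingHom.id_apply]

theorem PreservesKernels.exists_isGluedFrom (hD : S.PreservesKernels D) :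
    ∃ L, S.IsGluedFrom D L := by
  choose g hg using fun i =>
    (S.comp i).exists_rightInverse_of_surjective (LinearMap.range_eq_top.2 (S.comp_surjective i))
  refine ⟨fun i => S.comp i ∘ₗ D ∘ₗ g i, isGluedFrom_iff.2 fun i α => sub_eq_zero.1 ?_⟩
  change S.comp i (D α) - S.comp i (D (g i (S.comp i α))) = 0
  rw [← map_sub, ← map_sub]
  refine S.comp_eq_zero_iff.2 (hD i _ (S.comp_eq_zero_iff.1 ?_))
  rw [map_sub, sub_eq_zero]
  exact (LinearMap.congr_fun (hg i) _).symm

namespace IsGluedFrom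

variable (hD : S.IsGluedFrom D L)

include hD

theorem unique {D' : S.hor →ₗ[ℂ] S.hor} (hD' : S.IsGluedFrom D' L) : D = D' :=
  LinearMap.ext fun α => hor_ext fun i =>
    (isGluedFrom_iff.1 hD i α).trans (isGluedFrom_iff.1 hD' i α).symm

theorem preservesKernels : S.PreservesKernels D := fun i α hα => by
  rw [← comp_eq_zero_iff] at hα ⊢
  rw [isGluedFrom_iff.1 hD, hα, map_zero]

theorem killsOne_iff : S.KillsOne D ↔ ∀ i, L i 1 = 0 := by
  simp only [← comp_one, ← isGluedFrom_iff.1 hD]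
  exact ⟨fun h i => (congrArg _ h).trans (map_zero _),
    fun h => hor_ext fun i => (h i).trans (map_zero _).symm⟩

theorem raisesDegree_iff : S.RaisesDegree D ↔ ∀ n i, ∀ y ∈ tensorDegree (S.base i).gr H n,
    L i y ∈ tensorDegree (S.base i).gr H (n + 1) := by
  refine forall_congr' fun n => ⟨fun h i y hy => ?_, fun h α hα => ?_⟩
  · obtain ⟨α, hα, rfl⟩ := S.exists_homogeneous_comp_eq i hy
    rw [← isGluedFrom_iff.1 hD]
    exact S.horDegree_iff.1 (h α hα) i
  · refine S.horDegree_iff.2 fun i => ?_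
    rw [isGluedFrom_iff.1 hD]
    exact h i _ (S.horDegree_iff.1 hα i)

theorem rTensor_comp_rTensor (i : I) (t : S.hor ⊗[ℂ] H) :
    (S.comp i).rTensor H (D.rTensor H t) = (L i).rTensor H ((S.comp i).rTensor H t) := by
  have hcomp : S.comp i ∘ₗ D = L i ∘ₗ S.comp i := LinearMap.ext (isGluedFrom_iff.1 hD i)
  rw [← LinearMap.rTensor_comp_apply, hcomp, LinearMap.rTensor_comp_apply]

theorem cofreeCoaction_apply (hcov : S.IsCovariant D) (i : I) (y : S.BForm i ⊗[ℂ] H) :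
    cofreeCoaction _ H (L i y) = (L i).rTensor H (cofreeCoaction _ H y) := by
  obtain ⟨α, rfl⟩ := S.comp_surjective i y
  obtain ⟨t, ht, hDt⟩ := hcov α
  rw [← isGluedFrom_iff.1 hD, ← isCoactionOf_iff.1 hDt, hD.rTensor_comp_rTensor,
    isCoactionOf_iff.1 ht]

theorem isCovariant [Finite I]
    (hL : ∀ i y, cofreeCoaction _ H (L i y) = (L i).rTensor H (cofreeCoaction _ H y)) :
    S.IsCovariant D := fun α => by
  obtain ⟨t, ht⟩ := exists_isCoactionOf α
  refine ⟨t, ht, isCoactionOf_iff.2 fun i => ?_⟩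
  rw [hD.rTensor_comp_rTensor, isCoactionOf_iff.1 ht, isGluedFrom_iff.1 hD, hL]

theorem leftLeibniz_iff : S.LeftLeibniz D ↔ ∀ n i, ∀ γ ∈ (S.base i).gr n, ∀ y,
    L i ((γ ⊗ₜ 1) * y) = ((S.base i).d γ ⊗ₜ 1) * y + (-1 : ℂ) ^ n • ((γ ⊗ₜ 1) * L i y) := by
  have hcomp (n : ℕ) (γ : S.ΓcB) (α : S.hor) : ((D (S.ιc γ * α) : ∀ i, S.E i) =
      S.dPi (S.ιc γ) * α + (-1 : ℂ) ^ n • ((S.ιc γ : ∀ i, S.E i) * D α)) ↔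
      ∀ i, L i ((γ.1 i ⊗ₜ 1) * S.comp i α) = ((S.base i).d (γ.1 i) ⊗ₜ 1) * S.comp i α +
        (-1 : ℂ) ^ n • ((γ.1 i ⊗ₜ 1) * L i (S.comp i α)) := by
    refine funext_iff.trans (forall_congr' fun i => ?_)
    rw [← comp_ιc, ← comp_mul, ← isGluedFrom_iff.1 hD, ← isGluedFrom_iff.1 hD, comp_eq_iff,
      map_add, map_smul, map_mul (S.hIncl i), map_mul (S.hIncl i), hIncl_tmul_one, left_d]
    simp only [hIncl_comp]
    rfl
  refine forall_congr' fun n => ⟨fun h i γ hγ y => ?_, fun h γ hγ α => ?_⟩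
  · obtain ⟨γ', hγ', rfl⟩ := S.exists_homogeneous_lift i hγ
    obtain ⟨α, rfl⟩ := S.comp_surjective i y
    exact (hcomp n γ' α).1 (h γ' hγ' α) i
  · exact (hcomp n γ α).2 fun i => h i _ (hγ i) _

theorem rightLeibniz_iff : S.RightLeibniz D ↔ ∀ n i, ∀ y ∈ tensorDegree (S.base i).gr H n, ∀ γ,
    L i (y * (γ ⊗ₜ 1)) = L i y * (γ ⊗ₜ 1) + (-1 : ℂ) ^ n • (y * ((S.base i).d γ ⊗ₜ 1)) := by
  have hcomp (n : ℕ) (α : S.hor) (γ : S.ΓcB) : ((D (α * S.ιc γ) : ∀ i, S.E i) =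
      (D α : ∀ i, S.E i) * S.ιc γ + (-1 : ℂ) ^ n • ((α : ∀ i, S.E i) * S.dPi (S.ιc γ))) ↔
      ∀ i, L i (S.comp i α * (γ.1 i ⊗ₜ 1)) = L i (S.comp i α) * (γ.1 i ⊗ₜ 1) +
        (-1 : ℂ) ^ n • (S.comp i α * ((S.base i).d (γ.1 i) ⊗ₜ 1)) := by
    refine funext_iff.trans (forall_congr' fun i => ?_)
    rw [← comp_ιc, ← comp_mul, ← isGluedFrom_iff.1 hD, ← isGluedFrom_iff.1 hD, comp_eq_iff,
      map_add, map_smul, map_mul (S.hIncl i), map_mul (S.hIncl i), hIncl_tmul_one, left_d]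
    simp only [hIncl_comp]
    rfl
  refine forall_congr' fun n => ⟨fun h i y hy γ => ?_, fun h α hα γ => ?_⟩
  · obtain ⟨α, hα, rfl⟩ := S.exists_homogeneous_comp_eq i hy
    obtain ⟨γ', rfl⟩ := S.base_surjective i γ
    exact (hcomp n α ⟨γ'.1, S.ΓB_le_ΓcB γ'.2⟩).1 (h α hα _) i
  · exact (hcomp n α γ).2 fun i => h i _ (S.horDegree_iff.1 hα i) _

theorem exists_family (hdeg : S.RaisesDegree D) (hcov : S.IsCovariant D) :
    ∃ A : S.LocalFamily,
      ∀ i h, L i (1 ⊗ₜ h) = -(S.formOf A i).rTensor H (Coalgebra.comul h) := by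
  let f (i : I) : H →ₗ[ℂ] S.BForm i :=
    slice _ Coalgebra.counit ∘ₗ L i ∘ₗ TensorProduct.mk ℂ (S.BForm i) H 1
  have hf (i : I) (h : H) : f i h ∈ (S.base i).gr 1 :=
    slice_mem_of_mem_tensorDegree (hD.raisesDegree_iff.1 hdeg 0 i _
      (tmul_mem_tensorDegree (SetLike.one_mem_graded _) h)) _
  refine ⟨fun i => -(f i).codRestrict _ (hf i), fun i h => ?_⟩
  rw [eq_slice_counit_of_colinear (hD.cofreeCoaction_apply hcov i), ← LinearMap.neg_apply,
    ← LinearMap.rTensor_neg]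
  congr 2
  exact (neg_neg (f i)).symm

end IsGluedFrom

end Gluing

section Correspondence

variable {S} {D : S.hor →ₗ[ℂ] S.hor} {A : S.LocalFamily}

theorem IsFamilyOf.unique {A' : S.LocalFamily} (h : S.IsFamilyOf D A) (h' : S.IsFamilyOf D A') :
    A = A' := by
  refine funext fun i => LinearMap.ext fun k => Subtype.ext ?_
  obtain ⟨α, hα⟩ := S.comp_surjective i (1 ⊗ₜ k)
  have hαD := (S.hIncl_comp i (D α)).symm
  exact (h i k α _ (comp_eq_iff.1 hα) hαD).trans (h' i k α _ (comp_eq_iff.1 hα) hαD).symm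

namespace IsConnectionProduct

variable {m : ∀ i, S.BForm i →ₗ[ℂ] S.BForm i →ₗ[ℂ] S.BForm i} (hm : S.IsConnectionProduct m)

include hm

theorem localDer_formOf_one (i : I) : S.localDer (m i) (S.formOf A i) 1 = 0 ↔ A i 1 = 0 := by
  rw [Algebra.TensorProduct.one_def, hm.localDer_one_tmul, Bialgebra.comul_one,
    Algebra.TensorProduct.one_def, LinearMap.rTensor_tmul, neg_eq_zero]
  refine ⟨fun h => Subtype.ext ?_, fun h => ?_⟩
  · have := congrArg (slice _ Coalgebra.counit) h
    rwa [slice_tmul, Bialgebra.counit_one, one_smul, map_zero] at this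
  · rw [formOf, LinearMap.comp_apply, h, map_zero, TensorProduct.zero_tmul]

section

variable (hD : S.IsGluedFrom D fun i => S.localDer (m i) (S.formOf A i))

include hD

theorem isFamilyOf : S.IsFamilyOf D A := by
  intro i h α y hα hy
  have hDα : y = S.localDer (m i) (S.formOf A i) (1 ⊗ₜ h) :=
    S.hIncl_injective i (hy.symm.trans (hD i α _ hα))
  rw [hDα, hm.localDer_one_tmul, map_neg, neg_neg]
  exact (slice_counit_rTensor_comul _ h).symm

theorem raisesDegree : S.RaisesDegree D :=
  hD.raisesDegree_iff.2 fun _ i _ hy => hm.localDer_mem_tensorDegree (fun h => (A i h).2) hy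

theorem killsOne_iff : S.KillsOne D ↔ ∀ i, A i 1 = 0 :=
  hD.killsOne_iff.trans (forall_congr' hm.localDer_formOf_one)

theorem isCompatible [Finite I] (hone : S.KillsOne D) : S.IsCompatible A := by
  refine ⟨(hm.killsOne_iff hD).1 hone, fun i j => ?_⟩
  refine (hm.agree_localDer_one_tmul_iff _ _).1 fun h => ?_
  obtain ⟨α, -, hα⟩ := S.exists_comp_eq_overlapSect i h
  have hagree := S.agree_comp i j (D α)
  rwa [isGluedFrom_iff.1 hD, isGluedFrom_iff.1 hD, hα, hα, overlapSect_self] at hagree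

end

theorem exists_equiv {p : (S.hor →ₗ[ℂ] S.hor) → Prop} {q : S.LocalFamily → Prop}
    (hpq : ∀ {D A}, S.IsGluedFrom D (fun i => S.localDer (m i) (S.formOf A i)) → (p D ↔ q A))
    (hp : ∀ D, p D → ∃ A, S.IsGluedFrom D fun i => S.localDer (m i) (S.formOf A i))
    (hq : ∀ A, q A → ∃ D, S.IsGluedFrom D fun i => S.localDer (m i) (S.formOf A i)) :
    ∃ e : {D // p D} ≃ {A // q A}, ∀ D, S.IsFamilyOf D.1 (e D).1 ∧
      S.IsGluedFrom D.1 fun i => S.localDer (m i) (S.formOf (e D).1 i) := by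
  choose A hA using hp
  let F (D : {D // p D}) : {A // q A} := ⟨A D.1 D.2, (hpq (hA D.1 D.2)).1 D.2⟩
  have hinj : Function.Injective F := fun D D' h => by
    have hD' := hA D'.1 D'.2
    rw [← show A D.1 D.2 = A D'.1 D'.2 from congrArg Subtype.val h] at hD'
    exact Subtype.ext ((hA D.1 D.2).unique hD')
  have hsurj : Function.Surjective F := fun ⟨A', hA'⟩ => by
    obtain ⟨D, hD⟩ := hq A' hA'
    have hpD : p D := (hpq hD).2 hA'
    exact ⟨⟨D, hpD⟩, Subtype.ext ((hm.isFamilyOf (hA D hpD)).unique (hm.isFamilyOf hD))⟩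
  exact ⟨Equiv.ofBijective F ⟨hinj, hsurj⟩, fun D => ⟨hm.isFamilyOf (hA D.1 D.2), hA D.1 D.2⟩⟩

end IsConnectionProduct

theorem IsLeftCovDer.exists_isGluedFrom (hD : S.IsLeftCovDer D) :
    ∃ A : S.LocalFamily, S.IsGluedFrom D fun i => S.localDer (S.leftMul i) (S.formOf A i) := by
  obtain ⟨L, hL⟩ := hD.map_ker.exists_isGluedFrom
  obtain ⟨A, hA⟩ := hL.exists_family hD.degree hD.covariant
  refine ⟨A, ?_⟩
  suffices L = fun i => S.localDer (S.leftMul i) (S.formOf A i) from this ▸ hL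
  refine funext fun i => TensorProduct.ext' fun γ h => ?_
  induction γ using DirectSum.Decomposition.inductionOn (S.base i).gr with
  | zero => rw [TensorProduct.zero_tmul, map_zero, map_zero]
  | homogeneous γ =>
    have htmul : γ.1 ⊗ₜ[ℂ] h = (γ.1 ⊗ₜ 1) * (1 ⊗ₜ h) := by
      rw [Algebra.TensorProduct.tmul_mul_tmul, mul_one, one_mul]
    rw [htmul, hL.leftLeibniz_iff.1 hD.leibniz _ i _ γ.2, localDer_leftMul_mul,
      DiffCalculus.parity_apply _ γ.2, hA, S.isConnectionProduct_leftMul.localDer_one_tmul,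
      ← TensorProduct.smul_tmul', smul_mul_assoc]
  | add γ δ hγ hδ => rw [TensorProduct.add_tmul, map_add, map_add, hγ, hδ]

variable [Finite I]

theorem IsRightCovDer.exists_isGluedFrom (hD : S.IsRightCovDer D) :
    ∃ A : S.LocalFamily, S.IsGluedFrom D fun i => S.localDer (S.rightMul i) (S.formOf A i) := by
  obtain ⟨L, hL⟩ := hD.map_ker.exists_isGluedFrom
  obtain ⟨A, hA⟩ := hL.exists_family hD.degree hD.covariant
  refine ⟨A, ?_⟩
  suffices L = fun i => S.localDer (S.rightMul i) (S.formOf A i) from this ▸ hL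
  refine funext fun i => TensorProduct.ext' fun γ h => ?_
  have hone : (1 : S.BForm i) ⊗ₜ[ℂ] h ∈ tensorDegree (S.base i).gr H 0 :=
    tmul_mem_tensorDegree (SetLike.one_mem_graded _) h
  have htmul : γ ⊗ₜ[ℂ] h = (1 ⊗ₜ h) * (γ ⊗ₜ 1) := by
    rw [Algebra.TensorProduct.tmul_mul_tmul, mul_one, one_mul]
  rw [htmul, hL.rightLeibniz_iff.1 hD.leibniz 0 i _ hone, localDer_rightMul_mul,
    DiffCalculus.rTensor_parity _ hone, hA, S.isConnectionProduct_rightMul.localDer_one_tmul,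
    smul_mul_assoc]

theorem isLeftCovDer_iff
    (hD : S.IsGluedFrom D fun i => S.localDer (S.leftMul i) (S.formOf A i)) :
    S.IsLeftCovDer D ↔ S.IsCompatible A := by
  have hm := S.isConnectionProduct_leftMul
  refine ⟨fun h => hm.isCompatible hD h.map_one, fun hA => ?_⟩
  refine ⟨hm.raisesDegree hD, (hm.killsOne_iff hD).2 hA.map_one, ?_,
    hD.isCovariant fun i => S.cofreeCoaction_localDer _ _, hD.preservesKernels⟩
  refine hD.leftLeibniz_iff.2 fun n i γ hγ y => ?_
  rw [localDer_leftMul_mul, DiffCalculus.parity_apply _ hγ, ← TensorProduct.smul_tmul',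
    smul_mul_assoc]

theorem isRightCovDer_iff
    (hD : S.IsGluedFrom D fun i => S.localDer (S.rightMul i) (S.formOf A i)) :
    S.IsRightCovDer D ↔ S.IsCompatible A := by
  have hm := S.isConnectionProduct_rightMul
  refine ⟨fun h => hm.isCompatible hD h.map_one, fun hA => ?_⟩
  refine ⟨hm.raisesDegree hD, (hm.killsOne_iff hD).2 hA.map_one, ?_,
    hD.isCovariant fun i => S.cofreeCoaction_localDer _ _, hD.preservesKernels⟩
  refine hD.rightLeibniz_iff.2 fun n i y hy γ => ?_
  rw [localDer_rightMul_mul, DiffCalculus.rTensor_parity _ hy, smul_mul_assoc]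

theorem IsCompatible.exists_isGluedFrom_leftMul (hA : S.IsCompatible A) :
    ∃ D, S.IsGluedFrom D fun i => S.localDer (S.leftMul i) (S.formOf A i) :=
  exists_isGluedFrom_of_agree fun i j _ _ => agree_localDer_leftMul
    ((S.isConnectionProduct_leftMul.agree_localDer_one_tmul_iff _ _).2 (hA.gauge i j))

theorem IsCompatible.exists_isGluedFrom_rightMul (hA : S.IsCompatible A) :
    ∃ D, S.IsGluedFrom D fun i => S.localDer (S.rightMul i) (S.formOf A i) :=
  exists_isGluedFrom_of_agree fun i j _ _ => agree_localDer_rightMul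
    ((S.isConnectionProduct_rightMul.agree_localDer_one_tmul_iff _ _).2 (hA.gauge i j))

end Correspondence

end DiffStructure

end QuantumBundle

end

theorem proposition10 {H B P I : Type*} [Finite I] [Ring H] [HopfAlgebra ℂ H]
    [Ring B] [Algebra ℂ B] [Ring P] [Algebra ℂ P]
    (X : QuantumBundle.Bundle H B P I) (S : QuantumBundle.DiffStructure X) :
    (∃ e : {D : S.hor →ₗ[ℂ] S.hor // S.IsLeftCovDer D} ≃
        {A : S.LocalFamily // S.IsCompatible A},
      ∀ D, S.IsFamilyOf D.1 (e D).1 ∧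
        S.IsGluedFrom D.1 (fun i => S.localLeft (S.formOf (e D).1 i))) ∧
    (∃ e : {D : S.hor →ₗ[ℂ] S.hor // S.IsRightCovDer D} ≃
        {A : S.LocalFamily // S.IsCompatible A},
      ∀ D, S.IsFamilyOf D.1 (e D).1 ∧
        S.IsGluedFrom D.1 (fun i => S.localRight (S.formOf (e D).1 i))) := by
  simp only [S.localLeft_eq_localDer, S.localRight_eq_localDer]
  exact ⟨S.isConnectionProduct_leftMul.exists_equiv S.isLeftCovDer_iff
      (fun _ hD => hD.exists_isGluedFrom) fun _ hA => hA.exists_isGluedFrom_leftMul,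
    S.isConnectionProduct_rightMul.exists_equiv S.isRightCovDer_iff
      (fun _ hD => hD.exists_isGluedFrom) fun _ hA => hA.exists_isGluedFrom_rightMul⟩
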